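/- Let $\mathfrak{ham}_2$ be the topological Lie algebra of formal Hamiltonian vector fields on $\mathbb{R}^2$. It is identified with $\mathbb{R}[[x,y]]/\mathbb{R}$, with the Poisson bracket $\{f,g\}=f_xg_y-f_yg_x$ and the topology of coefficientwise convergence, by letting $H$ correspond to $H_x\,\partial_y-H_y\,\partial_x$. Let $\mathfrak{ham}_2^0\subset\mathfrak{ham}_2$ be the subalgebra of vector fields without constant term (vanishing at the origin), and let $\mathfrak{sp}(2,\mathbb{R})\subset\mathfrak{ham}_2^0$ be the linear vector fields (quadratic $H$). A homogeneous Hamiltonian of degree $d$ has weight $d-2$. A continuous alternating $k$-form has weight $w$ if it vanishes on all $k$-tuples of homogeneous Hamiltonians whose weights do not add up to $w$. For $\mathfrak g\in\{\mathfrak{ham}_2,\mathfrak{ham}_2^0\}$, let $H^k_{GF}(\mathfrak g,\mathfrak{sp}(2,\mathbb{R}))_w$ be the degree $k$ cohomology, with trivial real coefficients, of the complex of continuous alternating forms of weight $w$ on $\mathfrak g$ that are $\mathfrak{sp}(2,\mathbb{R})$-invariant and vanish when an argument lies in $\mathfrak{sp}(2,\mathbb{R})$, with the Chevalley-Eilenberg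 differential. Classes for $\mathfrak{ham}_2^0$ are called leaf cohomology classes. For $X=f_1\partial_{x}+f_2\partial_{y}$ and $(x_1,x_2)=(x,y)$ put $\delta^i(X)=f_i(0)$ and $\delta^i_j(X)=-\frac{\partial f_i}{\partial x_j}(0)$. Let $\omega=\delta^1\wedge\delta^2$, let $\Omega^i_j=d\delta^i_j+\sum_k\delta^i_k\wedge\delta^k_j$ be the curvature, and let $p_1=-\frac1{8\pi^2}\sum_{i,j}\Omega^i_j\wedge\Omega^j_i$ be the first Pontrjagin form. For a form $f$ on $\mathfrak{ham}^0_2$ let $f\wedge\omega$ be the form on $\mathfrak{ham}_2$ obtained by extending $f$ to $\mathfrak{ham}_2$ and multiplying by $\omega$; it does not depend on the extension. **Theorem.** (1) For every integer $w\le 10$ and every $k\ge 0$, $H^k_{GF}(\mathfrak{ham}^0_2,\mathfrak{sp}(2,\mathbb{R}))_w=0$ unless $(k,w)\in\{(0,0),(2,2),(5,10)\}$, and in these three cases it is one-dimensional. (2) Each of the spaces $H^2_{GF}(\mathfrak{ham}_2,\mathfrak{sp}(2,\mathbb{R}))_{-2}$, $H^4_{GF}(\mathfrak{ham}_2,\mathfrak{sp}(2,\mathbb{R}))_{0}$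 and $H^7_{GF}(\mathfrak{ham}_2,\mathfrak{sp}(2,\mathbb{R}))_{8}$ is one-dimensional. The forms $\omega$ and $p_1$ are relative cocycles whose classes span the first and the second; a generator of the third, which is unique up to a nonzero factor, is called the Gel'fand-Kalinin-Fuks class $GKF$. The product $f\mapsto f\wedge\omega$ induces isomorphisms $$H^0_{GF}(\mathfrak{ham}^0_2,\mathfrak{sp}(2,\mathbb{R}))_{0}\to H^2_{GF}(\mathfrak{ham}_2,\mathfrak{sp}(2,\mathbb{R}))_{-2}=\mathbb{R}\langle\omega\rangle,$$ $$H^2_{GF}(\mathfrak{ham}^0_2,\mathfrak{sp}(2,\mathbb{R}))_{2}\to H^4_{GF}(\mathfrak{ham}_2,\mathfrak{sp}(2,\mathbb{R}))_{0}=\mathbb{R}\langle p_1\rangle,$$ $$H^5_{GF}(\mathfrak{ham}^0_2,\mathfrak{sp}(2,\mathbb{R}))_{10}\to H^7_{GF}(\mathfrak{ham}_2,\mathfrak{sp}(2,\mathbb{R}))_{8}=\mathbb{R}\langle GKF\rangle.$$ (3) Hence there are unique leaf cohomology classes $\gamma_1\in H^2_{GF}(\mathfrak{ham}^0_2,\mathfrak{sp}(2,\mathbb{R}))_{2}$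 and $\eta\in H^5_{GF}(\mathfrak{ham}^0_2,\mathfrak{sp}(2,\mathbb{R}))_{10}$ such that $p_1=\gamma_1\wedge\omega$ and $GKF=\eta\wedge\omega$. -/

import Mathlib

open scoped MvPowerSeries.WithPiTopology

noncomputable section

/-! ### Continuous relative cohomology of a topological Lie algebra, by weights -/

namespace GelfandFuks

/-- The subquotient `Z / (B ∩ Z)` of a vector space. -/
abbrev Subquotient {A : Type*} [AddCommGroup A] [Module ℝ A] (Z B : Submodule ℝ A) : Type _ :=
  Z ⧸ B.submoduleOf Z

section Complex

variable {L : Type*} [LieRing L] [LieAlgebra ℝ L]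

/-- The Chevalley-Eilenberg differential on alternating forms with trivial coefficients.
In positive degree it is `-1/2` times the sum over all ordered pairs of distinct indices;
the usual formula, a sum over `i < j`, is `differential_apply` below. -/
def differential :
    (k : ℕ) → (L [⋀^Fin k]→ₗ[ℝ] ℝ) →ₗ[ℝ] (L [⋀^Fin (k + 1)]→ₗ[ℝ] ℝ)
  | 0 => 0
  | _ + 1 =>
    { toFun := fun f => (-(1 / 2) : ℝ) • AlternatingMap.alternatizeUncurryFin
        (AlternatingMap.alternatizeUncurryFinLM ∘ₗ
          ((LieModule.toEnd ℝ L L : L →ₗ[ℝ] L →ₗ[ℝ] L).compr₂ f.curryLeft))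
      map_add' := fun f g => by
        ext v
        simp [AlternatingMap.alternatizeUncurryFin_apply, Finset.sum_add_distrib, mul_add]
      map_smul' := fun c f => by
        ext v
        simp only [AlternatingMap.alternatizeUncurryFin_apply, AlternatingMap.smul_apply,
          LinearMap.comp_apply, AlternatingMap.alternatizeUncurryFinLM_apply,
          LinearMap.compr₂_apply, AlternatingMap.curryLeft_smul, LinearMap.smul_apply,
          Finset.smul_sum, RingHom.id_apply]
        refine Finset.sum_congr rfl fun i _ => Finset.sum_congr rfl fun j _ => ?_
        simp only [smul_eq_mul, zsmul_eq_mul]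
        ring }

/-- `df (v₀, …, v_{k+1}) = ∑_{p < q} (-1)^(p+q) f ([v_p, v_q], v₀, …, v̂_p, …, v̂_q, …)`.
Pairs `p < q` are written `p = i`, `q = j + 1` with `i ≤ j`. -/
theorem differential_apply {k : ℕ} (f : L [⋀^Fin (k + 1)]→ₗ[ℝ] ℝ) (v : Fin (k + 2) → L) :
    differential (k + 1) f v = ∑ i : Fin (k + 1), ∑ j ≥ i,
      (-1 : ℝ) ^ ((i : ℕ) + ((j : ℕ) + 1)) *
        f (Matrix.vecCons ⁅v i.castSucc, v j.succ⁆
          (j.removeNth (i.castSucc.removeNth v))) := by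
  change (-(1 / 2) : ℝ) • AlternatingMap.alternatizeUncurryFin
        (AlternatingMap.alternatizeUncurryFinLM ∘ₗ
          ((LieModule.toEnd ℝ L L : L →ₗ[ℝ] L →ₗ[ℝ] L).compr₂ f.curryLeft)) v = _
  rw [AlternatingMap.alternatizeUncurryFin_alternatizeUncurryFinLM_comp_apply, Finset.smul_sum]
  refine Finset.sum_congr rfl fun i _ => ?_
  rw [Finset.smul_sum]
  refine Finset.sum_congr rfl fun j _ => ?_
  have h : f.curryLeft ⁅v j.succ, v i.castSucc⁆ = - f.curryLeft ⁅v i.castSucc, v j.succ⁆ := by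
    rw [← lie_skew, map_neg]
  simp only [LinearMap.compr₂_apply, LieHom.coe_toLinearMap, LieModule.toEnd_apply_apply, h,
    AlternatingMap.neg_apply, AlternatingMap.curryLeft_apply_apply, smul_eq_mul, zsmul_eq_mul]
  push_cast
  ring

/-- The wedge product of alternating forms (sum over shuffles). -/
def wedge {p q : ℕ} (a : L [⋀^Fin p]→ₗ[ℝ] ℝ) (b : L [⋀^Fin q]→ₗ[ℝ] ℝ) :
    L [⋀^Fin (p + q)]→ₗ[ℝ] ℝ :=
  ((LinearMap.mul' ℝ ℝ).compAlternatingMap (a.domCoprod b)).domDomCongr finSumFinEquiv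

variable [TopologicalSpace L]

/-- The cochains of degree `k` and weight `w` of `L` relative to the Lie subalgebra `K`, where
`W j` is the homogeneous part of weight `j` of `L`: continuous alternating `k`-linear forms that
vanish as soon as one argument lies in `K`, that are `K`-invariant, and that
vanish on homogeneous arguments whose weights do not sum to `w`. -/
def cochains (K : LieSubalgebra ℝ L) (W : ℤ → Submodule ℝ L) (k : ℕ) (w : ℤ) :
    Submodule ℝ (L [⋀^Fin k]→ₗ[ℝ] ℝ) where
  carrier := {f | Continuous (fun v : Fin k → L => f v) ∧
    (∀ v : Fin k → L, (∃ i, v i ∈ K) → f v = 0) ∧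
    (∀ x ∈ K, ∀ v : Fin k → L, ∑ i, f (Function.update v i ⁅x, v i⁆) = 0) ∧
    (∀ (a : Fin k → ℤ) (v : Fin k → L), (∀ i, v i ∈ W (a i)) → ∑ i, a i ≠ w → f v = 0)}
  zero_mem' := by
    refine ⟨?_, ?_, ?_, ?_⟩
    · simpa using continuous_const
    all_goals simp
  add_mem' := by
    rintro f g ⟨f1, f2, f3, f4⟩ ⟨g1, g2, g3, g4⟩
    refine ⟨?_, fun v hv => ?_, fun x hx v => ?_, fun a v hv ha => ?_⟩
    · exact f1.add g1
    · simp [f2 v hv, g2 v hv]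
    · simp [Finset.sum_add_distrib, f3 x hx v, g3 x hx v]
    · simp [f4 a v hv ha, g4 a v hv ha]
  smul_mem' := by
    rintro c f ⟨f1, f2, f3, f4⟩
    refine ⟨?_, fun v hv => ?_, fun x hx v => ?_, fun a v hv ha => ?_⟩
    · exact f1.const_smul c
    · simp [f2 v hv]
    · simp [← Finset.mul_sum, f3 x hx v]
    · simp [f4 a v hv ha]

/-- Relative cocycles of degree `k` and weight `w`. -/
def cocycles (K : LieSubalgebra ℝ L) (W : ℤ → Submodule ℝ L) (k : ℕ) (w : ℤ) :
    Submodule ℝ (L [⋀^Fin k]→ₗ[ℝ] ℝ) :=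
  cochains K W k w ⊓ LinearMap.ker (differential k)

/-- Relative coboundaries of degree `k` and weight `w`. -/
def coboundaries (K : LieSubalgebra ℝ L) (W : ℤ → Submodule ℝ L) :
    (k : ℕ) → (w : ℤ) → Submodule ℝ (L [⋀^Fin k]→ₗ[ℝ] ℝ)
  | 0, _ => ⊥
  | k + 1, w => (cochains K W k w).map (differential k)

/-- The weight `w` part of the degree `k` relative continuous cohomology of `(L, K)`. -/
abbrev Cohomology (K : LieSubalgebra ℝ L) (W : ℤ → Submodule ℝ L) (k : ℕ) (w : ℤ) : Type _ :=
  Subquotient (cocycles K W k w) (coboundaries K W k w)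

/-- The cohomology class of a cocycle. -/
def cohomologyClass {K : LieSubalgebra ℝ L} {W : ℤ → Submodule ℝ L} {k : ℕ} {w : ℤ}
    (z : L [⋀^Fin k]→ₗ[ℝ] ℝ) (hz : z ∈ cocycles K W k w) : Cohomology K W k w :=
  Submodule.Quotient.mk ⟨z, hz⟩

end Complex

/-! ### Formal Hamiltonian vector fields on the plane -/

/-- Formal power series in `x` (the variable `0`) and `y` (the variable `1`). -/
abbrev Series : Type := MvPowerSeries (Fin 2) ℝ

/-- The formal partial derivative; `∂ 0` is `∂/∂x` and `∂ 1` is `∂/∂y`. -/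
def partialDeriv (i : Fin 2) (f : Series) : Series := MvPowerSeries.pderiv ℝ i f

/-- The value of a series at the origin. -/
def atOrigin (f : Series) : ℝ := MvPowerSeries.constantCoeff f

/-- The Poisson bracket `{f, g} = f_x g_y - f_y g_x`. -/
def poisson (f g : Series) : Series :=
  partialDeriv 0 f * partialDeriv 1 g - partialDeriv 1 f * partialDeriv 0 g

/-- The space `ℝ[[x, y]] / ℝ` of formal Hamiltonian functions up to constants: each class is
represented by its member without constant term. It carries the topology of coefficientwise
convergence. The Hamiltonian `H` stands for the vector field `H_x ∂/∂y - H_y ∂/∂x`. -/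
abbrev Ham : Type :=
  LinearMap.ker (MvPowerSeries.coeff (R := ℝ) (0 : Fin 2 →₀ ℕ))

theorem partialDeriv_add (i : Fin 2) (f g : Series) :
    partialDeriv i (f + g) = partialDeriv i f + partialDeriv i g := map_add _ _ _

theorem partialDeriv_sub (i : Fin 2) (f g : Series) :
    partialDeriv i (f - g) = partialDeriv i f - partialDeriv i g := map_sub _ _ _

theorem partialDeriv_smul (i : Fin 2) (c : ℝ) (f : Series) :
    partialDeriv i (c • f) = c • partialDeriv i f := Derivation.map_smul _ _ _

theorem partialDeriv_mul (i : Fin 2) (f g : Series) :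
    partialDeriv i (f * g) = partialDeriv i f * g + f * partialDeriv i g := by
  simp only [partialDeriv, Derivation.leibniz, smul_eq_mul]
  ring

theorem partialDeriv_C (i : Fin 2) (c : ℝ) :
    partialDeriv i (MvPowerSeries.C c : Series) = 0 :=
  MvPowerSeries.pderivFun_C c

theorem partialDeriv_comm (i j : Fin 2) (f : Series) :
    partialDeriv i (partialDeriv j f) = partialDeriv j (partialDeriv i f) := by
  ext n
  simp only [partialDeriv, MvPowerSeries.coeff_pderiv, Finsupp.add_apply]
  rw [add_right_comm]
  by_cases h : i = j
  · subst h; rfl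
  · simp [h, Ne.symm h]
    ring

/-- The representative without constant term of a series modulo constants. -/
def normalize (f : Series) : Ham :=
  ⟨f - MvPowerSeries.C (atOrigin f), by simp [atOrigin]⟩

theorem partialDeriv_normalize (i : Fin 2) (f : Series) :
    partialDeriv i (normalize f : Series) = partialDeriv i f := by
  simp [normalize, partialDeriv_sub, partialDeriv_C]

theorem poisson_normalize_left (f g : Series) : poisson (normalize f) g = poisson f g := by
  simp [poisson, partialDeriv_normalize]

theorem poisson_normalize_right (f g : Series) : poisson f (normalize g) = poisson f g := by
  simp [poisson, partialDeriv_normalize]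

theorem normalize_add (f g : Series) : normalize (f + g) = normalize f + normalize g := by
  ext1
  simp only [normalize, atOrigin, map_add, Submodule.coe_add]
  ring

theorem normalize_smul (c : ℝ) (f : Series) : normalize (c • f) = c • normalize f := by
  ext1
  simp [normalize, atOrigin, smul_sub, MvPowerSeries.smul_eq_C_mul]

theorem normalize_zero : normalize 0 = 0 := by
  ext1
  simp [normalize, atOrigin]

/-- The Lie algebra of formal Hamiltonian vector fields, with the Poisson bracket (taken modulo
constants). -/
instance instLieRingHam : LieRing Ham where
  bracket f g := normalize (poisson f g)
  add_lie f g h := by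
    change normalize _ = normalize _ + normalize _
    rw [← normalize_add]
    congr 1
    simp only [poisson, Submodule.coe_add, partialDeriv_add]
    ring
  lie_add f g h := by
    change normalize _ = normalize _ + normalize _
    rw [← normalize_add]
    congr 1
    simp only [poisson, Submodule.coe_add, partialDeriv_add]
    ring
  lie_self f := by
    change normalize _ = 0
    rw [← normalize_zero]
    congr 1
    simp only [poisson]
    ring
  leibniz_lie f g h := by
    change normalize (poisson _ (normalize _)) =
      normalize (poisson (normalize _) _) + normalize (poisson _ (normalize _))
    rw [← normalize_add, poisson_normalize_left, poisson_normalize_right,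
      poisson_normalize_right]
    congr 1
    simp only [poisson, partialDeriv_sub, partialDeriv_mul, partialDeriv_comm 1 0]
    ring

instance instLieAlgebraHam : LieAlgebra ℝ Ham where
  lie_smul c f g := by
    change normalize _ = c • normalize _
    rw [← normalize_smul]
    congr 1
    simp only [poisson, Submodule.coe_smul, partialDeriv_smul, mul_smul_comm, smul_sub]

theorem bracket_def (f g : Ham) : ⁅f, g⁆ = normalize (poisson f g) := rfl

theorem partialDeriv_bracket (i : Fin 2) (f g : Ham) :
    partialDeriv i (⁅f, g⁆ : Ham) = partialDeriv i (poisson f g) :=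
  partialDeriv_normalize i _

/-- The part of weight `j`: homogeneous Hamiltonian functions of degree `j + 2`. -/
def weightPart (j : ℤ) : Submodule ℝ Ham where
  carrier := {f | ∀ m : Fin 2 →₀ ℕ, (m.degree : ℤ) ≠ j + 2 →
    MvPowerSeries.coeff m (f : Series) = 0}
  zero_mem' := by simp
  add_mem' := by
    intro f g hf hg m hm
    simp [hf m hm, hg m hm]
  smul_mem' := by
    intro c f hf m hm
    simp [hf m hm]

theorem coeff_partialDeriv_of_mem {j : ℤ} {f : Ham} (hf : f ∈ weightPart j) (i : Fin 2)
    {m : Fin 2 →₀ ℕ} (hm : (m.degree : ℤ) ≠ j + 1) :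
    MvPowerSeries.coeff m (partialDeriv i (f : Series)) = 0 := by
  rw [partialDeriv, MvPowerSeries.coeff_pderiv, hf, zero_mul]
  rw [map_add, Finsupp.degree_single]
  push_cast
  omega

theorem bracket_mem_weightPart {i j : ℤ} {f g : Ham} (hf : f ∈ weightPart i)
    (hg : g ∈ weightPart j) : ⁅f, g⁆ ∈ weightPart (i + j) := by
  classical
  have key : ∀ (a b : Fin 2) (m : Fin 2 →₀ ℕ), (m.degree : ℤ) ≠ i + j + 2 →
      MvPowerSeries.coeff m (partialDeriv a (f : Series) * partialDeriv b (g : Series)) = 0 := by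
    intro a b m hm
    rw [MvPowerSeries.coeff_mul]
    refine Finset.sum_eq_zero fun p hp => ?_
    rw [Finset.HasAntidiagonal.mem_antidiagonal] at hp
    by_cases h : (p.1.degree : ℤ) = i + 1
    · rw [coeff_partialDeriv_of_mem hg, mul_zero]
      rw [← hp, map_add] at hm
      push_cast at hm
      omega
    · rw [coeff_partialDeriv_of_mem hf a h, zero_mul]
  intro m hm
  by_cases h0 : m = 0
  · subst h0
    exact LinearMap.mem_ker.mp (⁅f, g⁆ : Ham).2
  · simp [bracket_def, normalize, poisson, MvPowerSeries.coeff_C, h0, key _ _ m hm]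

/-- `sp(2, ℝ)` inside all formal Hamiltonian vector fields: the linear ones, that is, those with a
homogeneous quadratic Hamiltonian. -/
def sp : LieSubalgebra ℝ Ham :=
  { weightPart 0 with
    lie_mem' := fun hf hg => by simpa using bracket_mem_weightPart hf hg }

/-- The Hamiltonian vector fields without constant term: those that vanish at the origin. -/
def ham0 : LieSubalgebra ℝ Ham where
  carrier := {f | ∀ i : Fin 2, atOrigin (partialDeriv i (f : Series)) = 0}
  zero_mem' := fun i => by simp [partialDeriv, atOrigin]
  add_mem' := by
    intro f g hf hg i
    have h1 := hf i
    have h2 := hg i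
    simp only [atOrigin] at h1 h2 ⊢
    simp [partialDeriv_add, h1, h2]
  smul_mem' := by
    intro c f hf i
    have h1 := hf i
    simp only [atOrigin] at h1 ⊢
    rw [Submodule.coe_smul, partialDeriv_smul, MvPowerSeries.smul_eq_C_mul, map_mul, h1, mul_zero]
  lie_mem' := by
    intro f g hf hg i
    have f0 := hf 0
    have f1 := hf 1
    have g0 := hg 0
    have g1 := hg 1
    simp only [atOrigin] at f0 f1 g0 g1 ⊢
    rw [partialDeriv_bracket]
    simp [poisson, partialDeriv_sub, partialDeriv_mul, f0, f1, g0, g1]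

/-- `sp(2, ℝ)` as a subalgebra of `ham0`. -/
def sp0 : LieSubalgebra ℝ ham0 := sp.comap ham0.incl

/-- The weight grading of `ham0`. -/
def weightPart0 (j : ℤ) : Submodule ℝ ham0 := (weightPart j).comap ham0.toSubmodule.subtype

/-- `H^k_GF(ham_2, sp(2, ℝ))_w`. -/
abbrev HamCohomology (k : ℕ) (w : ℤ) : Type := Cohomology sp weightPart k w

/-- `H^k_GF(ham_2^0, sp(2, ℝ))_w`; its elements are the leaf cohomology classes. -/
abbrev LeafCohomology (k : ℕ) (w : ℤ) : Type := Cohomology sp0 weightPart0 k w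

/-! ### The symplectic class, the first Pontrjagin class, and the product with `ω` -/

/-- A linear functional as a form of degree one. -/
def oneForm (φ : Ham →ₗ[ℝ] ℝ) : Ham [⋀^Fin 1]→ₗ[ℝ] ℝ :=
  AlternatingMap.ofSubsingleton ℝ Ham ℝ (0 : Fin 1) φ

/-- The components `f₁ = -H_y`, `f₂ = H_x` of the vector field of `H`. -/
def component : Fin 2 → Ham →ₗ[ℝ] Series :=
  ![-((MvPowerSeries.pderiv ℝ 1).toLinearMap ∘ₗ Submodule.subtype _),
    (MvPowerSeries.pderiv ℝ 0).toLinearMap ∘ₗ Submodule.subtype _]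

/-- The tautological form `δ^i (X) = f_i (0)`. -/
def delta (i : Fin 2) : Ham [⋀^Fin 1]→ₗ[ℝ] ℝ :=
  oneForm (MvPowerSeries.coeff (R := ℝ) (0 : Fin 2 →₀ ℕ) ∘ₗ component i)

/-- The transverse symplectic form `ω = δ¹ ∧ δ²`. -/
def omega : Ham [⋀^Fin 2]→ₗ[ℝ] ℝ := wedge (delta 0) (delta 1)

/-- The tautological form `δ^i_j (X) = -(∂f_i / ∂x_j)(0)`. These are the entries of the universal
connection form. -/
def connection (i j : Fin 2) : Ham [⋀^Fin 1]→ₗ[ℝ] ℝ :=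
  oneForm (-(MvPowerSeries.coeff (R := ℝ) (0 : Fin 2 →₀ ℕ) ∘ₗ
    (MvPowerSeries.pderiv ℝ j).toLinearMap ∘ₗ component i))

/-- The universal curvature form `Ω^i_j = dδ^i_j + ∑_k δ^i_k ∧ δ^k_j`. -/
def curvature (i j : Fin 2) : Ham [⋀^Fin 2]→ₗ[ℝ] ℝ :=
  differential 1 (connection i j) + ∑ k, wedge (connection i k) (connection k j)

/-- The first Pontrjagin form `p₁ = -(1 / 8π²) tr (Ω ∧ Ω)`. -/
def pontrjagin : Ham [⋀^Fin 4]→ₗ[ℝ] ℝ :=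
  (-(1 / (8 * Real.pi ^ 2)) : ℝ) • ∑ i, ∑ j, wedge (curvature i j) (curvature j i)

/-- A series with its homogeneous part of degree one removed. -/
def dropLinear (f : Series) : Series := fun m : Fin 2 →₀ ℕ =>
  if m.degree = 1 then 0 else MvPowerSeries.coeff m f

theorem coeff_dropLinear (f : Series) (m : Fin 2 →₀ ℕ) :
    MvPowerSeries.coeff m (dropLinear f) =
      if m.degree = 1 then 0 else MvPowerSeries.coeff m f := rfl

theorem dropLinear_add (f g : Series) :
    dropLinear (f + g) = dropLinear f + dropLinear g := by
  ext m
  simp only [coeff_dropLinear, map_add]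
  split_ifs <;> simp

theorem dropLinear_smul (c : ℝ) (f : Series) : dropLinear (c • f) = c • dropLinear f := by
  ext m
  simp only [coeff_dropLinear, map_smul]
  split_ifs <;> simp

/-- The projection of formal Hamiltonian vector fields onto those without constant term, which
drops the linear terms of the Hamiltonian. -/
def dropConstant : Ham →ₗ[ℝ] ham0 where
  toFun f := ⟨⟨dropLinear f, by
      have h : MvPowerSeries.coeff (0 : Fin 2 →₀ ℕ) (f : Series) = 0 := f.2
      refine LinearMap.mem_ker.mpr ?_
      rw [coeff_dropLinear, h, ite_self]⟩, fun i => by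
      rw [atOrigin, ← MvPowerSeries.coeff_zero_eq_constantCoeff_apply, partialDeriv,
        MvPowerSeries.coeff_pderiv, coeff_dropLinear]
      simp⟩
  map_add' f g := Subtype.ext (Subtype.ext (dropLinear_add f g))
  map_smul' c f := Subtype.ext (Subtype.ext (dropLinear_smul c f))

/-- The form `f ∧ ω` on `ham_2`, for a form `f` on `ham_2^0`. The form `f` is first extended to
`ham_2`; the product does not depend on the extension, because `ω` vanishes as soon as one argument
lies in `ham_2^0`, which has codimension two. -/
def wedgeOmega {k : ℕ} (f : ham0 [⋀^Fin k]→ₗ[ℝ] ℝ) : Ham [⋀^Fin (k + 2)]→ₗ[ℝ] ℝ :=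
  wedge (f.compLinearMap dropConstant) omega

/-- `e` is the map on cohomology that is induced by `f ↦ f ∧ ω`: the product of each
relative cocycle of `ham_2^0` of degree `k` and weight `w` with `ω` is a relative cocycle of `ham_2`
of degree `k + 2` and weight `w'`, and `e` sends the class of the former to that of the latter. -/
def IsWedgeOmega {k : ℕ} {w w' : ℤ} (e : LeafCohomology k w →ₗ[ℝ] HamCohomology (k + 2) w') :
    Prop :=
  ∀ (z : ham0 [⋀^Fin k]→ₗ[ℝ] ℝ) (hz : z ∈ cocycles sp0 weightPart0 k w),
    ∃ hz' : wedgeOmega z ∈ cocycles sp weightPart (k + 2) w',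
      e (cohomologyClass z hz) = cohomologyClass (wedgeOmega z) hz'

end GelfandFuks

end

open GelfandFuks

noncomputable section

namespace GelfandFuks

section Cartan

variable {L : Type*} [LieRing L] [LieAlgebra ℝ L]

/-- The action of `X` on alternating forms, `(act X f) v = ∑ i, f (v₀, …, [X, v i], …)`. -/
def act (X : L) : (k : ℕ) → (L [⋀^Fin k]→ₗ[ℝ] ℝ) →ₗ[ℝ] (L [⋀^Fin k]→ₗ[ℝ] ℝ)
  | 0 => 0
  | _ + 1 => AlternatingMap.alternatizeUncurryFinLM ∘ₗ
      (LinearMap.lcomp ℝ _ (LieModule.toEnd ℝ L L X)) ∘ₗ AlternatingMap.curryLeftLinearMap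

theorem act_succ_apply (X : L) {k : ℕ} (f : L [⋀^Fin (k + 1)]→ₗ[ℝ] ℝ) (v : Fin (k + 1) → L) :
    act X (k + 1) f v =
      ∑ i : Fin (k + 1), (-1 : ℝ) ^ (i : ℕ) * f (Matrix.vecCons ⁅X, v i⁆ (i.removeNth v)) := by
  simp [act, AlternatingMap.alternatizeUncurryFin_apply]

theorem act_apply (X : L) {k : ℕ} (f : L [⋀^Fin k]→ₗ[ℝ] ℝ) (v : Fin k → L) :
    act X k f v = ∑ i, f (Function.update v i ⁅X, v i⁆) := by
  cases k with
  | zero => simp [act]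
  | succ k =>
    rw [act_succ_apply]
    refine Finset.sum_congr rfl fun i _ => ?_
    rw [← Fin.insertNth_removeNth, AlternatingMap.map_insertNth]
    simp

theorem act_curryLeft (X Y : L) {k : ℕ} (f : L [⋀^Fin (k + 1)]→ₗ[ℝ] ℝ) :
    (act X (k + 1) f).curryLeft Y = act X k (f.curryLeft Y) + f.curryLeft ⁅X, Y⁆ := by
  ext v
  simp only [AlternatingMap.curryLeft_apply_apply, AlternatingMap.add_apply, act_apply,
    Fin.sum_univ_succ, Matrix.vecCons]
  rw [add_comm]
  simp [Fin.cons_update]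

theorem map_vecCons_swap {k : ℕ} (f : L [⋀^Fin (k + 2)]→ₗ[ℝ] ℝ) (a b : L) (u : Fin k → L) :
    f (Matrix.vecCons a (Matrix.vecCons b u)) = -f (Matrix.vecCons b (Matrix.vecCons a u)) := by
  rw [← f.map_swap (Matrix.vecCons b (Matrix.vecCons a u)) (i := 0) (j := 1) (by simp)]
  congr 1
  ext m
  refine Fin.cases (by simp) (fun m => Fin.cases (by simp) (fun m => ?_) m) m
  have h0 : (m.succ.succ : Fin (k + 2)) ≠ 0 := Fin.succ_ne_zero _
  have h1 : (m.succ.succ : Fin (k + 2)) ≠ 1 := by simp [Fin.ext_iff]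
  simp [Equiv.swap_apply_of_ne_of_ne h0 h1]

theorem differential_curryLeft (X : L) {k : ℕ} (f : L [⋀^Fin (k + 1)]→ₗ[ℝ] ℝ) :
    (differential (k + 1) f).curryLeft X =
      -act X (k + 1) f - differential k (f.curryLeft X) := by
  ext v
  simp only [AlternatingMap.curryLeft_apply_apply, AlternatingMap.sub_apply,
    AlternatingMap.neg_apply]
  rw [differential_apply, act_succ_apply, Fin.sum_univ_succ, sub_eq_add_neg]
  congr 1
  · rw [← Finset.sum_neg_distrib]
    refine Finset.sum_congr (by ext; simp) fun j _ => ?_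
    simp [Matrix.vecCons, pow_succ]
  · cases k with
    | zero => simp [differential]
    | succ k =>
      rw [differential_apply, ← Finset.sum_neg_distrib]
      refine Finset.sum_congr rfl fun i _ => ?_
      rw [← Finset.sum_neg_distrib]
      symm
      refine Finset.sum_bij (fun j _ => j.succ) (by simp) (by simp) ?_ fun j hj => ?_
      · intro j hj
        obtain ⟨j, rfl⟩ := Fin.exists_succ_eq (x := j) |>.mpr (by
          rintro rfl; simp at hj)
        exact ⟨j, by simpa using hj, rfl⟩
      · simp only [AlternatingMap.curryLeft_apply_apply]
        have h1 : j.succ.removeNth (i.succ.castSucc.removeNth (Matrix.vecCons X v)) =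
            Matrix.vecCons X (j.removeNth (i.castSucc.removeNth v)) := by
          ext m
          cases m using Fin.cases with
          | zero => simp [Fin.removeNth, Matrix.vecCons]
          | succ m => simp [Fin.removeNth, Matrix.vecCons]
        rw [h1]
        rw [map_vecCons_swap]
        simp [Matrix.vecCons]
        left
        ring

theorem ext_curryLeft {k : ℕ} {f g : L [⋀^Fin (k + 1)]→ₗ[ℝ] ℝ}
    (h : ∀ X, f.curryLeft X = g.curryLeft X) : f = g := by
  ext v
  have := congrArg (fun u => u (fun i => v i.succ)) (h (v 0))
  simpa [Matrix.vecCons, ← Fin.tail_def] using this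

theorem act_commutator (X Y : L) : ∀ {k : ℕ} (f : L [⋀^Fin k]→ₗ[ℝ] ℝ),
    act X k (act Y k f) - act Y k (act X k f) = -act ⁅X, Y⁆ k f
  | 0, _ => by simp [act]
  | k + 1, f => by
    refine ext_curryLeft fun Z => ?_
    have h := act_commutator X Y (f.curryLeft Z)
    have h1 : ∀ a b : L [⋀^Fin (k + 1)]→ₗ[ℝ] ℝ, (a - b).curryLeft Z =
      a.curryLeft Z - b.curryLeft Z := fun _ _ => rfl
    have h2 : ∀ a : L [⋀^Fin (k + 1)]→ₗ[ℝ] ℝ, (-a).curryLeft Z = -a.curryLeft Z := fun _ => rfl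
    have h3 : f.curryLeft ⁅X, ⁅Y, Z⁆⁆ =
        f.curryLeft ⁅⁅X, Y⁆, Z⁆ + f.curryLeft ⁅Y, ⁅X, Z⁆⁆ := by
      rw [leibniz_lie, map_add]
    rw [h1, h2]
    simp only [act_curryLeft, map_add, h3]
    rw [sub_eq_iff_eq_add] at h
    rw [h]
    abel

theorem act_differential (X : L) : ∀ {k : ℕ} (f : L [⋀^Fin k]→ₗ[ℝ] ℝ),
    act X (k + 1) (differential k f) = differential k (act X k f)
  | 0, f => by simp [differential]
  | k + 1, f => by
    refine ext_curryLeft fun Z => ?_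
    have h := act_commutator X Z f
    have h1 := act_differential X (f.curryLeft Z)
    rw [sub_eq_iff_eq_add] at h
    rw [act_curryLeft, differential_curryLeft, differential_curryLeft, differential_curryLeft,
      act_curryLeft]
    simp only [map_add, map_sub, map_neg, h, h1]
    abel

theorem differential_differential : ∀ {k : ℕ} (f : L [⋀^Fin k]→ₗ[ℝ] ℝ),
    differential (k + 1) (differential k f) = 0
  | 0, f => by rw [show differential 0 f = 0 from rfl, map_zero]
  | k + 1, f => by
    refine ext_curryLeft fun Z => ?_
    rw [differential_curryLeft, differential_curryLeft, act_differential]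
    simp [differential_differential (f.curryLeft Z)]

theorem eq_zero_of_curryLeft_mem {k : ℕ} {f : L [⋀^Fin (k + 1)]→ₗ[ℝ] ℝ} {X : L}
    (h : f.curryLeft X = 0) {v : Fin (k + 1) → L} {i : Fin (k + 1)} (hi : v i = X) : f v = 0 := by
  rw [← Fin.insertNth_self_removeNth i v, AlternatingMap.map_insertNth, hi,
    ← AlternatingMap.curryLeft_apply_apply, h]
  simp

theorem differential_eq_zero_of_weight {W : ℤ → Submodule ℝ L} {k : ℕ} {w : ℤ}
    (hW : ∀ {i j : ℤ} {x y : L}, x ∈ W i → y ∈ W j →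
      ⁅x, y⁆ ∈ W (i + j)) {f : L [⋀^Fin k]→ₗ[ℝ] ℝ}
    (hf : ∀ (a : Fin k → ℤ) (v : Fin k → L), (∀ i, v i ∈ W (a i)) → ∑ i, a i ≠ w → f v = 0)
    (a : Fin (k + 1) → ℤ) (v : Fin (k + 1) → L) (hv : ∀ i, v i ∈ W (a i)) (ha : ∑ i, a i ≠ w) :
    differential k f v = 0 := by
  cases k with
  | zero => simp [differential]
  | succ k =>
    rw [differential_apply]
    refine Finset.sum_eq_zero fun i _ => Finset.sum_eq_zero fun j hj => ?_
    rw [hf (Matrix.vecCons (a i.castSucc + a j.succ) (j.removeNth (i.castSucc.removeNth a))),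
      mul_zero]
    · refine Fin.cases (by simpa using hW (hv _) (hv _)) fun m => by simpa [Fin.removeNth] using hv _
    · have h : i.castSucc.succAbove j = j.succ :=
        Fin.succAbove_of_le_castSucc _ _ (by simpa using hj)
      rw [Fin.sum_univ_succAbove a i.castSucc, Fin.sum_univ_succAbove _ j, h] at ha
      rw [Fin.sum_univ_succ]
      simpa [Fin.removeNth, add_assoc] using ha

variable [TopologicalSpace L] {K : LieSubalgebra ℝ L} {W : ℤ → Submodule ℝ L} {k : ℕ} {w : ℤ}

theorem cochains_act_eq_zero {f : L [⋀^Fin k]→ₗ[ℝ] ℝ} (hf : f ∈ cochains K W k w) {X : L}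
    (hX : X ∈ K) : act X k f = 0 := by
  ext v
  rw [act_apply]
  exact hf.2.2.1 X hX v

theorem cochains_curryLeft_eq_zero {f : L [⋀^Fin (k + 1)]→ₗ[ℝ] ℝ} (hf : f ∈ cochains K W (k + 1) w)
    {X : L} (hX : X ∈ K) : f.curryLeft X = 0 := by
  ext v
  exact hf.2.1 _ ⟨0, hX⟩

theorem continuous_differential
    (hbr : Continuous fun p : L × L => ⁅p.1, p.2⁆) {f : L [⋀^Fin k]→ₗ[ℝ] ℝ}
    (hf : Continuous fun v : Fin k → L => f v) :
    Continuous fun v : Fin (k + 1) → L => differential k f v := by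
  cases k with
  | zero => simpa [differential] using continuous_const
  | succ k =>
    simp only [differential_apply]
    refine continuous_finsetSum _ fun i _ => continuous_finsetSum _ fun j _ =>
      continuous_const.mul (hf.comp ?_)
    have h : Continuous fun v : Fin (k + 2) → L => ((v i.castSucc, v j.succ) : L × L) :=
      (continuous_apply _).prodMk (continuous_apply _)
    refine continuous_pi fun m => ?_
    refine Fin.cases ?_ (fun m => ?_) m
    · exact hbr.comp h
    · simpa [Fin.removeNth] using continuous_apply _

theorem continuous_act
    (hbr : Continuous fun p : L × L => ⁅p.1, p.2⁆) (X : L) {f : L [⋀^Fin k]→ₗ[ℝ] ℝ}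
    (hf : Continuous fun v : Fin k → L => f v) :
    Continuous fun v : Fin k → L => act X k f v := by
  simp only [act_apply]
  refine continuous_finsetSum _ fun i _ => hf.comp ?_
  exact continuous_id.update i (hbr.comp (continuous_const.prodMk (continuous_apply i)))

theorem differential_mem_cochains (hbr : Continuous fun p : L × L => ⁅p.1, p.2⁆)
    (hW : ∀ {i j : ℤ} {x y : L}, x ∈ W i → y ∈ W j → ⁅x, y⁆ ∈ W (i + j))
    {f : L [⋀^Fin k]→ₗ[ℝ] ℝ} (hf : f ∈ cochains K W k w) :
    differential k f ∈ cochains K W (k + 1) w := by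
  refine ⟨continuous_differential hbr hf.1, ?_, fun x hx v => ?_,
    differential_eq_zero_of_weight hW hf.2.2.2⟩
  · rintro v ⟨i, hi⟩
    refine eq_zero_of_curryLeft_mem (X := v i) ?_ rfl
    cases k with
    | zero => simp [differential]
    | succ k =>
      rw [differential_curryLeft, cochains_act_eq_zero hf hi, cochains_curryLeft_eq_zero hf hi]
      simp
  · rw [← act_apply, act_differential, cochains_act_eq_zero hf hx]
    simp

end Cartan

/-- The exponent vector of `x ^ a * y ^ b`. -/
def expo (a b : ℕ) : Fin 2 →₀ ℕ := Finsupp.single 0 a + Finsupp.single 1 b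

@[simp] theorem expo_zero (a b : ℕ) : expo a b 0 = a := by simp [expo]

@[simp] theorem expo_one (a b : ℕ) : expo a b 1 = b := by simp [expo]

theorem expo_eta (m : Fin 2 →₀ ℕ) : expo (m 0) (m 1) = m := by
  ext i
  fin_cases i <;> simp

theorem expo_inj {a b c d : ℕ} : expo a b = expo c d ↔ a = c ∧ b = d := by
  refine ⟨fun h => ?_, fun h => by rw [h.1, h.2]⟩
  have h0 := DFunLike.congr_fun h 0
  have h1 := DFunLike.congr_fun h 1
  simp at h0 h1
  exact ⟨h0, h1⟩

theorem expo_eq_zero {a b : ℕ} : expo a b = 0 ↔ a = 0 ∧ b = 0 := by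
  rw [← expo_inj (c := 0) (d := 0)]
  simp [expo]

theorem degree_expo (a b : ℕ) : (expo a b).degree = a + b := by
  simp [expo]

/-- The class of the monomial `x ^ a * y ^ b`; it vanishes for `a = b = 0`. -/
def mono (a b : ℕ) : Ham := normalize (MvPowerSeries.monomial (expo a b) 1)

theorem mono_zero : mono 0 0 = 0 := by
  rw [mono, expo_eq_zero.mpr ⟨rfl, rfl⟩]
  ext1
  simp [normalize, atOrigin]

/-- The coefficient of `x ^ a * y ^ b`. -/
def cf (a b : ℕ) : Ham →ₗ[ℝ] ℝ :=
  MvPowerSeries.coeff (R := ℝ) (expo a b) ∘ₗ Submodule.subtype _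

theorem cf_apply (a b : ℕ) (f : Ham) : cf a b f = MvPowerSeries.coeff (expo a b) (f : Series) := rfl

theorem ham_ext {f g : Ham} (h : ∀ a b, cf a b f = cf a b g) : f = g := by
  ext m
  rw [← expo_eta m]
  exact h _ _

theorem cf_zero (f : Ham) : cf 0 0 f = 0 := by
  have : (f : Series) ∈ LinearMap.ker (MvPowerSeries.coeff (R := ℝ) (0 : Fin 2 →₀ ℕ)) := f.2
  rw [cf_apply, expo_eq_zero.mpr ⟨rfl, rfl⟩]
  exact this

theorem cf_normalize {a b : ℕ} (h : a + b ≠ 0) (f : Series) :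
    cf a b (normalize f) = MvPowerSeries.coeff (expo a b) f := by
  classical
  have h0 : expo a b ≠ 0 := by
    rw [Ne, expo_eq_zero]
    omega
  simp [cf_apply, normalize, MvPowerSeries.coeff_C, h0]

theorem cf_mono (a b c d : ℕ) (h : c + d ≠ 0) :
    cf a b (mono c d) = if a = c ∧ b = d then 1 else 0 := by
  classical
  by_cases h0 : a + b = 0
  · obtain ⟨rfl, rfl⟩ : a = 0 ∧ b = 0 := by omega
    rw [cf_zero, if_neg (by omega)]
  · rw [mono, cf_normalize h0, MvPowerSeries.coeff_monomial]
    simp [expo_inj]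

theorem pderiv_zero_mono (a b : ℕ) : partialDeriv 0 (mono a b : Series) =
    (a : ℝ) • MvPowerSeries.monomial (expo (a - 1) b) 1 := by
  classical
  rw [mono, partialDeriv_normalize]
  ext m
  rw [← expo_eta m, partialDeriv, MvPowerSeries.coeff_pderiv,
    show expo (m 0) (m 1) + Finsupp.single 0 1 = expo (m 0 + 1) (m 1) by
      simp only [expo, Finsupp.single_add]; abel]
  simp only [MvPowerSeries.coeff_monomial, expo_inj, map_smul, smul_eq_mul, expo_zero]
  rcases a with _ | a
  · simp
  · by_cases h : m 0 = a <;> simp [h]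

theorem pderiv_one_mono (a b : ℕ) : partialDeriv 1 (mono a b : Series) =
    (b : ℝ) • MvPowerSeries.monomial (expo a (b - 1)) 1 := by
  classical
  rw [mono, partialDeriv_normalize]
  ext m
  rw [← expo_eta m, partialDeriv, MvPowerSeries.coeff_pderiv,
    show expo (m 0) (m 1) + Finsupp.single 1 1 = expo (m 0) (m 1 + 1) by
      simp only [expo, Finsupp.single_add]; abel]
  simp only [MvPowerSeries.coeff_monomial, expo_inj, map_smul, smul_eq_mul, expo_one]
  rcases b with _ | b
  · simp
  · by_cases h : m 1 = b <;> simp [h]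

theorem expo_add (a b c d : ℕ) : expo a b + expo c d = expo (a + c) (b + d) := by
  simp only [expo, Finsupp.single_add]
  abel

theorem bracket_mono (a b c d : ℕ) :
    ⁅mono a b, mono c d⁆ = ((a : ℝ) * d - b * c) • mono (a + c - 1) (b + d - 1) := by
  rw [bracket_def, poisson, pderiv_zero_mono, pderiv_one_mono, pderiv_zero_mono, pderiv_one_mono,
    mono, ← normalize_smul]
  congr 1
  simp only [smul_mul_smul_comm, MvPowerSeries.monomial_mul_monomial, expo_add, one_mul]
  have h1 : ((a : ℝ) * d) • (MvPowerSeries.monomial (expo (a - 1 + c) (b + (d - 1))) 1 : Series) =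
      ((a : ℝ) * d) • MvPowerSeries.monomial (expo (a + c - 1) (b + d - 1)) 1 := by
    rcases a with _ | a
    · simp
    rcases d with _ | d
    · simp
    congr 4 <;> omega
  have h2 : ((b : ℝ) * c) • (MvPowerSeries.monomial (expo (a + (c - 1)) (b - 1 + d)) 1 : Series) =
      ((b : ℝ) * c) • MvPowerSeries.monomial (expo (a + c - 1) (b + d - 1)) 1 := by
    rcases b with _ | b
    · simp
    rcases c with _ | c
    · simp
    congr 4 <;> omega
  rw [h1, h2, sub_smul]

theorem mono_mem_weightPart (a b : ℕ) : mono a b ∈ weightPart ((a : ℤ) + b - 2) := by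
  intro m hm
  by_cases h : a + b = 0
  · obtain ⟨rfl, rfl⟩ : a = 0 ∧ b = 0 := by omega
    simp [mono_zero]
  have h1 := cf_mono (m 0) (m 1) a b h
  rw [cf_apply, expo_eta] at h1
  rw [h1, if_neg]
  rintro ⟨rfl, rfl⟩
  rw [← expo_eta m, degree_expo] at hm
  push_cast at hm
  simp at hm

theorem continuous_cf (a b : ℕ) : Continuous (cf a b) :=
  (MvPowerSeries.WithPiTopology.continuous_coeff ℝ (expo a b)).comp continuous_subtype_val

theorem continuous_ham {X : Type*} [TopologicalSpace X] {g : X → Ham}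
    (h : ∀ a b, Continuous fun x => cf a b (g x)) : Continuous g := by
  refine Continuous.subtype_mk (f := fun x => (g x : Series)) ?_ _
  refine continuous_pi fun m => ?_
  have := h (m 0) (m 1)
  simp only [cf_apply, expo_eta] at this
  exact this

theorem continuous_partialDeriv (i : Fin 2) : Continuous (partialDeriv i) := by
  refine continuous_pi fun m => ?_
  have : (fun f : Series => partialDeriv i f m) =
      fun f => MvPowerSeries.coeff (m + Finsupp.single i 1) f * ((m i : ℝ) + 1) := by
    ext f
    exact MvPowerSeries.coeff_pderiv ..
  rw [this]
  exact (MvPowerSeries.WithPiTopology.continuous_coeff ℝ _).mul continuous_const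

theorem continuous_bracket : Continuous fun p : Ham × Ham => ⁅p.1, p.2⁆ := by
  refine continuous_ham fun a b => ?_
  by_cases h0 : a + b = 0
  · obtain ⟨rfl, rfl⟩ : a = 0 ∧ b = 0 := by omega
    simpa only [cf_zero] using continuous_const
  simp only [bracket_def, cf_normalize h0]
  refine (MvPowerSeries.WithPiTopology.continuous_coeff ℝ _).comp ?_
  have h : ∀ i, Continuous fun p : Ham × Ham => partialDeriv i (p.1 : Series) := fun i =>
    (continuous_partialDeriv i).comp (continuous_subtype_val.comp continuous_fst)
  have h' : ∀ i, Continuous fun p : Ham × Ham => partialDeriv i (p.2 : Series) := fun i =>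
    (continuous_partialDeriv i).comp (continuous_subtype_val.comp continuous_snd)
  exact ((h 0).mul (h' 1)).sub ((h 1).mul (h' 0))

/-- The truncation of a Hamiltonian to the exponents less than `N`. -/
def truncation (N : ℕ) (f : Ham) : Ham :=
  ∑ p ∈ Finset.range N ×ˢ Finset.range N, cf p.1 p.2 f • mono p.1 p.2

theorem cf_truncation {N a b : ℕ} (ha : a < N) (hb : b < N) (f : Ham) :
    cf a b (truncation N f) = cf a b f := by
  rw [truncation, map_sum, Finset.sum_eq_single (a, b)]
  · by_cases h : a + b = 0
    · obtain ⟨rfl, rfl⟩ : a = 0 ∧ b = 0 := by omega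
      simp [cf_zero]
    · simp [cf_mono a b a b h]
  · rintro ⟨c, d⟩ - hne
    by_cases h : c + d = 0
    · obtain ⟨rfl, rfl⟩ : c = 0 ∧ d = 0 := by omega
      simp [cf_zero]
    · rw [map_smul, cf_mono a b c d h, if_neg, smul_zero]
      rintro ⟨rfl, rfl⟩
      exact hne rfl
  · simp [ha, hb]

open Filter Topology in
theorem tendsto_truncation (f : Ham) : Tendsto (fun N => truncation N f) atTop (𝓝 f) := by
  rw [tendsto_subtype_rng, MvPowerSeries.WithPiTopology.tendsto_iff_coeff_tendsto]
  intro m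
  refine tendsto_const_nhds.congr' ?_
  filter_upwards [eventually_gt_atTop (m 0), eventually_gt_atTop (m 1)] with N h0 h1
  have := cf_truncation h0 h1 f
  rw [cf_apply, cf_apply, expo_eta] at this
  exact this.symm

/-- A continuous multilinear form is determined by its values on monomials. -/
theorem eq_zero_of_mono {k : ℕ} {f : Ham [⋀^Fin k]→ₗ[ℝ] ℝ}
    (hf : Continuous fun v : Fin k → Ham => f v)
    (h : ∀ t : Fin k → ℕ × ℕ, f (fun i => mono (t i).1 (t i).2) = 0) : f = 0 := by
  ext v
  have h1 : Filter.Tendsto (fun N => f (fun i => truncation N (v i))) Filter.atTop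
      (nhds (f v)) :=
    (hf.tendsto v).comp (tendsto_pi_nhds.mpr fun i => tendsto_truncation (v i))
  refine tendsto_nhds_unique h1 ?_
  convert tendsto_const_nhds with N
  simp only [truncation]
  have := f.toMultilinearMap.map_sum_finset (A := fun _ => Finset.range N ×ˢ Finset.range N)
    (fun i p => cf p.1 p.2 (v i) • mono p.1 p.2)
  refine this.trans (Finset.sum_eq_zero fun r _ => ?_)
  have h2 := f.toMultilinearMap.map_smul_univ (fun i => cf (r i).1 (r i).2 (v i))
    (fun i => mono (r i).1 (r i).2)
  refine h2.trans ?_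
  have := h r
  simp only [AlternatingMap.coe_multilinearMap, this, smul_zero]

/-! ### The decomposition of forms under `sp(2, ℝ)` -/

/-- A tuple of monomials without constants and quadratic terms, whose number of linear terms lies
in `A`, whose weights sum to `w`, and whose weights under `x ∂/∂x - y ∂/∂y` sum to `h`. -/
def IsHomogeneous (A : Finset ℕ) {k : ℕ} (w h : ℤ) (t : Fin k → ℕ × ℕ) : Prop :=
  (∀ i, (t i).1 + (t i).2 ≠ 0 ∧ (t i).1 + (t i).2 ≠ 2) ∧
    (Finset.univ.filter fun i => (t i).1 + (t i).2 = 1).card ∈ A ∧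
    ∑ i, (((t i).1 + (t i).2 : ℕ) - 2 : ℤ) = w ∧ ∑ i, ((t i).1 - (t i).2 : ℤ) = h

/-- The value of a form on a tuple of monomials. -/
abbrev onMono {k : ℕ} (f : Ham [⋀^Fin k]→ₗ[ℝ] ℝ) (t : Fin k → ℕ × ℕ) : ℝ :=
  f fun i => mono (t i).1 (t i).2

/-- The continuous forms supported on homogeneous tuples of monomials. -/
def homForms (A : Finset ℕ) (k : ℕ) (w h : ℤ) : Submodule ℝ (Ham [⋀^Fin k]→ₗ[ℝ] ℝ) where
  carrier := {f | (Continuous fun v : Fin k → Ham => f v) ∧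
    ∀ t : Fin k → ℕ × ℕ, ¬ IsHomogeneous A w h t → onMono f t = 0}
  zero_mem' := ⟨by simpa using continuous_const, by simp⟩
  add_mem' := by
    rintro f g ⟨f1, f2⟩ ⟨g1, g2⟩
    exact ⟨f1.add g1, fun t ht => by simp [f2 t ht, g2 t ht]⟩
  smul_mem' := by
    rintro c f ⟨f1, f2⟩
    exact ⟨f1.const_smul c, fun t ht => by simp [f2 t ht]⟩

theorem onMono_act (c d : ℕ) {k : ℕ} (f : Ham [⋀^Fin k]→ₗ[ℝ] ℝ) (t : Fin k → ℕ × ℕ) :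
    onMono (act (mono c d) k f) t = ∑ i, ((c : ℝ) * (t i).2 - d * (t i).1) *
      onMono f (Function.update t i (c + (t i).1 - 1, d + (t i).2 - 1)) := by
  rw [onMono, act_apply]
  refine Finset.sum_congr rfl fun i _ => ?_
  rw [bracket_mono, AlternatingMap.map_update_smul, smul_eq_mul]
  congr 2
  ext1 j
  by_cases h : j = i
  · subst h; simp
  · simp [h]

theorem IsHomogeneous.of_update {A : Finset ℕ} {k : ℕ} {w h h' : ℤ} {t : Fin k → ℕ × ℕ} {i : Fin k}
    {q : ℕ × ℕ} (hq : q.1 + q.2 = (t i).1 + (t i).2)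
    (hh : h + ((t i).1 - (t i).2) = h' + (q.1 - q.2))
    (ht : IsHomogeneous A w h (Function.update t i q)) : IsHomogeneous A w h' t := by
  obtain ⟨h1, h2, h3, h4⟩ := ht
  have key : ∀ j, (Function.update t i q j).1 + (Function.update t i q j).2 =
      (t j).1 + (t j).2 := by
    intro j
    by_cases hj : j = i
    · subst hj; simpa using hq
    · simp [hj]
  simp only [key] at h1 h2 h3
  refine ⟨h1, h2, h3, ?_⟩
  rw [← Finset.add_sum_erase _ _ (Finset.mem_univ i)] at h4 ⊢
  rw [Finset.sum_congr rfl (g := fun j => ((t j).1 - (t j).2 : ℤ))] at h4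
  · simp only [Function.update_self] at h4
    linarith
  · intro j hj
    simp [Finset.ne_of_mem_erase hj]

/-- The action of `x ^ 2`, which lowers the weight by two. -/
abbrev lower (k : ℕ) := act (mono 2 0) k

/-- The action of `y ^ 2`, which raises the weight by two. -/
abbrev raise (k : ℕ) := act (mono 0 2) k

variable {A : Finset ℕ} {k : ℕ} {w h : ℤ} {f : Ham [⋀^Fin k]→ₗ[ℝ] ℝ}

theorem act_mem_homForms {c d : ℕ} {e : ℤ} (hcd : c + d = 2) (he : (c : ℤ) - d = e)
    (hf : f ∈ homForms A k w h) : act (mono c d) k f ∈ homForms A k w (h - e) := by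
  refine ⟨continuous_act continuous_bracket _ hf.1, fun t ht => ?_⟩
  rw [onMono_act]
  refine Finset.sum_eq_zero fun i _ => ?_
  by_cases h0 : (c : ℝ) * (t i).2 - d * (t i).1 = 0
  · rw [h0, zero_mul]
  · rw [hf.2, mul_zero]
    contrapose! ht
    have h1 : c + (t i).1 ≠ 0 := fun h => h0 (by
      have h1 : c = 0 := by omega
      have h2 : (t i).1 = 0 := by omega
      simp [h1, h2])
    have h2 : d + (t i).2 ≠ 0 := fun h => h0 (by
      have h1 : d = 0 := by omega
      have h2 : (t i).2 = 0 := by omega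
      simp [h1, h2])
    refine ht.of_update (by simp only; omega) ?_
    simp only
    omega

theorem lower_mem (hf : f ∈ homForms A k w h) : lower k f ∈ homForms A k w (h - 2) :=
  act_mem_homForms rfl rfl hf

theorem raise_mem (hf : f ∈ homForms A k w h) : raise k f ∈ homForms A k w (h + 2) := by
  simpa using act_mem_homForms (c := 0) (d := 2) rfl rfl hf

theorem act_one_one (hf : f ∈ homForms A k w h) : act (mono 1 1) k f = (-h : ℝ) • f := by
  rw [← sub_eq_zero]
  refine eq_zero_of_mono (f := act (mono 1 1) k f - (-h : ℝ) • f)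
    ((continuous_act continuous_bracket _ hf.1).sub (hf.1.const_smul (-h : ℝ))) fun t => ?_
  have h1 := onMono_act 1 1 f t
  rw [AlternatingMap.sub_apply, AlternatingMap.smul_apply, sub_eq_zero]
  refine h1.trans ?_
  have h2 : ∀ i, Function.update t i (1 + (t i).1 - 1, 1 + (t i).2 - 1) = t := fun i => by
    simp
  simp only [h2]
  rw [← Finset.sum_mul, smul_eq_mul]
  by_cases h0 : IsHomogeneous A w h t
  · have h4 := h0.2.2.2
    rw [← h4]
    congr 1
    push_cast
    rw [← Finset.sum_neg_distrib]
    exact Finset.sum_congr rfl fun i _ => by ring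
  · have := hf.2 t h0
    rw [onMono] at this
    rw [onMono, this]
    simp

theorem lower_raise (hf : f ∈ homForms A k w h) :
    lower k (raise k f) - raise k (lower k f) = (4 * h : ℝ) • f := by
  have h1 := act_commutator (mono 2 0) (mono 0 2) f
  have h2 : ⁅mono 2 0, mono 0 2⁆ = (4 : ℝ) • mono 1 1 := by
    rw [bracket_mono]
    norm_num
  have h3 : act ((4 : ℝ) • mono 1 1) k f = (4 : ℝ) • act (mono 1 1) k f := by
    ext v
    simp [act_apply, Finset.mul_sum]
  rw [h1, h2, h3, act_one_one hf, smul_smul, ← neg_smul]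
  congr 1
  ring

theorem homForms_eq_zero (hh : w + 2 * k < |h|) (hf : f ∈ homForms A k w h) : f = 0 := by
  refine eq_zero_of_mono hf.1 fun t => hf.2 t fun ht => ?_
  obtain ⟨-, -, h3, h4⟩ := ht
  have h5 : |h| ≤ ∑ i, (((t i).1 + (t i).2 : ℕ) : ℤ) := by
    rw [← h4]
    refine (Finset.abs_sum_le_sum_abs _ _).trans (Finset.sum_le_sum fun i _ => ?_)
    rw [abs_le]
    push_cast
    constructor <;> omega
  rw [Finset.sum_sub_distrib] at h3
  simp at h3 h5
  omega

theorem eq_zero_of_sl_two {M : Type*} [AddCommGroup M] [Module ℝ M] (E F : M →ₗ[ℝ] M) {v : M}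
    (hEF : ∀ n : ℕ, E (F ((E ^ n) v)) - F (E ((E ^ n) v)) = (-(8 * (n + 1)) : ℝ) • (E ^ n) v)
    (hv : E (F v) = 0) {N : ℕ} (hN : (E ^ N) v = 0) : v = 0 := by
  have key : ∀ n : ℕ, ∃ c : ℝ, 0 < c ∧ F ((E ^ (n + 1)) v) = c • (E ^ n) v := by
    intro n
    induction n with
    | zero =>
      refine ⟨8, by norm_num, ?_⟩
      have := hEF 0
      simp only [pow_zero, Module.End.one_apply, hv, zero_sub] at this
      simpa using this
    | succ n ih =>
      obtain ⟨c, hc, h⟩ := ih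
      refine ⟨c + 8 * (n + 2), by positivity, ?_⟩
      have h1 := hEF (n + 1)
      rw [h, map_smul, ← Module.End.mul_apply, ← pow_succ', ← Module.End.mul_apply E, ← pow_succ',
        sub_eq_iff_eq_add] at h1
      rw [← sub_eq_iff_eq_add'.mpr h1, sub_eq_iff_eq_add, ← add_smul]
      push_cast
      congr 1
      ring
  induction N with
  | zero => simpa using hN
  | succ n ih =>
    obtain ⟨c, hc, h⟩ := key n
    rw [hN, map_zero] at h
    exact ih ((smul_eq_zero.mp h.symm).resolve_left hc.ne')

theorem lower_pow_mem (hf : f ∈ homForms A k w h) (n : ℕ) :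
    ((lower k) ^ n) f ∈ homForms A k w (h - 2 * n) := by
  induction n with
  | zero => simpa using hf
  | succ n ih =>
    rw [pow_succ', Module.End.mul_apply]
    convert lower_mem ih using 1
    push_cast
    ring_nf

theorem raise_pow_mem (hf : f ∈ homForms A k w h) (n : ℕ) :
    ((raise k) ^ n) f ∈ homForms A k w (h + 2 * n) := by
  induction n with
  | zero => simpa using hf
  | succ n ih =>
    rw [pow_succ', Module.End.mul_apply]
    convert raise_mem ih using 1
    push_cast
    ring_nf

theorem lower_raise_injective (hf : f ∈ homForms A k w (-2)) (h0 : lower k (raise k f) = 0) :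
    f = 0 := by
  refine eq_zero_of_sl_two (lower k) (raise k) (fun n => ?_) h0 (N := (w + 2 * k).toNat + 1) ?_
  · rw [lower_raise (lower_pow_mem hf n)]
    congr 1
    push_cast
    ring
  · refine homForms_eq_zero ?_ (lower_pow_mem hf _)
    rw [abs_of_neg] <;> push_cast <;> omega

theorem raise_eq_zero (hf : f ∈ homForms A k w 0) (h0 : lower k f = 0) : raise k f = 0 := by
  have h1 := lower_raise hf
  rw [h0, map_zero, sub_zero] at h1
  have h2 : lower k (raise k f) = 0 := by simpa using h1
  have h3 := raise_mem hf
  have h4 := lower_raise h3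
  refine eq_zero_of_sl_two (raise k) (lower k) (v := raise k f) (fun n => ?_) (by rw [h2, map_zero])
    (N := (w + 2 * k).toNat + 1) ?_
  · rw [← neg_sub, lower_raise (raise_pow_mem h3 n), ← neg_smul (M := Ham [⋀^Fin k]→ₗ[ℝ] ℝ)]
    congr 1
    push_cast
    ring
  · refine homForms_eq_zero ?_ (raise_pow_mem h3 _)
    rw [abs_of_pos] <;> push_cast <;> omega

/-- The forms of weight zero that are invariant under `sp(2, ℝ)`. -/
def invariantForms (A : Finset ℕ) (k : ℕ) (w : ℤ) : Submodule ℝ (Ham [⋀^Fin k]→ₗ[ℝ] ℝ) :=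
  homForms A k w 0 ⊓ LinearMap.ker (lower k)

theorem finrank_invariantForms [FiniteDimensional ℝ (homForms A k w 0)]
    [FiniteDimensional ℝ (homForms A k w (-2))] :
    Module.finrank ℝ (invariantForms A k w) + Module.finrank ℝ (homForms A k w (-2)) =
      Module.finrank ℝ (homForms A k w 0) := by
  let E : homForms A k w 0 →ₗ[ℝ] homForms A k w (-2) :=
    (lower k).restrict fun f hf => by simpa using lower_mem hf
  let F : homForms A k w (-2) →ₗ[ℝ] homForms A k w 0 :=
    (raise k).restrict fun f hf => by simpa using raise_mem hf
  have hEF : Function.Injective (E ∘ₗ F) := by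
    rw [injective_iff_map_eq_zero]
    intro f hf
    exact Subtype.ext (lower_raise_injective f.2 (congrArg Subtype.val hf))
  have hE : Function.Surjective E := by
    have := (LinearMap.injective_iff_surjective (K := ℝ) (V := homForms A k w (-2))).mp hEF
    rw [LinearMap.coe_comp] at this
    exact this.of_comp
  have h1 := LinearMap.finrank_range_add_finrank_ker (K := ℝ) (V := homForms A k w 0)
    (V₂ := homForms A k w (-2)) E
  rw [LinearMap.range_eq_top.mpr hE, finrank_top] at h1
  rw [← h1, add_comm]
  congr 1
  have : LinearMap.ker E = (invariantForms A k w).submoduleOf (homForms A k w 0) := by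
    ext f
    simp only [LinearMap.mem_ker, Submodule.submoduleOf, Submodule.mem_comap, invariantForms,
      Submodule.subtype_apply, Submodule.mem_inf, f.2, true_and, ← Submodule.coe_eq_zero]
    rfl
  rw [this]
  exact (Submodule.submoduleOfEquivOfLe inf_le_left).finrank_eq.symm

/-! ### Evaluation of forms on lists of monomials

The monomial `x ^ a * y ^ b` is encoded by the number `32 * (a + b) + a`. -/

/-- The exponents of the monomial with a given code. -/
def decode (p : ℕ) : ℕ × ℕ := (p % 32, p / 32 - p % 32)

/-- The code of the monomial with given exponents. -/
def encode (t : ℕ × ℕ) : ℕ := 32 * (t.1 + t.2) + t.1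

/-- The codes of the monomials of degree between `1` and `16`. -/
def IsCode (p : ℕ) : Prop := p % 32 ≤ p / 32 ∧ 1 ≤ p / 32 ∧ p / 32 ≤ 16

theorem encode_decode {p : ℕ} (hp : p % 32 ≤ p / 32) : encode (decode p) = p := by
  simp only [encode, decode]
  omega

theorem encode_div {t : ℕ × ℕ} (h : t.1 + t.2 ≤ 16) : encode t / 32 = t.1 + t.2 := by
  simp only [encode]
  omega

theorem encode_mod {t : ℕ × ℕ} (h : t.1 + t.2 ≤ 16) : encode t % 32 = t.1 := by
  simp only [encode]
  omega

theorem decode_encode {t : ℕ × ℕ} (h : t.1 + t.2 ≤ 16) : decode (encode t) = t := by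
  ext
  · simp [decode, encode_mod h]
  · simp [decode, encode_mod h, encode_div h]

theorem isCode_encode {t : ℕ × ℕ} (h : t.1 + t.2 ≤ 16) (h0 : t.1 + t.2 ≠ 0) :
    IsCode (encode t) := by
  rw [IsCode, encode_div h, encode_mod h]
  omega

theorem decode_injOn {p q : ℕ} (hp : p % 32 ≤ p / 32) (hq : q % 32 ≤ q / 32)
    (h : decode p = decode q) : p = q := by
  rw [← encode_decode hp, h, encode_decode hq]

/-- The monomial with a given code. -/
def codeMono (p : ℕ) : Ham := mono (decode p).1 (decode p).2

/-- The coefficient of the bracket of the monomials with given codes. -/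
def bracketCoeff (p q : ℕ) : ℤ := ((p % 32 * (q / 32) : ℕ) : ℤ) - ((q % 32 * (p / 32) : ℕ) : ℤ)

theorem bracket_codeMono {p q : ℕ} (hp : IsCode p) (hq : IsCode q) :
    ⁅codeMono p, codeMono q⁆ = (bracketCoeff p q : ℝ) • codeMono (p + q - 65) := by
  obtain ⟨hp1, hp2, hp3⟩ := hp
  obtain ⟨hq1, hq2, hq3⟩ := hq
  rw [codeMono, codeMono, bracket_mono]
  have hc : ((decode p).1 : ℝ) * (decode q).2 - (decode p).2 * (decode q).1 = bracketCoeff p q := by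
    simp only [decode, bracketCoeff]
    rw [Nat.cast_sub hp1, Nat.cast_sub hq1, Int.cast_sub, Int.cast_natCast, Int.cast_natCast,
      Nat.cast_mul, Nat.cast_mul]
    ring
  rw [hc]
  by_cases h0 : bracketCoeff p q = 0
  · simp [h0]
  · have h1 : p % 32 + q % 32 ≠ 0 := by
      intro h
      have h1 : p % 32 = 0 := by omega
      have h2 : q % 32 = 0 := by omega
      simp [bracketCoeff, h1, h2] at h0
    have h2 : p % 32 + q % 32 ≠ p / 32 + q / 32 := by
      intro h
      have h1 : p % 32 = p / 32 := by omega
      have h2 : q % 32 = q / 32 := by omega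
      rw [bracketCoeff, h1, h2] at h0
      exact h0 (by push_cast; ring)
    congr 1
    rw [codeMono]
    simp only [decode]
    congr 1 <;> omega

/-- The value of a form of degree `k` on a list of `k` monomials. -/
def onList : (k : ℕ) → (Ham [⋀^Fin k]→ₗ[ℝ] ℝ) → List ℕ → ℝ
  | 0, f, [] => f ![]
  | 0, _, _ :: _ => 0
  | _ + 1, _, [] => 0
  | k + 1, f, p :: l => onList k (f.curryLeft (codeMono p)) l

theorem onList_ofFn : ∀ {k : ℕ} (f : Ham [⋀^Fin k]→ₗ[ℝ] ℝ) (t : Fin k → ℕ),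
    onList k f (List.ofFn t) = f fun i => codeMono (t i)
  | 0, f, t => by
    simp only [List.ofFn_zero, onList]
    congr 1
    exact Subsingleton.elim _ _
  | k + 1, f, t => by
    rw [List.ofFn_succ, onList, onList_ofFn, AlternatingMap.curryLeft_apply_apply]
    congr 1
    ext1 i
    refine Fin.cases rfl (fun i => rfl) i

theorem onList_add : ∀ {k : ℕ} (f g : Ham [⋀^Fin k]→ₗ[ℝ] ℝ) (l : List ℕ),
    onList k (f + g) l = onList k f l + onList k g l
  | 0, f, g, [] => rfl
  | 0, f, g, _ :: _ => by simp [onList]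
  | k + 1, f, g, [] => by simp [onList]
  | k + 1, f, g, p :: l => by
    simp only [onList]
    exact onList_add (f.curryLeft _) (g.curryLeft _) l

theorem onList_smul : ∀ {k : ℕ} (c : ℝ) (f : Ham [⋀^Fin k]→ₗ[ℝ] ℝ) (l : List ℕ),
    onList k (c • f) l = c * onList k f l
  | 0, c, f, [] => rfl
  | 0, c, f, _ :: _ => by simp [onList]
  | k + 1, c, f, [] => by simp [onList]
  | k + 1, c, f, p :: l => by
    simp only [onList]
    exact onList_smul c (f.curryLeft _) l

/-- The value of a form on a list, as a linear functional of the form. -/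
def onListLM (k : ℕ) (l : List ℕ) : (Ham [⋀^Fin k]→ₗ[ℝ] ℝ) →ₗ[ℝ] ℝ where
  toFun f := onList k f l
  map_add' f g := onList_add f g l
  map_smul' c f := onList_smul c f l

theorem onListLM_apply (k : ℕ) (l : List ℕ) (f : Ham [⋀^Fin k]→ₗ[ℝ] ℝ) :
    onListLM k l f = onList k f l := rfl

theorem onList_of_length_ne : ∀ {k : ℕ} (f : Ham [⋀^Fin k]→ₗ[ℝ] ℝ) {l : List ℕ},
    l.length ≠ k → onList k f l = 0
  | 0, _, [], h => absurd rfl h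
  | 0, _, _ :: _, _ => rfl
  | _ + 1, _, [], _ => rfl
  | k + 1, f, p :: l, h => onList_of_length_ne (f.curryLeft _) (by simpa using h)

/-- Insertion of an element into a sorted list, with the parity of the number of transpositions;
`none` if the element occurs in the list. -/
def insertSign (p : ℕ) : List ℕ → Option (Bool × List ℕ)
  | [] => some (false, [p])
  | q :: l =>
    bif Nat.blt p q then some (false, p :: q :: l)
    else bif Nat.beq p q then none
    else match insertSign p l with
      | none => none
      | some (s, l') => some (!s, q :: l')

/-- Sorting of a list, with the sign of the permutation; `none` if there are repetitions. -/
def sortSign : List ℕ → Option (Bool × List ℕ)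
  | [] => some (false, [])
  | p :: l =>
    match sortSign l with
    | none => none
    | some (s, l') =>
      match insertSign p l' with
      | none => none
      | some (s', l'') => some (xor s s', l'')

/-- The value of an alternating function on an unsorted list, from its values on sorted ones. -/
def signed (φ : List ℕ → ℝ) : Option (Bool × List ℕ) → ℝ
  | none => 0
  | some (s, l) => bif s then -φ l else φ l

theorem signed_not (φ : List ℕ → ℝ) (s : Bool) (l : List ℕ) :
    signed φ (some (!s, l)) = -signed φ (some (s, l)) := by
  cases s <;> simp [signed]

theorem onList_swap {k : ℕ} (f : Ham [⋀^Fin (k + 2)]→ₗ[ℝ] ℝ) (p q : ℕ) (l : List ℕ) :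
    onList (k + 2) f (p :: q :: l) = -onList (k + 2) f (q :: p :: l) := by
  have : (f.curryLeft (codeMono p)).curryLeft (codeMono q) =
      (-1 : ℝ) • (f.curryLeft (codeMono q)).curryLeft (codeMono p) := by
    ext v
    simpa using map_vecCons_swap f (codeMono p) (codeMono q) v
  simp only [onList]
  rw [this, onList_smul]
  ring

theorem onList_insertSign : ∀ {k : ℕ} (f : Ham [⋀^Fin (k + 1)]→ₗ[ℝ] ℝ) (p : ℕ) (l : List ℕ),
    l.length = k → onList (k + 1) f (p :: l) = signed (onList (k + 1) f) (insertSign p l)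
  | _, f, p, [], _ => rfl
  | k + 1, f, p, q :: l, hl => by
    rw [insertSign]
    cases h1 : Nat.blt p q <;> cases h2 : Nat.beq p q <;> simp only [cond_true, cond_false]
    · have h3 := onList_insertSign (f.curryLeft (codeMono q)) p l (by simpa using hl)
      rw [onList_swap]
      change -onList (k + 1) (f.curryLeft (codeMono q)) (p :: l) = _
      rw [h3]
      cases h : insertSign p l with
      | none => simp [signed]
      | some x =>
        obtain ⟨s, l'⟩ := x
        simp only
        rw [signed_not]
        cases s <;> simp [signed, onList]
    · have := onList_swap f p q l
      rw [Nat.eq_of_beq_eq_true h2] at this ⊢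
      simp only [signed]
      linarith
    · rfl
    · rfl

theorem insertSign_spec : ∀ {p : ℕ} {l : List ℕ} {s : Bool} {l' : List ℕ},
    insertSign p l = some (s, l') → l.Pairwise (· < ·) →
      l'.Perm (p :: l) ∧ l'.Pairwise (· < ·)
  | p, [], s, l', h, _ => by
    simp [insertSign] at h
    simp [← h.2]
  | p, q :: l, s, l', h, hl => by
    rw [insertSign] at h
    rw [List.pairwise_cons] at hl
    cases h1 : Nat.blt p q <;> cases h2 : Nat.beq p q <;> simp [h1, h2] at h
    · split at h
      · simp at h
      · rename_i s₀ l₀ h0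
        simp at h
        obtain ⟨-, rfl⟩ := h
        obtain ⟨h3, h4⟩ := insertSign_spec h0 hl.2
        refine ⟨(h3.cons q).trans (List.Perm.swap p q l), List.pairwise_cons.mpr ⟨?_, h4⟩⟩
        intro r hr
        rw [h3.mem_iff, List.mem_cons] at hr
        rcases hr with rfl | hr
        · have h5 : ¬ r < q := by rw [← Nat.blt_eq, h1]; exact Bool.false_ne_true
          have h6 : ¬ r = q := by rw [← Nat.beq_eq, h2]; exact Bool.false_ne_true
          omega
        · exact hl.1 r hr
    all_goals
      obtain ⟨-, rfl⟩ := h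
      have h5 : p < q := by simpa [Nat.blt_eq] using h1
      refine ⟨List.Perm.refl _, List.pairwise_cons.mpr ⟨?_, List.pairwise_cons.mpr hl⟩⟩
      intro r hr
      rw [List.mem_cons] at hr
      rcases hr with rfl | hr
      · exact h5
      · exact h5.trans (hl.1 r hr)

theorem sortSign_spec : ∀ {l : List ℕ} {s : Bool} {l' : List ℕ},
    sortSign l = some (s, l') → l'.Perm l ∧ l'.Pairwise (· < ·)
  | [], s, l', h => by
    simp [sortSign] at h
    obtain ⟨-, rfl⟩ := h
    simp
  | p :: l, s, l', h => by
    rw [sortSign] at h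
    split at h
    · simp at h
    · rename_i s₁ l₁ h1
      split at h
      · simp at h
      · rename_i s₂ l₂ h2
        simp at h
        obtain ⟨-, rfl⟩ := h
        obtain ⟨h3, h4⟩ := sortSign_spec h1
        obtain ⟨h5, h6⟩ := insertSign_spec h2 h4
        exact ⟨h5.trans (h3.cons p), h6⟩

theorem onList_sortSign : ∀ {k : ℕ} (f : Ham [⋀^Fin k]→ₗ[ℝ] ℝ) (l : List ℕ), l.length = k →
    onList k f l = signed (onList k f) (sortSign l)
  | 0, f, [], _ => rfl
  | k + 1, f, p :: l, hl => by
    rw [sortSign]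
    have h1 := onList_sortSign (f.curryLeft (codeMono p)) l (by simpa using hl)
    rw [onList, h1]
    cases h : sortSign l with
    | none => rfl
    | some x =>
      obtain ⟨s, l'⟩ := x
      have h2 := onList_insertSign f p l' (by
        rw [(sortSign_spec h).1.length_eq]; simpa using hl)
      rw [onList] at h2
      cases h' : insertSign p l' with
      | none => cases s <;> simp_all [signed]
      | some y =>
        obtain ⟨s', l''⟩ := y
        cases s <;> cases s' <;> simp_all [signed]

/-- The action of the monomial with code `p`, on functions of lists. -/
def listAct (p : ℕ) : (List ℕ → ℝ) → List ℕ → ℝ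
  | _, [] => 0
  | φ, q :: l => bracketCoeff p q * φ ((p + q - 65) :: l) + listAct p (fun m => φ (q :: m)) l

/-- The differential, on functions of lists. -/
def listDiff : (List ℕ → ℝ) → List ℕ → ℝ
  | _, [] => 0
  | φ, p :: l => -listAct p φ l - listDiff (fun m => φ (p :: m)) l

theorem onList_act : ∀ {k : ℕ} (f : Ham [⋀^Fin k]→ₗ[ℝ] ℝ) {p : ℕ} {l : List ℕ}, IsCode p →
    (∀ q ∈ l, IsCode q) → l.length = k →
    onList k (act (codeMono p) k f) l = listAct p (onList k f) l
  | 0, f, p, [], _, _, _ => rfl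
  | k + 1, f, p, q :: l, hp, hl, hk => by
    rw [onList, act_curryLeft, onList_add, onList_act _ hp (fun r hr => hl r (by simp [hr]))
      (by simpa using hk), bracket_codeMono hp (hl q (by simp)), map_smul, onList_smul, listAct,
      add_comm]
    rfl

theorem onList_differential : ∀ {k : ℕ} (f : Ham [⋀^Fin k]→ₗ[ℝ] ℝ) {l : List ℕ},
    (∀ q ∈ l, IsCode q) → l.length = k + 1 →
    onList (k + 1) (differential k f) l = listDiff (onList k f) l
  | 0, f, [p], _, _ => by simp [listDiff, listAct, differential, onList]
  | k + 1, f, p :: l, hl, hk => by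
    have hl' : ∀ q ∈ l, IsCode q := fun r hr => hl r (by simp [hr])
    have hk' : l.length = k + 1 := by simpa using hk
    have h1 : ∀ a b : Ham [⋀^Fin (k + 1)]→ₗ[ℝ] ℝ, -a - b = (-1 : ℝ) • a + (-1 : ℝ) • b :=
      fun a b => by ext v; simp [sub_eq_add_neg]
    rw [onList, differential_curryLeft, h1, onList_add, onList_smul, onList_smul,
      onList_act f (hl p (by simp)) hl' hk', onList_differential _ hl' hk', listDiff]
    simp only [onList]
    ring

/-- The determinant of the coefficients at the monomials in the list `l`. -/
def elementaryForm (k : ℕ) (l : List ℕ) : Ham [⋀^Fin k]→ₗ[ℝ] ℝ :=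
  Matrix.detRowAlternating.compLinearMap
    (LinearMap.pi fun i : Fin k => cf (decode (l.getD i 0)).1 (decode (l.getD i 0)).2)

theorem elementaryForm_apply (k : ℕ) (l : List ℕ) (v : Fin k → Ham) :
    elementaryForm k l v = Matrix.det (Matrix.of fun i j : Fin k =>
      cf (decode (l.getD j 0)).1 (decode (l.getD j 0)).2 (v i)) := rfl

theorem continuous_elementaryForm (k : ℕ) (l : List ℕ) :
    Continuous fun v : Fin k → Ham => elementaryForm k l v := by
  simp only [elementaryForm_apply]
  refine Continuous.matrix_det (continuous_matrix fun i j => ?_)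
  exact (continuous_cf _ _).comp (continuous_apply i)

theorem eq_of_cf_mono_ne_zero {a b c d : ℕ} (h : cf a b (mono c d) ≠ 0) : (c, d) = (a, b) := by
  by_cases h0 : c + d = 0
  · obtain ⟨rfl, rfl⟩ : c = 0 ∧ d = 0 := by omega
    simp [mono_zero] at h
  · rw [cf_mono _ _ _ _ h0] at h
    simp at h
    simp [h.1, h.2]

theorem exists_perm_of_elementaryForm_ne_zero {k : ℕ} {l : List ℕ} {t : Fin k → ℕ × ℕ}
    (h : onMono (elementaryForm k l) t ≠ 0) :
    ∃ σ : Equiv.Perm (Fin k), ∀ i, t (σ i) = decode (l.getD i 0) := by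
  rw [onMono, elementaryForm_apply, Matrix.det_apply] at h
  obtain ⟨σ, -, hσ⟩ := Finset.exists_ne_zero_of_sum_ne_zero h
  refine ⟨σ, fun i => ?_⟩
  have h1 : ∏ i : Fin k, cf (decode (l.getD i 0)).1 (decode (l.getD i 0)).2
      (mono (t (σ i)).1 (t (σ i)).2) ≠ 0 := by
    intro h0
    apply hσ
    have : ∏ i, (Matrix.of fun i j : Fin k => cf (decode (l.getD j 0)).1 (decode (l.getD j 0)).2
      (mono (t i).1 (t i).2)) (σ i) i = 0 := h0
    rw [this, smul_zero]
  have h2 := Finset.prod_ne_zero_iff.mp h1 i (Finset.mem_univ i)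
  exact eq_of_cf_mono_ne_zero h2

theorem ofFn_getD {k : ℕ} {l : List ℕ} (h : l.length = k) :
    List.ofFn (fun i : Fin k => l.getD i 0) = l := by
  subst h
  refine List.ext_getElem (by simp) fun i h1 h2 => ?_
  simp

theorem onList_eq_onMono {k : ℕ} (f : Ham [⋀^Fin k]→ₗ[ℝ] ℝ) {l : List ℕ} (h : l.length = k) :
    onList k f l = onMono f fun i => decode (l.getD i 0) := by
  conv_lhs => rw [← ofFn_getD h, onList_ofFn]
  rfl

theorem onList_elementaryForm_self {k : ℕ} {l : List ℕ} (hk : l.length = k)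
    (hl : l.Pairwise (· < ·)) (hc : ∀ p ∈ l, IsCode p) : onList k (elementaryForm k l) l = 1 := by
  rw [onList_eq_onMono _ hk, onMono, elementaryForm_apply]
  subst hk
  rw [← Matrix.det_one (n := Fin l.length)]
  congr 1
  ext i j
  have hi : IsCode (l.getD i 0) := hc _ (by simp)
  have hj : IsCode (l.getD j 0) := hc _ (by simp)
  have hi0 : (decode (l.getD i 0)).1 + (decode (l.getD i 0)).2 ≠ 0 := by
    obtain ⟨h1, h2, -⟩ := hi
    simp only [decode]
    omega
  rw [Matrix.of_apply, cf_mono _ _ _ _ hi0, Matrix.one_apply]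
  refine if_congr ⟨fun h => ?_, fun h => by simp [h]⟩ rfl rfl
  have h1 : l.getD j 0 = l.getD i 0 := decode_injOn hj.1 hi.1 (Prod.ext h.1 h.2)
  have h2 : l.Nodup := hl.imp fun h => h.ne
  simp only [List.getD_eq_getElem?_getD, Fin.is_lt, getElem?_pos, Option.getD_some] at h1
  exact Fin.ext ((List.Nodup.getElem_inj_iff h2).mp h1).symm

theorem eq_of_onList_elementaryForm_ne_zero {k : ℕ} {l l' : List ℕ} (hk : l.length = k)
    (hl : l.Pairwise (· < ·)) (hc : ∀ p ∈ l, IsCode p) (hk' : l'.length = k)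
    (hl' : l'.Pairwise (· < ·)) (hc' : ∀ p ∈ l', p % 32 ≤ p / 32)
    (h : onList k (elementaryForm k l) l' ≠ 0) : l = l' := by
  rw [onList_eq_onMono _ hk'] at h
  obtain ⟨σ, hσ⟩ := exists_perm_of_elementaryForm_ne_zero h
  have hsub : l ⊆ l' := by
    intro p hp
    obtain ⟨i, hi, rfl⟩ := List.getElem_of_mem hp
    subst hk
    have h1 := hσ ⟨i, hi⟩
    simp only [List.getD_eq_getElem?_getD, hi, getElem?_pos, Option.getD_some] at h1
    have h2 : (σ ⟨i, hi⟩ : ℕ) < l'.length := by rw [hk']; exact (σ ⟨i, hi⟩).2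
    simp only [h2, getElem?_pos, Option.getD_some] at h1
    rw [← decode_injOn (hc' _ (List.getElem_mem h2)) (hc _ hp).1 h1]
    exact List.getElem_mem h2
  have hn : l.Nodup := hl.imp fun h => h.ne
  have hp : l.Perm l' :=
    (hn.subperm hsub).perm_of_length_le (by rw [hk, hk'])
  exact hp.eq_of_pairwise' hl hl'

/-- A sorted list of codes whose monomials form a homogeneous tuple. -/
def IsHomList (A : Finset ℕ) (k : ℕ) (w h : ℤ) (l : List ℕ) : Prop :=
  l.length = k ∧ l.Pairwise (· < ·) ∧ (∀ p ∈ l, IsCode p ∧ p / 32 ≠ 2) ∧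
    (l.map fun p => if p / 32 = 1 then 1 else 0).sum ∈ A ∧
    (l.map fun p => ((p / 32 : ℕ) - 2 : ℤ)).sum = w ∧
    (l.map fun p => (2 * (p % 32 : ℕ) - (p / 32 : ℕ) : ℤ)).sum = h

variable {A : Finset ℕ} {k : ℕ} {w h : ℤ}

theorem isHomList_ofFn {u : Fin k → ℕ} : IsHomList A k w h (List.ofFn u) ↔
    (List.ofFn u).Pairwise (· < ·) ∧ (∀ i, IsCode (u i)) ∧
      IsHomogeneous A w h fun i => decode (u i) := by
  have key : (∀ i, IsCode (u i)) → ((∀ i, u i / 32 ≠ 2) ∧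
    (∑ i, if u i / 32 = 1 then 1 else 0) ∈ A ∧
    ∑ i, ((u i / 32 : ℕ) - 2 : ℤ) = w ∧
    ∑ i, (2 * (u i % 32 : ℕ) - (u i / 32 : ℕ) : ℤ) = h ↔ IsHomogeneous A w h fun i => decode (u i)) := by
    intro hc
    have h0 : ∀ i, (decode (u i)).1 + (decode (u i)).2 = u i / 32 := fun i => by
      have := (hc i).1
      simp only [decode]
      omega
    have h1 : ∀ i, ((decode (u i)).1 - (decode (u i)).2 : ℤ) =
        2 * (u i % 32 : ℕ) - (u i / 32 : ℕ) := fun i => by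
      have := (hc i).1
      simp only [decode]
      omega
    have h2 : ∀ i, u i / 32 ≠ 0 := fun i => by have := (hc i).2.1; omega
    simp only [IsHomogeneous, h0, h1, Finset.card_filter, ne_eq, h2, not_false_eq_true, true_and]
  simp only [IsHomList, List.length_ofFn, List.forall_mem_ofFn_iff, List.map_ofFn, List.sum_ofFn,
    Function.comp_apply, true_and, forall_and]
  constructor
  · rintro ⟨a, ⟨b, c⟩, d⟩
    exact ⟨a, b, (key b).mp ⟨c, d⟩⟩
  · rintro ⟨a, b, c⟩
    obtain ⟨d, e⟩ := (key b).mpr c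
    exact ⟨a, ⟨b, d⟩, e⟩

theorem IsHomogeneous.comp_perm {t : Fin k → ℕ × ℕ} (σ : Equiv.Perm (Fin k))
    (ht : IsHomogeneous A w h fun i => t (σ i)) : IsHomogeneous A w h t := by
  obtain ⟨h1, h2, h3, h4⟩ := ht
  refine ⟨fun i => ?_, ?_, ?_, ?_⟩
  · simpa using h1 (σ.symm i)
  · rw [Finset.card_filter] at h2 ⊢
    rwa [← Equiv.sum_comp σ]
  · rwa [← Equiv.sum_comp σ]
  · rwa [← Equiv.sum_comp σ]

theorem IsHomogeneous.degree_le (hA : ∀ n ∈ A, n ≤ 2) (hw : w ≤ 10) {t : Fin k → ℕ × ℕ}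
    (ht : IsHomogeneous A w h t) (i : Fin k) : (t i).1 + (t i).2 ≤ 14 := by
  obtain ⟨h1, h2, h3, -⟩ := ht
  have h2 := hA _ h2
  rw [Finset.card_filter] at h2
  rw [← Finset.add_sum_erase _ _ (Finset.mem_univ i)] at h3
  have h4 : ∑ j ∈ Finset.univ.erase i, (((t j).1 + (t j).2 : ℕ) - 2 : ℤ) ≥
      ∑ j ∈ Finset.univ.erase i, -(if (t j).1 + (t j).2 = 1 then 1 else 0 : ℤ) := by
    refine Finset.sum_le_sum fun j _ => ?_
    have := h1 j
    split_ifs <;> omega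
  have h5 : ∑ j ∈ Finset.univ.erase i, (if (t j).1 + (t j).2 = 1 then 1 else 0 : ℕ) ≤ 2 :=
    (Finset.sum_le_sum_of_subset (Finset.erase_subset _ _)).trans h2
  rw [Finset.sum_neg_distrib] at h4
  have h6 : ∑ j ∈ Finset.univ.erase i, (if (t j).1 + (t j).2 = 1 then 1 else 0 : ℤ) ≤ 2 := by
    exact_mod_cast h5
  omega

theorem exists_isHomList (hA : ∀ n ∈ A, n ≤ 2) (hw : w ≤ 10) {t : Fin k → ℕ × ℕ}
    (ht : IsHomogeneous A w h t) (hi : Function.Injective t) :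
    ∃ σ : Equiv.Perm (Fin k), IsHomList A k w h (List.ofFn fun i => encode (t (σ i))) := by
  have hd : ∀ i, (t i).1 + (t i).2 ≤ 16 := fun i => (ht.degree_le hA hw i).trans (by norm_num)
  refine ⟨Tuple.sort fun i => encode (t i), ?_⟩
  set σ := Tuple.sort fun i => encode (t i)
  refine isHomList_ofFn.mpr ⟨?_, fun i => isCode_encode (hd _) (ht.1 _).1, ?_⟩
  · rw [List.pairwise_ofFn]
    have hm : Monotone ((fun i => encode (t i)) ∘ σ) := Tuple.monotone_sort _
    refine fun i j hij => (hm.strictMono_of_injective ?_) hij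
    intro i j hij
    have := congrArg decode hij
    simp only [Function.comp_apply, decode_encode (hd _)] at this
    exact σ.injective (hi this)
  · simp only [decode_encode (hd _)]
    refine IsHomogeneous.comp_perm σ⁻¹ ?_
    simpa using ht

/-- Forms supported on homogeneous tuples are determined by their values on homogeneous lists. -/
theorem homForms_ext (hA : ∀ n ∈ A, n ≤ 2) (hw : w ≤ 10) {f : Ham [⋀^Fin k]→ₗ[ℝ] ℝ}
    (hf : f ∈ homForms A k w h) (h0 : ∀ l, IsHomList A k w h l → onList k f l = 0) : f = 0 := by
  refine eq_zero_of_mono hf.1 fun t => ?_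
  by_cases ht : IsHomogeneous A w h t
  · by_cases hi : Function.Injective t
    · obtain ⟨σ, hσ⟩ := exists_isHomList hA hw ht hi
      have h1 := h0 _ hσ
      rw [onList_ofFn] at h1
      simp only [codeMono, decode_encode ((ht.degree_le hA hw _).trans (by norm_num : 14 ≤ 16))] at h1
      have h2 := f.map_perm (fun i => mono (t i).1 (t i).2) σ
      have h3 : f ((fun i => mono (t i).1 (t i).2) ∘ σ) = 0 := h1
      rw [h3] at h2
      exact (smul_eq_zero_iff_eq _).mp h2.symm
    · rw [Function.not_injective_iff] at hi
      obtain ⟨i, j, hij, hne⟩ := hi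
      exact f.map_eq_zero_of_eq _ (by simp only [hij]) hne
  · exact hf.2 t ht

theorem elementaryForm_mem {l : List ℕ} (hl : IsHomList A k w h l) :
    elementaryForm k l ∈ homForms A k w h := by
  refine ⟨continuous_elementaryForm k l, fun t ht => ?_⟩
  contrapose! ht
  obtain ⟨σ, hσ⟩ := exists_perm_of_elementaryForm_ne_zero ht
  refine IsHomogeneous.comp_perm σ ?_
  simp only [hσ]
  have hl' := hl
  rw [← ofFn_getD hl.1] at hl'
  exact (isHomList_ofFn.mp hl').2.2

theorem onList_elementaryForm {l l' : List ℕ} (hl : IsHomList A k w h l)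
    (hk' : l'.length = k) (hl' : l'.Pairwise (· < ·)) (hc' : ∀ p ∈ l', p % 32 ≤ p / 32) :
    onList k (elementaryForm k l) l' = if l = l' then 1 else 0 := by
  split_ifs with h0
  · subst h0
    exact onList_elementaryForm_self hk' hl' fun p hp => (hl.2.2.1 p hp).1
  · by_contra h1
    exact h0 (eq_of_onList_elementaryForm_ne_zero hl.1 hl.2.1 (fun p hp => (hl.2.2.1 p hp).1)
      hk' hl' hc' h1)

/-- The form with prescribed values on a finite set of homogeneous lists. -/
def formOfValues (k : ℕ) (S : Finset (List ℕ)) (φ : List ℕ → ℝ) : Ham [⋀^Fin k]→ₗ[ℝ] ℝ :=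
  ∑ l ∈ S, φ l • elementaryForm k l

theorem formOfValues_mem {S : Finset (List ℕ)} (hS : ∀ l ∈ S, IsHomList A k w h l)
    (φ : List ℕ → ℝ) : formOfValues k S φ ∈ homForms A k w h :=
  Submodule.sum_mem _ fun l hl => Submodule.smul_mem _ _ (elementaryForm_mem (hS l hl))

theorem onList_formOfValues {S : Finset (List ℕ)} (hS : ∀ l ∈ S, IsHomList A k w h l)
    (φ : List ℕ → ℝ) {l : List ℕ} (hk : l.length = k) (hl : l.Pairwise (· < ·))
    (hc : ∀ p ∈ l, p % 32 ≤ p / 32) :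
    onList k (formOfValues k S φ) l = if l ∈ S then φ l else 0 := by
  rw [← onListLM_apply, formOfValues, map_sum]
  have : ∀ m ∈ S, onListLM k l (φ m • elementaryForm k m) = if m = l then φ m else 0 := by
    intro m hm
    rw [map_smul, onListLM_apply, onList_elementaryForm (hS m hm) hk hl hc]
    simp
  rw [Finset.sum_congr rfl this, Finset.sum_ite_eq' S l φ]

theorem IsHomList.isCode {l : List ℕ} (hl : IsHomList A k w h l) : ∀ p ∈ l, IsCode p :=
  fun p hp => (hl.2.2.1 p hp).1

/-- Values on homogeneous lists are coordinates on the forms supported on homogeneous tuples. -/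
def homFormsEquiv (hA : ∀ n ∈ A, n ≤ 2) (hw : w ≤ 10) (S : Finset (List ℕ))
    (hS : ∀ l, l ∈ S ↔ IsHomList A k w h l) : homForms A k w h ≃ₗ[ℝ] (S → ℝ) :=
  LinearEquiv.ofBijective
    ((LinearMap.pi fun l : S => onListLM k l.1) ∘ₗ (homForms A k w h).subtype) (by
    constructor
    · rw [injective_iff_map_eq_zero]
      intro f hf
      refine Subtype.ext (homForms_ext hA hw f.2 fun l hl => ?_)
      exact congrFun hf ⟨l, (hS l).mpr hl⟩
    · intro φ
      have hS' : ∀ l ∈ S, IsHomList A k w h l := fun l hl => (hS l).mp hl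
      refine ⟨⟨_, formOfValues_mem hS' fun l => if h : l ∈ S then φ ⟨l, h⟩ else 0⟩, ?_⟩
      ext l
      have hl := hS' l.1 l.2
      refine (onList_formOfValues hS' _ hl.1 hl.2.1 fun p hp => (hl.isCode p hp).1).trans ?_
      simp)

/-! ### Enumeration of homogeneous lists -/

/-- The sublists of `cs` of length `k`, where the degrees minus two sum to `w` and the exponents of
`x` sum to `a`. -/
def enumerate : List ℕ → ℕ → ℕ → ℕ → List (List ℕ)
  | [], k, w, a => if k = 0 ∧ w = 0 ∧ a = 0 then [[]] else []
  | _ :: _, 0, w, a => if w = 0 ∧ a = 0 then [[]] else []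
  | c :: cs, k + 1, w, a =>
    if w < (k + 1) * (c / 32 - 2) then []
    else (if a < c % 32 then []
      else (enumerate cs k (w - (c / 32 - 2)) (a - c % 32)).map fun l => c :: l) ++
        enumerate cs (k + 1) w a

theorem mem_enumerate : ∀ {cs : List ℕ} {k w a : ℕ} {l : List ℕ}, cs.Pairwise (· < ·) →
    (l ∈ enumerate cs k w a ↔ l.Sublist cs ∧ l.length = k ∧
      (l.map fun p => p / 32 - 2).sum = w ∧ (l.map fun p => p % 32).sum = a)
  | [], k, w, a, l, _ => by
    rw [enumerate, List.sublist_nil]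
    constructor
    · intro h
      split_ifs at h with h0
      · obtain ⟨rfl, rfl, rfl⟩ := h0
        simp at h
        simp [h]
      · simp at h
    · rintro ⟨rfl, rfl, rfl, rfl⟩
      simp
  | c :: cs, 0, w, a, l, _ => by
    rw [enumerate]
    constructor
    · intro h
      split_ifs at h with h0
      · obtain ⟨rfl, rfl⟩ := h0
        simp at h
        simp [h]
      · simp at h
    · rintro ⟨-, h1, rfl, rfl⟩
      rw [List.length_eq_zero_iff] at h1
      simp [h1]
  | c :: cs, k + 1, w, a, l, hcs => by
    have hcs' := List.pairwise_cons.mp hcs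
    rw [enumerate]
    split_ifs with h1 h2
    · simp only [List.not_mem_nil, false_iff]
      rintro ⟨hl, hk, rfl, -⟩
      have h3 : ∀ x ∈ l.map fun p => p / 32 - 2, c / 32 - 2 ≤ x := by
        intro x hx
        obtain ⟨p, hp, rfl⟩ := List.mem_map.mp hx
        have hp := hl.subset hp
        have : c ≤ p := by
          rcases List.mem_cons.mp hp with rfl | hp
          · exact le_rfl
          · exact (hcs'.1 p hp).le
        have := Nat.div_le_div_right (c := 32) this
        omega
      have h4 := List.card_nsmul_le_sum _ _ h3
      rw [List.length_map, hk, smul_eq_mul] at h4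
      omega
    · rw [List.nil_append, mem_enumerate hcs'.2]
      constructor
      · rintro ⟨hl, h⟩
        exact ⟨hl.cons c, h⟩
      · rintro ⟨hl, hk, hw, ha⟩
        cases hl with
        | cons _ hl => exact ⟨hl, hk, hw, ha⟩
        | cons_cons _ hl =>
          simp at ha
          omega
    · rw [List.mem_append, List.mem_map, mem_enumerate hcs'.2]
      simp only [mem_enumerate hcs'.2]
      constructor
      · rintro (⟨m, ⟨hm, hk, hw, ha⟩, rfl⟩ | ⟨hl, h⟩)
        · refine ⟨hm.cons_cons c, by simp [hk], ?_, ?_⟩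
          · have : 1 * (c / 32 - 2) ≤ (k + 1) * (c / 32 - 2) := Nat.mul_le_mul_right _ (by omega)
            simp only [List.map_cons, List.sum_cons]
            omega
          · simp only [List.map_cons, List.sum_cons]
            omega
        · exact ⟨hl.cons c, h⟩
      · rintro ⟨hl, hk, hw, ha⟩
        cases hl with
        | cons _ hl => exact Or.inr ⟨hl, hk, hw, ha⟩
        | cons_cons _ hl =>
          rename_i m
          simp at hk hw ha
          exact Or.inl ⟨m, ⟨hl, hk, by omega, by omega⟩, rfl⟩

theorem nodup_enumerate : ∀ {cs : List ℕ} {k w a : ℕ}, cs.Pairwise (· < ·) →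
    (enumerate cs k w a).Nodup
  | [], k, w, a, _ => by
    rw [enumerate]
    split_ifs <;> simp
  | c :: cs, 0, w, a, _ => by
    rw [enumerate]
    split_ifs <;> simp
  | c :: cs, k + 1, w, a, hcs => by
    have hcs' := List.pairwise_cons.mp hcs
    rw [enumerate]
    split_ifs with h1 h2
    · simp
    · simpa using nodup_enumerate hcs'.2
    · refine List.Nodup.append ((nodup_enumerate hcs'.2).map fun _ _ h => (List.cons.inj h).2)
        (nodup_enumerate hcs'.2) ?_
      rw [List.disjoint_left]
      intro l hl hl'
      obtain ⟨m, -, rfl⟩ := List.mem_map.mp hl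
      have := ((mem_enumerate hcs'.2).mp hl').1.subset (List.mem_cons_self ..)
      exact lt_irrefl _ (hcs'.1 c this)

/-- The codes of the monomials of degree between `3` and `14`. -/
def higherCodes : List ℕ := (List.range 463).filter fun p => Nat.ble 96 p && Nat.ble (p % 32) (p / 32)

theorem pairwise_higherCodes : higherCodes.Pairwise (· < ·) := List.pairwise_lt_range.filter _

theorem mem_higherCodes {p : ℕ} : p ∈ higherCodes ↔ 3 ≤ p / 32 ∧ p / 32 ≤ 14 ∧ p % 32 ≤ p / 32 := by
  simp only [higherCodes, List.mem_filter, List.mem_range, Bool.and_eq_true, Nat.ble_eq]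
  omega

/-- The homogeneous lists of monomials of degree at least three. -/
def leafLists (k : ℕ) (w h : ℤ) : List (List ℕ) :=
  if 0 ≤ w ∧ 0 ≤ w + 2 * k + h ∧ (w + 2 * k + h) % 2 = 0 then
    enumerate higherCodes k w.toNat ((w + 2 * k + h) / 2).toNat
  else []

theorem sum_weights {l : List ℕ} (hl : ∀ p ∈ l, p ∈ higherCodes) :
    (l.map fun p => ((p / 32 : ℕ) - 2 : ℤ)).sum = ((l.map fun p => p / 32 - 2).sum : ℕ) := by
  induction l with
  | nil => rfl
  | cons p l ih =>
    have := (mem_higherCodes.mp (hl p (by simp))).1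
    simp only [List.map_cons, List.sum_cons, ih fun q hq => hl q (by simp [hq])]
    push_cast
    omega

theorem sum_charges {l : List ℕ} :
    (l.map fun p => (2 * (p % 32 : ℕ) - (p / 32 : ℕ) : ℤ)).sum =
      2 * ((l.map fun p => p % 32).sum : ℕ) - (l.map fun p => ((p / 32 : ℕ) - 2 : ℤ)).sum -
        2 * l.length := by
  induction l with
  | nil => rfl
  | cons p l ih =>
    simp only [List.map_cons, List.sum_cons, ih, List.length_cons]
    push_cast
    ring

theorem mem_leafLists {k : ℕ} {w h : ℤ} {l : List ℕ} : l ∈ leafLists k w h ↔ l.length = k ∧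
    l.Pairwise (· < ·) ∧ (∀ p ∈ l, p ∈ higherCodes) ∧
    (l.map fun p => ((p / 32 : ℕ) - 2 : ℤ)).sum = w ∧
    (l.map fun p => (2 * (p % 32 : ℕ) - (p / 32 : ℕ) : ℤ)).sum = h := by
  rw [sum_charges, leafLists]
  constructor
  · intro hl
    split_ifs at hl with h0
    · obtain ⟨h1, h2, h3, h4⟩ := (mem_enumerate pairwise_higherCodes).mp hl
      have h5 := sum_weights fun p hp => h1.subset hp
      refine ⟨h2, pairwise_higherCodes.sublist h1, fun p hp => h1.subset hp, ?_, ?_⟩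
      · omega
      · rw [h5, h3, h4, h2]
        omega
    · simp at hl
  · rintro ⟨h1, h2, h3, h4, h5⟩
    have h6 := sum_weights h3
    rw [if_pos (by omega), mem_enumerate pairwise_higherCodes]
    refine ⟨?_, h1, by omega, by omega⟩
    have hn : l.Nodup := h2.imp fun h => h.ne
    exact List.sublist_of_subperm_of_pairwise (hn.subperm h3) h2 pairwise_higherCodes

theorem nodup_leafLists (k : ℕ) (w h : ℤ) : (leafLists k w h).Nodup := by
  rw [leafLists]
  split_ifs
  · exact nodup_enumerate pairwise_higherCodes
  · simp

/-- The homogeneous lists of monomials with exactly one linear monomial. -/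
def oneLinearLists : ℕ → ℤ → ℤ → List (List ℕ)
  | 0, _, _ => []
  | k + 1, w, h => ((leafLists k (w + 1) (h + 1)).map fun l => 32 :: l) ++
      (leafLists k (w + 1) (h - 1)).map fun l => 33 :: l

/-- The homogeneous lists of monomials with two linear monomials. -/
def twoLinearLists : ℕ → ℤ → ℤ → List (List ℕ)
  | 0, _, _ => []
  | 1, _, _ => []
  | k + 2, w, h => (leafLists k (w + 2) h).map fun l => 32 :: 33 :: l

/-- All homogeneous lists of non-quadratic monomials. -/
def hamLists (k : ℕ) (w h : ℤ) : List (List ℕ) :=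
  leafLists k w h ++ oneLinearLists k w h ++ twoLinearLists k w h

theorem IsHomList.degree_le {A : Finset ℕ} (hA : ∀ n ∈ A, n ≤ 2) {k : ℕ} {w h : ℤ} (hw : w ≤ 10)
    {l : List ℕ} (hl : IsHomList A k w h l) : ∀ p ∈ l, p / 32 ≤ 14 := by
  have hl' := hl
  rw [← ofFn_getD hl.1] at hl' ⊢
  rw [List.forall_mem_ofFn_iff]
  intro i
  obtain ⟨-, h1, h2⟩ := isHomList_ofFn.mp hl'
  have h3 := h2.degree_le hA hw i
  have h4 := (h1 i).1
  simp only [decode] at h3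
  omega

theorem IsHomList.mem_higherCodes {A : Finset ℕ} (hA : ∀ n ∈ A, n ≤ 2) {k : ℕ} {w h : ℤ}
    (hw : w ≤ 10) {l : List ℕ} (hl : IsHomList A k w h l) :
    ∀ p ∈ l, p / 32 = 1 ∨ p ∈ higherCodes := by
  intro p hp
  have h1 := hl.degree_le hA hw p hp
  obtain ⟨⟨h2, h3, -⟩, h4⟩ := hl.2.2.1 p hp
  rw [GelfandFuks.mem_higherCodes]
  omega

theorem sum_linear {l : List ℕ} (hl : ∀ p ∈ l, p ∈ higherCodes) :
    (l.map fun p => if p / 32 = 1 then 1 else 0).sum = 0 := by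
  rw [List.sum_eq_zero_iff]
  intro x hx
  obtain ⟨p, hp, rfl⟩ := List.mem_map.mp hx
  have := (mem_higherCodes.mp (hl p hp)).1
  rw [if_neg (by omega)]

theorem isCode_of_mem_higherCodes {p : ℕ} (hp : p ∈ higherCodes) : IsCode p ∧ p / 32 ≠ 2 := by
  rw [mem_higherCodes] at hp
  rw [IsCode]
  omega

theorem isHomList_of_mem_leafLists {A : Finset ℕ} (hA : 0 ∈ A) {k : ℕ} {w h : ℤ} {l : List ℕ}
    (hl : l ∈ leafLists k w h) : IsHomList A k w h l := by
  obtain ⟨h1, h2, h3, h4, h5⟩ := mem_leafLists.mp hl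
  exact ⟨h1, h2, fun p hp => isCode_of_mem_higherCodes (h3 p hp), by rwa [sum_linear h3], h4, h5⟩

theorem isHomList_leaf {k : ℕ} {w h : ℤ} (hw : w ≤ 10) {l : List ℕ} :
    IsHomList {0} k w h l ↔ l ∈ leafLists k w h := by
  refine ⟨fun hl => ?_, isHomList_of_mem_leafLists (by simp)⟩
  refine mem_leafLists.mpr ⟨hl.1, hl.2.1, fun p hp => ?_, hl.2.2.2.2⟩
  refine (hl.mem_higherCodes (by simp) hw p hp).resolve_left fun h1 => ?_
  have h0 := hl.2.2.2.1
  rw [Finset.mem_singleton, List.sum_eq_zero_iff] at h0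
  have := h0 _ (List.mem_map.mpr ⟨p, hp, rfl⟩)
  simp [h1] at this

theorem isHomList_of_mem_oneLinearLists {A : Finset ℕ} (hA : 1 ∈ A) {k : ℕ} {w h : ℤ} {l : List ℕ}
    (hl : l ∈ oneLinearLists k w h) : IsHomList A k w h l := by
  have key : ∀ {k : ℕ} {h' : ℤ} {m : List ℕ} {p : ℕ}, m ∈ leafLists k (w + 1) h' →
      p = 32 ∨ p = 33 → h' + (2 * (p % 32 : ℕ) - 1) = h → IsHomList A (k + 1) w h (p :: m) := by
    intro k h' m p hm hp hh
    obtain ⟨h1, h2, h3, h4, h5⟩ := mem_leafLists.mp hm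
    refine ⟨by simp [h1], List.pairwise_cons.mpr ⟨fun q hq => ?_, h2⟩, ?_, ?_, ?_, ?_⟩
    · have := (mem_higherCodes.mp (h3 q hq)).1
      omega
    · intro q hq
      rcases List.mem_cons.mp hq with rfl | hq
      · rw [IsCode]
        omega
      · exact isCode_of_mem_higherCodes (h3 q hq)
    · have h6 : p / 32 = 1 := by omega
      rw [List.map_cons, List.sum_cons, sum_linear h3, if_pos h6]
      exact hA
    · rw [List.map_cons, List.sum_cons, h4]
      omega
    · rw [List.map_cons, List.sum_cons, h5]
      omega
  cases k with
  | zero => simp [oneLinearLists] at hl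
  | succ k =>
    rw [oneLinearLists, List.mem_append, List.mem_map, List.mem_map] at hl
    rcases hl with ⟨m, hm, rfl⟩ | ⟨m, hm, rfl⟩
    · exact key hm (Or.inl rfl) (by norm_num)
    · exact key hm (Or.inr rfl) (by norm_num)

theorem isHomList_of_mem_twoLinearLists {A : Finset ℕ} (hA : 2 ∈ A) {k : ℕ} {w h : ℤ} {l : List ℕ}
    (hl : l ∈ twoLinearLists k w h) : IsHomList A k w h l := by
  match k, hl with
  | k + 2, hl =>
    rw [twoLinearLists, List.mem_map] at hl
    obtain ⟨m, hm, rfl⟩ := hl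
    obtain ⟨h1, h2, h3, h4, h5⟩ := mem_leafLists.mp hm
    refine ⟨by simp [h1], ?_, ?_, ?_, ?_, ?_⟩
    · have h6 : ∀ q ∈ m, 33 < q := fun q hq => by
        have := (mem_higherCodes.mp (h3 q hq)).1
        omega
      refine List.pairwise_cons.mpr ⟨fun q hq => ?_, List.pairwise_cons.mpr ⟨h6, h2⟩⟩
      rcases List.mem_cons.mp hq with rfl | hq
      · norm_num
      · exact lt_trans (by norm_num) (h6 q hq)
    · intro q hq
      rw [List.mem_cons, List.mem_cons] at hq
      rcases hq with rfl | rfl | hq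
      · rw [IsCode]
        omega
      · rw [IsCode]
        omega
      · exact isCode_of_mem_higherCodes (h3 q hq)
    · simpa [sum_linear h3] using hA
    · rw [List.map_cons, List.sum_cons, List.map_cons, List.sum_cons, h4]
      omega
    · rw [List.map_cons, List.sum_cons, List.map_cons, List.sum_cons, h5]
      omega

theorem isHomList_ham {k : ℕ} {w h : ℤ} (hw : w ≤ 10) {l : List ℕ} :
    IsHomList {0, 1, 2} k w h l ↔ l ∈ hamLists k w h := by
  rw [hamLists, List.mem_append, List.mem_append]
  constructor
  · intro hl
    have h0 := hl.mem_higherCodes (by simp) hw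
    obtain ⟨hk, hs, hc, -, h1, h2⟩ := hl
    have key : ∀ {p : ℕ} {m : List ℕ}, (p :: m).Pairwise (· < ·) → p ∈ higherCodes →
        (∀ q ∈ m, q / 32 = 1 ∨ q ∈ higherCodes) → ∀ q ∈ p :: m, q ∈ higherCodes := by
      intro p m hm hp hq q hq'
      rcases List.mem_cons.mp hq' with rfl | hq'
      · exact hp
      · have h3 := (List.pairwise_cons.mp hm).1 q hq'
        have h4 := (mem_higherCodes.mp hp).1
        exact (hq q hq').resolve_left (by omega)
    have one : ∀ {p : ℕ} {m : List ℕ} {k : ℕ}, IsCode p → p / 32 = 1 → (p :: m).length = k →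
        (p :: m).Pairwise (· < ·) → (∀ q ∈ m, q ∈ higherCodes) →
        ((p :: m).map fun p => ((p / 32 : ℕ) - 2 : ℤ)).sum = w →
        ((p :: m).map fun p => (2 * (p % 32 : ℕ) - (p / 32 : ℕ) : ℤ)).sum = h →
        p :: m ∈ oneLinearLists k w h := by
      intro p m k hp hp1 hk hm hq h1 h2
      obtain ⟨k, rfl⟩ : ∃ n, k = n + 1 := ⟨m.length, by simpa using hk.symm⟩
      have hk' : m.length = k := by simpa using hk
      have hm' := (List.pairwise_cons.mp hm).2
      rw [List.map_cons, List.sum_cons] at h1 h2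
      rw [oneLinearLists, List.mem_append, List.mem_map, List.mem_map]
      have h3 := hp.1
      obtain rfl | rfl : p = 32 ∨ p = 33 := by omega
      · exact Or.inl ⟨m, mem_leafLists.mpr ⟨hk', hm', hq, by omega, by omega⟩, rfl⟩
      · exact Or.inr ⟨m, mem_leafLists.mpr ⟨hk', hm', hq, by omega, by omega⟩, rfl⟩
    match l, k, hk with
    | [], k, hk =>
      exact Or.inl (Or.inl (mem_leafLists.mpr ⟨hk, hs, by simp, h1, h2⟩))
    | [p], k, hk =>
      rcases h0 p (by simp) with h3 | h3
      · exact Or.inl (Or.inr (one (hc p (by simp)).1 h3 hk hs (by simp) h1 h2))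
      · exact Or.inl (Or.inl (mem_leafLists.mpr ⟨hk, hs, key hs h3 (by simp), h1, h2⟩))
    | p :: q :: m, k, hk =>
      have hs' := List.pairwise_cons.mp hs
      have hs'' := List.pairwise_cons.mp hs'.2
      rcases h0 p (by simp) with h3 | h3
      · rcases h0 q (by simp) with h4 | h4
        · obtain ⟨k, rfl⟩ : ∃ n, k = n + 2 := ⟨m.length, by simpa using hk.symm⟩
          have h5 := (hc p (by simp)).1.1
          have h6 := (hc q (by simp)).1.1
          have h7 := hs'.1 q (by simp)
          obtain ⟨rfl, rfl⟩ : p = 32 ∧ q = 33 := by omega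
          simp only [List.map_cons, List.sum_cons] at h1 h2
          refine Or.inr (List.mem_map.mpr ⟨m, mem_leafLists.mpr ⟨by simpa using hk, hs''.2, ?_,
            by omega, by omega⟩, rfl⟩)
          intro r hr
          refine (h0 r (by simp [hr])).resolve_left fun h8 => ?_
          have h9 := hs''.1 r hr
          have h10 := (hc r (by simp [hr])).1.1
          omega
        · refine Or.inl (Or.inr (one (hc p (by simp)).1 h3 hk hs ?_ h1 h2))
          exact key hs'.2 h4 fun r hr => h0 r (by simp [hr])
      · refine Or.inl (Or.inl (mem_leafLists.mpr ⟨hk, hs, ?_, h1, h2⟩))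
        exact key hs h3 fun r hr => h0 r (List.mem_cons_of_mem _ hr)
  · rintro ((hl | hl) | hl)
    · exact isHomList_of_mem_leafLists (by simp) hl
    · exact isHomList_of_mem_oneLinearLists (by simp) hl
    · exact isHomList_of_mem_twoLinearLists (by simp) hl

theorem nodup_hamLists (k : ℕ) (w h : ℤ) : (hamLists k w h).Nodup := by
  have h1 : (oneLinearLists k w h).Nodup := by
    cases k with
    | zero => simp [oneLinearLists]
    | succ k =>
      refine List.Nodup.append ((nodup_leafLists _ _ _).map fun _ _ h => (List.cons.inj h).2)
        ((nodup_leafLists _ _ _).map fun _ _ h => (List.cons.inj h).2) ?_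
      rw [List.disjoint_left]
      intro l hl hl'
      obtain ⟨m, -, rfl⟩ := List.mem_map.mp hl
      obtain ⟨m', -, h⟩ := List.mem_map.mp hl'
      simp at h
  have h2 : (twoLinearLists k w h).Nodup := by
    match k with
    | 0 => simp [twoLinearLists]
    | 1 => simp [twoLinearLists]
    | k + 2 =>
      exact (nodup_leafLists _ _ _).map fun _ _ h => (List.cons.inj (List.cons.inj h).2).2
  have key : ∀ {n m : ℕ} {l : List ℕ}, IsHomList {n} k w h l → IsHomList {m} k w h l → n = m := by
    intro n m l hn hm
    have h1 := hn.2.2.2.1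
    have h2 := hm.2.2.2.1
    rw [Finset.mem_singleton] at h1 h2
    rw [← h1, ← h2]
  rw [hamLists]
  refine List.Nodup.append (List.Nodup.append (nodup_leafLists _ _ _) h1 ?_) h2 ?_
  · rw [List.disjoint_left]
    intro l hl hl'
    exact absurd (key (isHomList_of_mem_leafLists (Finset.mem_singleton_self 0) hl)
      (isHomList_of_mem_oneLinearLists (Finset.mem_singleton_self 1) hl')) (by norm_num)
  · rw [List.disjoint_left]
    intro l hl hl'
    have h3 := isHomList_of_mem_twoLinearLists (Finset.mem_singleton_self 2) hl'
    rcases List.mem_append.mp hl with hl | hl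
    · exact absurd (key (isHomList_of_mem_leafLists (Finset.mem_singleton_self 0) hl) h3)
        (by norm_num)
    · exact absurd (key (isHomList_of_mem_oneLinearLists (Finset.mem_singleton_self 1) hl) h3)
        (by norm_num)

theorem finrank_homForms_leaf {k : ℕ} {w h : ℤ} (hw : w ≤ 10) :
    Module.finrank ℝ (homForms {0} k w h) = (leafLists k w h).length := by
  rw [(homFormsEquiv (A := {0}) (by simp) hw (leafLists k w h).toFinset fun l => by
    rw [List.mem_toFinset, isHomList_leaf hw]).finrank_eq, Module.finrank_fintype_fun_eq_card,
    Fintype.card_coe, List.toFinset_card_of_nodup (nodup_leafLists _ _ _)]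

theorem finrank_homForms_ham {k : ℕ} {w h : ℤ} (hw : w ≤ 10) :
    Module.finrank ℝ (homForms {0, 1, 2} k w h) = (hamLists k w h).length := by
  rw [(homFormsEquiv (A := {0, 1, 2}) (by simp) hw (hamLists k w h).toFinset fun l => by
    rw [List.mem_toFinset, isHomList_ham hw]).finrank_eq, Module.finrank_fintype_fun_eq_card,
    Fintype.card_coe, List.toFinset_card_of_nodup (nodup_hamLists _ _ _)]

theorem finiteDimensional_leaf {k : ℕ} {w h : ℤ} (hw : w ≤ 10) :
    FiniteDimensional ℝ (homForms {0} k w h) :=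
  (homFormsEquiv (A := {0}) (by simp) hw (leafLists k w h).toFinset fun l => by
    rw [List.mem_toFinset, isHomList_leaf hw]).symm.finiteDimensional

theorem finiteDimensional_ham {k : ℕ} {w h : ℤ} (hw : w ≤ 10) :
    FiniteDimensional ℝ (homForms {0, 1, 2} k w h) :=
  (homFormsEquiv (A := {0, 1, 2}) (by simp) hw (hamLists k w h).toFinset fun l => by
    rw [List.mem_toFinset, isHomList_ham hw]).symm.finiteDimensional

theorem finrank_invariantForms_leaf {k : ℕ} {w : ℤ} (hw : w ≤ 10) :
    Module.finrank ℝ (invariantForms {0} k w) + (leafLists k w (-2)).length =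
      (leafLists k w 0).length := by
  have := finiteDimensional_leaf (k := k) (h := 0) hw
  have := finiteDimensional_leaf (k := k) (h := -2) hw
  rw [← finrank_homForms_leaf hw, ← finrank_homForms_leaf hw, finrank_invariantForms]

theorem finrank_invariantForms_ham {k : ℕ} {w : ℤ} (hw : w ≤ 10) :
    Module.finrank ℝ (invariantForms {0, 1, 2} k w) + (hamLists k w (-2)).length =
      (hamLists k w 0).length := by
  have := finiteDimensional_ham (k := k) (h := 0) hw
  have := finiteDimensional_ham (k := k) (h := -2) hw
  rw [← finrank_homForms_ham hw, ← finrank_homForms_ham hw, finrank_invariantForms]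

/-! ### Relative cochains as invariant forms -/

theorem mem_sp {f : Ham} : f ∈ sp ↔ f ∈ weightPart 0 := Iff.rfl

theorem cf_eq_zero_of_mem {j : ℤ} {v : Ham} (hv : v ∈ weightPart j) {a b : ℕ}
    (h : (a : ℤ) + b ≠ j + 2) : cf a b v = 0 :=
  hv _ (by rw [degree_expo]; push_cast; exact h)

theorem eq_sum_mono {n : ℕ} {v : Ham} (hv : v ∈ weightPart ((n : ℤ) - 2)) :
    v = ∑ p ∈ Finset.HasAntidiagonal.antidiagonal n, cf p.1 p.2 v • mono p.1 p.2 := by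
  refine ham_ext fun a b => ?_
  rw [map_sum]
  by_cases h : a + b = n
  · subst h
    rw [Finset.sum_eq_single (a, b)]
    · by_cases h0 : a + b = 0
      · obtain ⟨rfl, rfl⟩ : a = 0 ∧ b = 0 := by omega
        simp [cf_zero]
      · simp [cf_mono a b a b h0]
    · rintro ⟨c, d⟩ - hne
      rw [map_smul]
      by_contra h1
      exact hne (eq_of_cf_mono_ne_zero (right_ne_zero_of_smul h1))
    · simp
  · rw [cf_eq_zero_of_mem hv (by omega)]
    symm
    refine Finset.sum_eq_zero fun p hp => ?_
    rw [map_smul]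
    by_contra h1
    have h2 := eq_of_cf_mono_ne_zero (right_ne_zero_of_smul h1)
    rw [Prod.mk.injEq] at h2
    rw [Finset.HasAntidiagonal.mem_antidiagonal] at hp
    omega

theorem mono_mem_sp {a b : ℕ} (h : a + b = 2) : mono a b ∈ sp := by
  have := mono_mem_weightPart a b
  rwa [show (a : ℤ) + b - 2 = 0 by omega] at this

theorem onMono_eq_zero_of_eq {k : ℕ} (f : Ham [⋀^Fin k]→ₗ[ℝ] ℝ) {t : Fin k → ℕ × ℕ} {i j : Fin k}
    (hij : i ≠ j) (h : t i = t j) : onMono f t = 0 :=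
  f.map_eq_zero_of_eq _ (by simp only [h]) hij

theorem card_linear_le {k : ℕ} {f : Ham [⋀^Fin k]→ₗ[ℝ] ℝ} {t : Fin k → ℕ × ℕ}
    (h : onMono f t ≠ 0) : (Finset.univ.filter fun i => (t i).1 + (t i).2 = 1).card ≤ 2 := by
  rw [show (2 : ℕ) = ({(1, 0), (0, 1)} : Finset (ℕ × ℕ)).card from rfl]
  refine Finset.card_le_card_of_injOn t (fun i hi => ?_) fun i _ j _ hij => ?_
  · have h1 := (Finset.mem_filter.mp hi).2
    simp only [Finset.coe_insert, Finset.coe_singleton, Set.mem_insert_iff, Set.mem_singleton_iff,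
      Prod.ext_iff]
    omega
  · by_contra hne
    exact h (onMono_eq_zero_of_eq f hne hij)

theorem isHomogeneous_of_ne_zero {k : ℕ} {w : ℤ} {f : Ham [⋀^Fin k]→ₗ[ℝ] ℝ}
    (hf : f ∈ cochains sp weightPart k w) {t : Fin k → ℕ × ℕ} (h : onMono f t ≠ 0) :
    IsHomogeneous {0, 1, 2} w 0 t := by
  refine ⟨fun i => ⟨fun h0 => ?_, fun h2 => ?_⟩, ?_, ?_, ?_⟩
  · obtain ⟨h1, h2⟩ : (t i).1 = 0 ∧ (t i).2 = 0 := by omega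
    exact h (f.map_coord_zero i (by rw [h1, h2, mono_zero]))
  · exact h (hf.2.1 _ ⟨i, mono_mem_sp h2⟩)
  · have := card_linear_le h
    simp only [Finset.mem_insert, Finset.mem_singleton]
    omega
  · by_contra h3
    refine h (hf.2.2.2 (fun i => ((t i).1 + (t i).2 : ℕ) - 2) _ (fun i => ?_) h3)
    simpa using mono_mem_weightPart (t i).1 (t i).2
  · have h1 := onMono_act 1 1 f t
    rw [cochains_act_eq_zero hf (mono_mem_sp rfl)] at h1
    have h2 : ∀ i, Function.update t i (1 + (t i).1 - 1, 1 + (t i).2 - 1) = t := fun i => by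
      simp
    simp only [h2, ← Finset.sum_mul, onMono, AlternatingMap.zero_apply] at h1
    have h3 := (mul_eq_zero.mp h1.symm).resolve_right h
    rw [← Int.cast_inj (α := ℝ)]
    push_cast
    rw [← neg_eq_zero, ← Finset.sum_neg_distrib, ← h3]
    exact Finset.sum_congr rfl fun i _ => by ring

theorem mem_invariantForms_of_mem_cochains {k : ℕ} {w : ℤ} {f : Ham [⋀^Fin k]→ₗ[ℝ] ℝ}
    (hf : f ∈ cochains sp weightPart k w) : f ∈ invariantForms {0, 1, 2} k w := by
  refine ⟨⟨hf.1, fun t ht => ?_⟩, cochains_act_eq_zero hf (mono_mem_sp rfl)⟩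
  by_contra h
  exact ht (isHomogeneous_of_ne_zero hf h)

theorem mem_sp_induction {P : Ham → Prop} (h1 : P (mono 2 0)) (h2 : P (mono 1 1))
    (h3 : P (mono 0 2)) (hadd : ∀ x y, P x → P y → P (x + y)) (hsmul : ∀ (c : ℝ) x, P x → P (c • x))
    {X : Ham} (hX : X ∈ sp) : P X := by
  rw [eq_sum_mono (n := 2) (v := X) (by simpa using mem_sp.mp hX)]
  simp only [Finset.Nat.antidiagonal_succ, Finset.Nat.antidiagonal_zero, Finset.map_singleton,
    Finset.sum_cons, Finset.map_cons, Finset.sum_singleton]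
  exact hadd _ _ (hsmul _ _ h3) (hadd _ _ (hsmul _ _ h2) (hsmul _ _ h1))

theorem act_add_left {k : ℕ} (X Y : Ham) (f : Ham [⋀^Fin k]→ₗ[ℝ] ℝ) :
    act (X + Y) k f = act X k f + act Y k f := by
  ext v
  simp [act_apply, Finset.sum_add_distrib]

theorem act_smul_left {k : ℕ} (c : ℝ) (X : Ham) (f : Ham [⋀^Fin k]→ₗ[ℝ] ℝ) :
    act (c • X) k f = c • act X k f := by
  ext v
  simp [act_apply, Finset.mul_sum]

theorem continuous_curryLeft {L : Type*} [LieRing L] [LieAlgebra ℝ L] [TopologicalSpace L]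
    {k : ℕ} {f : L [⋀^Fin (k + 1)]→ₗ[ℝ] ℝ} (hf : Continuous fun v : Fin (k + 1) → L => f v)
    (X : L) : Continuous fun v : Fin k → L => f.curryLeft X v := by
  refine hf.comp (continuous_pi fun i => ?_)
  refine Fin.cases ?_ (fun i => ?_) i
  · exact continuous_const
  · exact continuous_apply i

theorem homForms_curryLeft_eq_zero {A : Finset ℕ} {k : ℕ} {w h : ℤ} {f : Ham [⋀^Fin (k + 1)]→ₗ[ℝ] ℝ}
    (hf : f ∈ homForms A (k + 1) w h) {X : Ham} (hX : X ∈ sp) : f.curryLeft X = 0 := by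
  have key : ∀ {a b : ℕ}, a + b = 2 → f.curryLeft (mono a b) = 0 := by
    intro a b hab
    refine eq_zero_of_mono (continuous_curryLeft hf.1 _) fun t => ?_
    have h1 := hf.2 (Matrix.vecCons (a, b) t) fun h => (h.1 0).2 hab
    rw [AlternatingMap.curryLeft_apply_apply, ← h1, onMono]
    congr 1
    ext1 i
    refine Fin.cases rfl (fun i => rfl) i
  refine mem_sp_induction (P := fun X => f.curryLeft X = 0) (key rfl) (key rfl) (key rfl) ?_ ?_ hX
  · intro x y hx hy
    rw [map_add, hx, hy, add_zero]
  · intro c x hx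
    rw [map_smul, hx, smul_zero]

theorem homForms_weight {A : Finset ℕ} {k : ℕ} {w h : ℤ} {f : Ham [⋀^Fin k]→ₗ[ℝ] ℝ}
    (hf : f ∈ homForms A k w h) (a : Fin k → ℤ) (v : Fin k → Ham) (hv : ∀ i, v i ∈ weightPart (a i))
    (ha : ∑ i, a i ≠ w) : f v = 0 := by
  by_cases h0 : ∃ i, a i + 2 < 0
  · obtain ⟨i, hi⟩ := h0
    refine f.map_coord_zero i (ham_ext fun c d => ?_)
    have : (0 : ℤ) ≤ c ∧ (0 : ℤ) ≤ d := ⟨c.cast_nonneg, d.cast_nonneg⟩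
    rw [cf_eq_zero_of_mem (hv i) (by omega), map_zero]
  · push Not at h0
    have h1 : ∀ i, v i ∈ weightPart (((a i + 2).toNat : ℤ) - 2) := fun i => by
      have h3 := h0 i
      rw [show (((a i + 2).toNat : ℤ) - 2) = a i by omega]
      exact hv i
    have h2 : v = fun i => ∑ p ∈ Finset.HasAntidiagonal.antidiagonal (a i + 2).toNat, cf p.1 p.2 (v i) • mono p.1 p.2 :=
      funext fun i => eq_sum_mono (h1 i)
    rw [h2]
    refine (f.toMultilinearMap.map_sum_finset _ _).trans (Finset.sum_eq_zero fun r hr => ?_)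
    refine (f.toMultilinearMap.map_smul_univ (fun i => cf (r i).1 (r i).2 (v i))
      (fun i => mono (r i).1 (r i).2)).trans ?_
    have h3 := hf.2 r fun h => ha (by
      rw [← h.2.2.1]
      refine Finset.sum_congr rfl fun i _ => ?_
      have h4 := Finset.HasAntidiagonal.mem_antidiagonal.mp (Fintype.mem_piFinset.mp hr i)
      have := h0 i
      omega)
    rw [onMono] at h3
    simp only [AlternatingMap.coe_multilinearMap, h3, smul_zero]

theorem mem_cochains_of_mem_invariantForms {A : Finset ℕ} {k : ℕ} {w : ℤ}
    {f : Ham [⋀^Fin k]→ₗ[ℝ] ℝ} (hf : f ∈ invariantForms A k w) :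
    f ∈ cochains sp weightPart k w := by
  obtain ⟨h1, h2⟩ := hf
  refine ⟨h1.1, ?_, fun X hX v => ?_, homForms_weight h1⟩
  · rintro v ⟨i, hi⟩
    cases k with
    | zero => exact i.elim0
    | succ k => exact eq_zero_of_curryLeft_mem (homForms_curryLeft_eq_zero h1 hi) rfl
  · rw [← act_apply]
    suffices act X k f = 0 by rw [this]; rfl
    refine mem_sp_induction (P := fun X => act X k f = 0) h2 ?_ (raise_eq_zero h1 h2) ?_ ?_ hX
    · rw [act_one_one h1]
      simp
    · intro x y hx hy
      rw [act_add_left, hx, hy, add_zero]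
    · intro c x hx
      rw [act_smul_left, hx, smul_zero]

theorem cochains_eq_invariantForms (k : ℕ) (w : ℤ) :
    cochains sp weightPart k w = invariantForms {0, 1, 2} k w :=
  le_antisymm (fun _ => mem_invariantForms_of_mem_cochains)
    fun _ => mem_cochains_of_mem_invariantForms

/-! ### Leaf cochains as invariant forms -/

theorem cf_dropConstant (a b : ℕ) (v : Ham) :
    cf a b (dropConstant v : Ham) = if a + b = 1 then 0 else cf a b v := by
  rw [← degree_expo a b]
  rfl

theorem mem_ham0 {v : Ham} : v ∈ ham0 ↔ cf 1 0 v = 0 ∧ cf 0 1 v = 0 := by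
  have h : ∀ i : Fin 2, atOrigin (partialDeriv i (v : Series)) =
      MvPowerSeries.coeff (Finsupp.single i 1) (v : Series) := by
    intro i
    rw [atOrigin, ← MvPowerSeries.coeff_zero_eq_constantCoeff_apply, partialDeriv,
      MvPowerSeries.coeff_pderiv]
    simp
  have h' : v ∈ ham0 ↔ ∀ i : Fin 2, atOrigin (partialDeriv i (v : Series)) = 0 := Iff.rfl
  rw [h', Fin.forall_fin_two, h, h, cf_apply, cf_apply]
  simp [expo]

theorem dropConstant_coe (u : ham0) : dropConstant (u : Ham) = u := by
  have hu := mem_ham0.mp u.2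
  refine Subtype.ext (ham_ext fun a b => ?_)
  rw [cf_dropConstant]
  split_ifs with h
  · rcases (by omega : (a = 1 ∧ b = 0) ∨ (a = 0 ∧ b = 1)) with ⟨rfl, rfl⟩ | ⟨rfl, rfl⟩
    · exact hu.1.symm
    · exact hu.2.symm
  · rfl

theorem sub_dropConstant_mem (v : Ham) : v - dropConstant v ∈ weightPart (-1) := by
  intro m hm
  have h := cf_dropConstant (m 0) (m 1) v
  rw [cf_apply, cf_apply, expo_eta, if_neg] at h
  · change MvPowerSeries.coeff m ((v : Series) - ((dropConstant v : Ham) : Series)) = 0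
    rw [map_sub, h, sub_self]
  · rw [← expo_eta m, degree_expo] at hm
    omega

theorem dropConstant_eq_zero {v : Ham} (hv : v ∈ weightPart (-1)) : dropConstant v = 0 := by
  refine Subtype.ext (ham_ext fun a b => ?_)
  rw [cf_dropConstant]
  split_ifs with h
  · simp
  · rw [cf_eq_zero_of_mem hv (by omega)]
    simp

theorem mono_mem_ham0 {a b : ℕ} (h : a + b ≠ 1) : mono a b ∈ ham0 := by
  by_cases h0 : a + b = 0
  · obtain ⟨rfl, rfl⟩ : a = 0 ∧ b = 0 := by omega
    rw [mono_zero]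
    exact ham0.zero_mem
  · rw [mem_ham0, cf_mono _ _ _ _ h0, cf_mono _ _ _ _ h0, if_neg (by omega), if_neg (by omega)]
    simp

theorem sp_le_ham0 {X : Ham} (hX : X ∈ sp) : X ∈ ham0 := by
  rw [mem_ham0]
  exact ⟨cf_eq_zero_of_mem hX (by norm_num), cf_eq_zero_of_mem hX (by norm_num)⟩

theorem dropConstant_bracket {X : Ham} (hX : X ∈ sp) (v : Ham) :
    dropConstant ⁅X, v⁆ = ⁅(⟨X, sp_le_ham0 hX⟩ : ham0), dropConstant v⁆ := by
  have h1 : v = dropConstant v + (v - dropConstant v) := by abel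
  have h2 : ⁅X, v - dropConstant v⁆ ∈ weightPart (-1) := by
    simpa using bracket_mem_weightPart hX (sub_dropConstant_mem v)
  conv_lhs => rw [h1, lie_add, map_add, dropConstant_eq_zero h2, add_zero]
  exact dropConstant_coe ⁅(⟨X, sp_le_ham0 hX⟩ : ham0), dropConstant v⁆

theorem continuous_dropConstant : Continuous dropConstant := by
  refine Continuous.subtype_mk (f := fun v => (dropConstant v : Ham)) (continuous_ham fun a b => ?_) _
  simp only [cf_dropConstant]
  split_ifs
  · exact continuous_const
  · exact continuous_cf a b

/-- The extension of a form on `ham0` to `Ham` by the projection onto `ham0`. -/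
def extend (k : ℕ) : (ham0 [⋀^Fin k]→ₗ[ℝ] ℝ) →ₗ[ℝ] (Ham [⋀^Fin k]→ₗ[ℝ] ℝ) where
  toFun f := f.compLinearMap dropConstant
  map_add' _ _ := rfl
  map_smul' _ _ := rfl

/-- The restriction of a form to `ham0`. -/
def restrict (k : ℕ) : (Ham [⋀^Fin k]→ₗ[ℝ] ℝ) →ₗ[ℝ] (ham0 [⋀^Fin k]→ₗ[ℝ] ℝ) where
  toFun f := f.compLinearMap ham0.toSubmodule.subtype
  map_add' _ _ := rfl
  map_smul' _ _ := rfl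

theorem extend_apply {k : ℕ} (f : ham0 [⋀^Fin k]→ₗ[ℝ] ℝ) (v : Fin k → Ham) :
    extend k f v = f fun i => dropConstant (v i) := rfl

theorem restrict_apply {k : ℕ} (f : Ham [⋀^Fin k]→ₗ[ℝ] ℝ) (v : Fin k → ham0) :
    restrict k f v = f fun i => (v i : Ham) := rfl

theorem restrict_extend {k : ℕ} (f : ham0 [⋀^Fin k]→ₗ[ℝ] ℝ) : restrict k (extend k f) = f := by
  ext v
  simp only [restrict_apply, extend_apply, dropConstant_coe]

theorem act_extend {k : ℕ} {X : Ham} (hX : X ∈ sp) (f : ham0 [⋀^Fin k]→ₗ[ℝ] ℝ) :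
    act X k (extend k f) = extend k (act ⟨X, sp_le_ham0 hX⟩ k f) := by
  ext v
  rw [act_apply, extend_apply, act_apply]
  refine Finset.sum_congr rfl fun i _ => ?_
  rw [extend_apply]
  congr 1
  ext1 j
  by_cases h : j = i
  · subst h
    simp [dropConstant_bracket hX]
  · simp [h]

variable {k : ℕ} {w : ℤ}

theorem extend_mem_cochains {f : ham0 [⋀^Fin k]→ₗ[ℝ] ℝ} (hf : f ∈ cochains sp0 weightPart0 k w) :
    extend k f ∈ cochains sp weightPart k w := by
  refine ⟨?_, ?_, fun X hX v => ?_, fun a v hv ha => ?_⟩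
  · exact hf.1.comp (continuous_pi fun i => continuous_dropConstant.comp (continuous_apply i))
  · rintro v ⟨i, hi⟩
    refine hf.2.1 _ ⟨i, ?_⟩
    have h := dropConstant_coe ⟨v i, sp_le_ham0 hi⟩
    change (dropConstant (v i) : Ham) ∈ sp
    rw [h]
    exact hi
  · rw [← act_apply, act_extend hX, cochains_act_eq_zero hf (X := ⟨X, sp_le_ham0 hX⟩) hX]
    simp
  · refine hf.2.2.2 a _ (fun i => ?_) ha
    intro m hm
    have h := cf_dropConstant (m 0) (m 1) (v i)
    rw [cf_apply, cf_apply, expo_eta, hv i m hm, ite_self] at h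
    exact h

theorem extend_mem {f : ham0 [⋀^Fin k]→ₗ[ℝ] ℝ} (hf : f ∈ cochains sp0 weightPart0 k w) :
    extend k f ∈ invariantForms {0} k w := by
  obtain ⟨⟨h1, h2⟩, h3⟩ := mem_invariantForms_of_mem_cochains (extend_mem_cochains hf)
  refine ⟨⟨h1, fun t ht => ?_⟩, h3⟩
  by_contra h0
  have h4 : IsHomogeneous {0, 1, 2} w 0 t := by
    by_contra h
    exact h0 (h2 t h)
  refine ht ⟨h4.1, ?_, h4.2.2⟩
  rw [Finset.mem_singleton, Finset.card_eq_zero, Finset.filter_eq_empty_iff]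
  intro i _ hi
  refine h0 (f.map_coord_zero i (dropConstant_eq_zero ?_))
  convert mono_mem_weightPart (t i).1 (t i).2 using 2
  omega

theorem restrict_mem {f : Ham [⋀^Fin k]→ₗ[ℝ] ℝ} (hf : f ∈ cochains sp weightPart k w) :
    restrict k f ∈ cochains sp0 weightPart0 k w := by
  refine ⟨?_, ?_, fun X hX v => ?_, fun a v hv ha => hf.2.2.2 a _ hv ha⟩
  · exact hf.1.comp (continuous_pi fun i => continuous_subtype_val.comp (continuous_apply i))
  · rintro v ⟨i, hi⟩
    exact hf.2.1 _ ⟨i, hi⟩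
  · rw [← hf.2.2.1 X hX fun i => (v i : Ham)]
    refine Finset.sum_congr rfl fun i _ => ?_
    rw [restrict_apply]
    congr 1
    ext1 j
    by_cases h : j = i
    · subst h
      simp
    · simp [h]

theorem extend_restrict {f : Ham [⋀^Fin k]→ₗ[ℝ] ℝ} (hf : f ∈ invariantForms {0} k w) :
    extend k (restrict k f) = f := by
  have h0 := (extend_mem_cochains (restrict_mem (mem_cochains_of_mem_invariantForms hf))).1
  rw [← sub_eq_zero]
  refine eq_zero_of_mono (f := extend k (restrict k f) - f) (h0.sub hf.1.1) fun t => ?_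
  rw [AlternatingMap.sub_apply, sub_eq_zero, extend_apply, restrict_apply]
  by_cases h : ∃ i, (t i).1 + (t i).2 = 1
  · obtain ⟨i, hi⟩ := h
    have h1 := hf.1.2 t fun h => by
      have h2 := h.2.1
      rw [Finset.mem_singleton, Finset.card_eq_zero, Finset.filter_eq_empty_iff] at h2
      exact h2 (Finset.mem_univ i) hi
    rw [onMono] at h1
    rw [h1]
    refine f.map_coord_zero i ?_
    rw [dropConstant_eq_zero]
    · rfl
    · convert mono_mem_weightPart (t i).1 (t i).2 using 2
      omega
  · push Not at h
    congr 1
    ext1 i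
    exact congrArg Subtype.val (dropConstant_coe ⟨_, mono_mem_ham0 (h i)⟩)

/-- Leaf cochains are the invariant forms without linear arguments. -/
def leafEquiv (k : ℕ) (w : ℤ) : cochains sp0 weightPart0 k w ≃ₗ[ℝ] invariantForms {0} k w where
  toFun f := ⟨extend k f, extend_mem f.2⟩
  invFun g := ⟨restrict k g, restrict_mem (mem_cochains_of_mem_invariantForms g.2)⟩
  map_add' _ _ := rfl
  map_smul' _ _ := rfl
  left_inv f := Subtype.ext (restrict_extend f.1)
  right_inv g := Subtype.ext (extend_restrict g.2)

theorem differential_restrict (f : Ham [⋀^Fin k]→ₗ[ℝ] ℝ) :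
    differential k (restrict k f) = restrict (k + 1) (differential k f) := by
  ext v
  cases k with
  | zero => rfl
  | succ k =>
    rw [restrict_apply, differential_apply, differential_apply]
    refine Finset.sum_congr rfl fun i _ => Finset.sum_congr rfl fun j _ => ?_
    rw [restrict_apply]
    congr 2
    ext1 m
    refine Fin.cases ?_ (fun m => ?_) m
    · simp
    · simp [Fin.removeNth]

theorem continuous_bracket_ham0 : Continuous fun p : ham0 × ham0 => ⁅p.1, p.2⁆ := by
  have h : Continuous fun p : ham0 × ham0 => ((p.1 : Ham), (p.2 : Ham)) :=
    (continuous_subtype_val.comp continuous_fst).prodMk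
      (continuous_subtype_val.comp continuous_snd)
  rw [continuous_induced_rng]
  have h2 := continuous_bracket.comp h
  exact h2

theorem bracket_mem_weightPart0 {i j : ℤ} {x y : ham0} (hx : x ∈ weightPart0 i)
    (hy : y ∈ weightPart0 j) : ⁅x, y⁆ ∈ weightPart0 (i + j) := by
  have h : ⁅(x : Ham), (y : Ham)⁆ ∈ weightPart (i + j) := bracket_mem_weightPart hx hy
  exact h

theorem differential_mem_leaf {f : ham0 [⋀^Fin k]→ₗ[ℝ] ℝ}
    (hf : f ∈ cochains sp0 weightPart0 k w) :
    differential k f ∈ cochains sp0 weightPart0 (k + 1) w :=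
  differential_mem_cochains continuous_bracket_ham0 bracket_mem_weightPart0 hf

theorem differential_mem_ham {f : Ham [⋀^Fin k]→ₗ[ℝ] ℝ} (hf : f ∈ cochains sp weightPart k w) :
    differential k f ∈ cochains sp weightPart (k + 1) w :=
  differential_mem_cochains continuous_bracket bracket_mem_weightPart hf

theorem onList_extend_restrict (f : Ham [⋀^Fin k]→ₗ[ℝ] ℝ) {l : List ℕ}
    (hl : ∀ p ∈ l, p ∈ higherCodes) (hk : l.length = k) :
    onList k (extend k (restrict k f)) l = onList k f l := by
  rw [onList_eq_onMono _ hk, onList_eq_onMono _ hk, onMono, extend_apply, restrict_apply]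
  congr 1
  ext1 i
  have h1 := mem_higherCodes.mp (hl (l.getD i 0) (by subst hk; simp))
  refine congrArg Subtype.val (dropConstant_coe ⟨_, mono_mem_ham0 ?_⟩)
  simp only [decode]
  omega

/-! ### Wedge products -/

section Wedge

variable {L : Type*} [LieRing L] [LieAlgebra ℝ L] {p q : ℕ}

/-- The product of `a` and `b` on the arguments permuted by `σ`. -/
def permProd (a : L [⋀^Fin p]→ₗ[ℝ] ℝ) (b : L [⋀^Fin q]→ₗ[ℝ] ℝ)
    (σ : Equiv.Perm (Fin p ⊕ Fin q)) (v : Fin (p + q) → L) : ℝ :=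
  a (fun i => v (finSumFinEquiv (σ (Sum.inl i)))) * b fun j => v (finSumFinEquiv (σ (Sum.inr j)))

theorem wedge_apply (a : L [⋀^Fin p]→ₗ[ℝ] ℝ) (b : L [⋀^Fin q]→ₗ[ℝ] ℝ) (v : Fin (p + q) → L) :
    ((p.factorial * q.factorial : ℕ) : ℝ) * wedge a b v =
      ∑ σ : Equiv.Perm (Fin p ⊕ Fin q), ((Equiv.Perm.sign σ : ℤ) : ℝ) * permProd a b σ v := by
  have h1 := MultilinearMap.domCoprod_alternization_eq a b
  have h2 := congrArg (fun f => LinearMap.mul' ℝ ℝ (f (v ∘ finSumFinEquiv))) h1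
  simp only [AlternatingMap.smul_apply, map_nsmul, Fintype.card_fin,
    MultilinearMap.alternatization_apply, map_sum] at h2
  rw [← nsmul_eq_mul]
  refine h2.symm.trans (Finset.sum_congr rfl fun σ _ => ?_)
  rw [Units.smul_def, map_zsmul, zsmul_eq_mul]
  rfl

theorem wedge_eq_sum (a : L [⋀^Fin p]→ₗ[ℝ] ℝ) (b : L [⋀^Fin q]→ₗ[ℝ] ℝ) (v : Fin (p + q) → L) :
    wedge a b v = ((p.factorial * q.factorial : ℕ) : ℝ)⁻¹ *
      ∑ σ : Equiv.Perm (Fin p ⊕ Fin q), ((Equiv.Perm.sign σ : ℤ) : ℝ) * permProd a b σ v := by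
  rw [← wedge_apply, inv_mul_cancel_left₀]
  exact_mod_cast (Nat.mul_pos p.factorial_pos q.factorial_pos).ne'

theorem wedge_eq_zero {a : L [⋀^Fin p]→ₗ[ℝ] ℝ} {b : L [⋀^Fin q]→ₗ[ℝ] ℝ} {v : Fin (p + q) → L}
    (h : ∀ σ, permProd a b σ v = 0) : wedge a b v = 0 := by
  rw [wedge_eq_sum, Finset.sum_eq_zero fun σ _ => by rw [h σ, mul_zero], mul_zero]

theorem permProd_act (X : L) (a : L [⋀^Fin p]→ₗ[ℝ] ℝ) (b : L [⋀^Fin q]→ₗ[ℝ] ℝ)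
    (σ : Equiv.Perm (Fin p ⊕ Fin q)) (v : Fin (p + q) → L) :
    ∑ i, permProd a b σ (Function.update v i ⁅X, v i⁆) =
      permProd (act X p a) b σ v + permProd a (act X q b) σ v := by
  rw [← Equiv.sum_comp (σ.trans finSumFinEquiv), Fintype.sum_sum_type]
  simp only [permProd, act_apply, Finset.sum_mul, Finset.mul_sum, Equiv.trans_apply]
  have key : ∀ s : Fin p ⊕ Fin q, ∀ r, Function.update v (finSumFinEquiv (σ s))
      ⁅X, v (finSumFinEquiv (σ s))⁆ (finSumFinEquiv (σ r)) =
      Function.update (fun r => v (finSumFinEquiv (σ r))) s ⁅X, v (finSumFinEquiv (σ s))⁆ r := by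
    intro s r
    by_cases h : r = s
    · subst h; simp
    · simp [h]
  simp only [key]
  congr 1
  · refine Finset.sum_congr rfl fun i _ => ?_
    congr 2
    ext j
    by_cases h : j = i
    · subst h; simp
    · simp [h]
  · refine Finset.sum_congr rfl fun i _ => ?_
    congr 2
    ext j
    by_cases h : j = i
    · subst h; simp
    · simp [h]

theorem act_wedge (X : L) (a : L [⋀^Fin p]→ₗ[ℝ] ℝ) (b : L [⋀^Fin q]→ₗ[ℝ] ℝ) :
    act X (p + q) (wedge a b) = wedge (act X p a) b + wedge a (act X q b) := by
  ext v
  rw [AlternatingMap.add_apply, act_apply, wedge_eq_sum, wedge_eq_sum, ← mul_add,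
    ← Finset.sum_add_distrib]
  simp only [wedge_eq_sum, ← Finset.mul_sum]
  rw [Finset.sum_comm]
  congr 1
  refine Finset.sum_congr rfl fun σ _ => ?_
  rw [← Finset.mul_sum, permProd_act, mul_add]

theorem wedge_zero_left (b : L [⋀^Fin q]→ₗ[ℝ] ℝ) : wedge (0 : L [⋀^Fin p]→ₗ[ℝ] ℝ) b = 0 := by
  ext v
  exact wedge_eq_zero fun σ => by simp [permProd]

theorem wedge_zero_right (a : L [⋀^Fin p]→ₗ[ℝ] ℝ) : wedge a (0 : L [⋀^Fin q]→ₗ[ℝ] ℝ) = 0 := by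
  ext v
  exact wedge_eq_zero fun σ => by simp [permProd]

theorem wedge_add_left (a a' : L [⋀^Fin p]→ₗ[ℝ] ℝ) (b : L [⋀^Fin q]→ₗ[ℝ] ℝ) :
    wedge (a + a') b = wedge a b + wedge a' b := by
  ext v
  simp only [AlternatingMap.add_apply, wedge_eq_sum, ← mul_add, ← Finset.sum_add_distrib]
  congr 1
  refine Finset.sum_congr rfl fun σ _ => ?_
  simp only [permProd, AlternatingMap.add_apply]
  ring

theorem wedge_smul_left (c : ℝ) (a : L [⋀^Fin p]→ₗ[ℝ] ℝ) (b : L [⋀^Fin q]→ₗ[ℝ] ℝ) :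
    wedge (c • a) b = c • wedge a b := by
  ext v
  rw [AlternatingMap.smul_apply, wedge_eq_sum, wedge_eq_sum, smul_eq_mul, mul_left_comm,
    Finset.mul_sum _ _ c]
  congr 1
  refine Finset.sum_congr rfl fun σ _ => ?_
  simp only [permProd, AlternatingMap.smul_apply, smul_eq_mul]
  ring

/-- If `b` vanishes as soon as one argument lies in `S`, and the first `p` arguments lie in `S`,
then only one shuffle contributes to the wedge product. -/
theorem wedge_apply_of_mem {a : L [⋀^Fin p]→ₗ[ℝ] ℝ} {b : L [⋀^Fin q]→ₗ[ℝ] ℝ} {S : Set L}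
    (hb : ∀ v : Fin q → L, (∃ j, v j ∈ S) → b v = 0) {v : Fin (p + q) → L}
    (hv : ∀ i : Fin p, v (Fin.castAdd q i) ∈ S) :
    wedge a b v = a (fun i => v (Fin.castAdd q i)) * b fun j => v (Fin.natAdd p j) := by
  classical
  have h0 : ((p.factorial * q.factorial : ℕ) : ℝ) ≠ 0 := by
    exact_mod_cast (Nat.mul_pos p.factorial_pos q.factorial_pos).ne'
  refine mul_left_cancel₀ h0 ?_
  rw [wedge_apply]
  have h1 : ∀ σ : Equiv.Perm (Fin p ⊕ Fin q), σ ∉ Finset.univ.image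
      (Equiv.Perm.sumCongrHom (Fin p) (Fin q)) → permProd a b σ v = 0 := by
    intro σ hσ
    have h2 : ¬ ∀ j, ∃ j', σ (Sum.inr j) = Sum.inr j' := by
      intro h
      apply hσ
      have h3 : Set.MapsTo σ (Set.range Sum.inr) (Set.range Sum.inr) := by
        rintro _ ⟨j, rfl⟩
        obtain ⟨j', h⟩ := h j
        exact ⟨j', h.symm⟩
      have h4 : Set.MapsTo σ (Set.range Sum.inl) (Set.range Sum.inl) := by
        rwa [Equiv.Perm.perm_mapsTo_inl_iff_mapsTo_inr]
      obtain ⟨τ, hτ⟩ := Equiv.Perm.mem_sumCongrHom_range_of_perm_mapsTo_inl h4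
      exact Finset.mem_image.mpr ⟨τ, Finset.mem_univ _, hτ⟩
    push Not at h2
    obtain ⟨j, hj⟩ := h2
    rw [permProd, hb, mul_zero]
    refine ⟨j, ?_⟩
    rcases h3 : σ (Sum.inr j) with i | i
    · simpa using hv i
    · exact absurd h3 (hj i)
  rw [← Finset.sum_subset (Finset.subset_univ _) fun σ _ hσ => by rw [h1 σ hσ, mul_zero],
    Finset.sum_image fun _ _ _ _ h => Equiv.Perm.sumCongrHom_injective h]
  have h2 : ∀ τ : Equiv.Perm (Fin p) × Equiv.Perm (Fin q),
      ((Equiv.Perm.sign (Equiv.Perm.sumCongrHom (Fin p) (Fin q) τ) : ℤ) : ℝ) *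
        permProd a b (Equiv.Perm.sumCongrHom (Fin p) (Fin q) τ) v =
      a (fun i => v (Fin.castAdd q i)) * b fun j => v (Fin.natAdd p j) := by
    intro τ
    have ha := a.map_perm (fun i => v (Fin.castAdd q i)) τ.1
    have hb := b.map_perm (fun i => v (Fin.natAdd p i)) τ.2
    have ha' : permProd a b (Equiv.Perm.sumCongrHom (Fin p) (Fin q) τ) v =
        a ((fun i => v (Fin.castAdd q i)) ∘ τ.1) * b ((fun i => v (Fin.natAdd p i)) ∘ τ.2) := by
      simp only [permProd, Equiv.Perm.sumCongrHom_apply, Equiv.Perm.sumCongr_apply, Sum.map_inl,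
        Sum.map_inr, finSumFinEquiv_apply_left, finSumFinEquiv_apply_right]
      rfl
    rw [ha', ha, hb]
    simp only [Equiv.Perm.sumCongrHom_apply, Equiv.Perm.sign_sumCongr, Units.smul_def, zsmul_eq_mul]
    push_cast
    have e : ∀ u : ℤˣ, ((u : ℤ) : ℝ) * ((u : ℤ) : ℝ) = 1 := by
      intro u
      rcases Int.units_eq_one_or u with rfl | rfl <;> simp
    linear_combination (a (fun i => v (Fin.castAdd q i)) * b fun j => v (Fin.natAdd p j)) *
      ((((Equiv.Perm.sign τ.2 : ℤˣ) : ℤ) : ℝ) * ((Equiv.Perm.sign τ.2 : ℤ) : ℝ) * e (Equiv.Perm.sign τ.1)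
       + e (Equiv.Perm.sign τ.2))
  rw [Finset.sum_congr rfl fun τ _ => h2 τ, Finset.sum_const, Finset.card_univ, Fintype.card_prod,
    Fintype.card_perm, Fintype.card_perm, Fintype.card_fin, Fintype.card_fin, nsmul_eq_mul]

variable [TopologicalSpace L]

theorem continuous_wedge {a : L [⋀^Fin p]→ₗ[ℝ] ℝ} {b : L [⋀^Fin q]→ₗ[ℝ] ℝ}
    (ha : Continuous fun v : Fin p → L => a v) (hb : Continuous fun v : Fin q → L => b v) :
    Continuous fun v : Fin (p + q) → L => wedge a b v := by
  simp only [wedge_eq_sum]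
  refine continuous_const.mul (continuous_finsetSum _ fun σ _ => continuous_const.mul ?_)
  exact (ha.comp (continuous_pi fun i => continuous_apply _)).mul
    (hb.comp (continuous_pi fun i => continuous_apply _))

theorem wedge_mem_cochains {K : LieSubalgebra ℝ L} {W : ℤ → Submodule ℝ L} {w w' : ℤ}
    {a : L [⋀^Fin p]→ₗ[ℝ] ℝ} {b : L [⋀^Fin q]→ₗ[ℝ] ℝ}
    (ha : a ∈ cochains K W p w) (hb : b ∈ cochains K W q w') :
    wedge a b ∈ cochains K W (p + q) (w + w') := by
  refine ⟨continuous_wedge ha.1 hb.1, ?_, fun X hX v => ?_, fun c v hv hc => ?_⟩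
  · rintro v ⟨i, hi⟩
    refine wedge_eq_zero fun σ => ?_
    obtain ⟨s, rfl⟩ := (σ.trans finSumFinEquiv).surjective i
    rcases s with s | s
    · rw [permProd, ha.2.1 _ ⟨s, hi⟩, zero_mul]
    · rw [permProd, hb.2.1 _ ⟨s, hi⟩, mul_zero]
  · rw [← act_apply, act_wedge, cochains_act_eq_zero ha hX, cochains_act_eq_zero hb hX,
      wedge_zero_left, wedge_zero_right]
    simp
  · refine wedge_eq_zero fun σ => ?_
    rw [permProd]
    by_cases h : ∑ i, c (finSumFinEquiv (σ (Sum.inl i))) = w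
    · rw [hb.2.2.2 (fun j => c (finSumFinEquiv (σ (Sum.inr j)))) _ (fun j => hv _), mul_zero]
      intro h'
      apply hc
      rw [← Equiv.sum_comp (σ.trans finSumFinEquiv), Fintype.sum_sum_type, ← h, ← h']
      rfl
    · rw [ha.2.2.2 _ _ (fun j => hv _) h, zero_mul]

end Wedge

/-! ### The product with the symplectic form -/

theorem wedge_one_one {L : Type*} [LieRing L] [LieAlgebra ℝ L] (a b : L [⋀^Fin 1]→ₗ[ℝ] ℝ)
    (v : Fin 2 → L) :
    wedge a b v = a (fun _ => v 0) * b (fun _ => v 1) - a (fun _ => v 1) * b fun _ => v 0 := by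
  have h := wedge_apply a b v
  have h2 : (Finset.univ : Finset (Equiv.Perm (Fin 1 ⊕ Fin 1))) =
    {1, Equiv.swap (Sum.inl 0) (Sum.inr 0)} := by decide
  have h3 : ∀ u : Fin 1 → L, u = fun _ => u 0 := fun u => by
    ext i
    rw [Subsingleton.elim i 0]
  have h4 : ∀ σ, permProd a b σ v = a (fun _ => v (finSumFinEquiv (σ (Sum.inl 0)))) *
      b fun _ => v (finSumFinEquiv (σ (Sum.inr 0))) := fun σ => by
    rw [permProd]
    congr 2 <;> exact h3 _
  simp only [h2, Finset.sum_pair (show (1 : Equiv.Perm (Fin 1 ⊕ Fin 1)) ≠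
      Equiv.swap (Sum.inl 0) (Sum.inr 0) by decide), h4, Nat.factorial_one, mul_one, Nat.cast_one,
    one_mul] at h
  rw [h]
  simp [sub_eq_add_neg]
  rfl

theorem delta_zero_apply (v : Fin 1 → Ham) : delta 0 v = -cf 0 1 (v 0) := by
  change MvPowerSeries.coeff (0 : Fin 2 →₀ ℕ) (-partialDeriv 1 (v 0 : Series)) = _
  rw [map_neg, partialDeriv, MvPowerSeries.coeff_pderiv, cf_apply]
  simp [expo]

theorem delta_one_apply (v : Fin 1 → Ham) : delta 1 v = cf 1 0 (v 0) := by
  change MvPowerSeries.coeff (0 : Fin 2 →₀ ℕ) (partialDeriv 0 (v 0 : Series)) = _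
  rw [partialDeriv, MvPowerSeries.coeff_pderiv, cf_apply]
  simp [expo]

theorem omega_apply (v : Fin 2 → Ham) :
    omega v = cf 0 1 (v 1) * cf 1 0 (v 0) - cf 0 1 (v 0) * cf 1 0 (v 1) := by
  rw [omega, wedge_one_one, delta_zero_apply, delta_zero_apply, delta_one_apply, delta_one_apply]
  ring

theorem omega_eq_zero {v : Fin 2 → Ham} {i : Fin 2} (h : v i ∈ ham0) : omega v = 0 := by
  obtain ⟨h1, h2⟩ := mem_ham0.mp h
  rw [omega_apply]
  fin_cases i <;> simp at h1 h2 <;> simp [h1, h2]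

theorem omega_mem_invariantForms : omega ∈ invariantForms {0, 1, 2} 2 (-2) := by
  have h : omega ∈ homForms {0, 1, 2} 2 (-2) 0 := by
    constructor
    · simp only [omega_apply]
      exact ((continuous_cf 0 1).comp (continuous_apply 1)).mul
        ((continuous_cf 1 0).comp (continuous_apply 0)) |>.sub
        (((continuous_cf 0 1).comp (continuous_apply 0)).mul
        ((continuous_cf 1 0).comp (continuous_apply 1)))
    · intro t ht
      contrapose! ht
      rw [onMono, omega_apply] at ht
      have h0 : ((0, 1) = t 1 ∧ (1, 0) = t 0) ∨ ((0, 1) = t 0 ∧ (1, 0) = t 1) := by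
        by_cases h1 : cf 0 1 (mono (t 1).1 (t 1).2) * cf 1 0 (mono (t 0).1 (t 0).2) = 0
        · rw [h1, zero_sub, neg_ne_zero] at ht
          have h2 := eq_of_cf_mono_ne_zero (left_ne_zero_of_mul ht)
          have h3 := eq_of_cf_mono_ne_zero (right_ne_zero_of_mul ht)
          exact Or.inr ⟨h2.symm, h3.symm⟩
        · have h2 := eq_of_cf_mono_ne_zero (left_ne_zero_of_mul h1)
          have h3 := eq_of_cf_mono_ne_zero (right_ne_zero_of_mul h1)
          exact Or.inl ⟨h2.symm, h3.symm⟩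
      rw [IsHomogeneous, Finset.card_filter]
      simp only [Fin.forall_fin_two, Fin.sum_univ_two]
      rcases h0 with ⟨h1, h2⟩ | ⟨h1, h2⟩ <;> rw [← h1, ← h2] <;> simp
  refine ⟨h, LinearMap.mem_ker.mpr ?_⟩
  refine homForms_ext (A := {0, 1, 2}) (w := -2) (h := 0 - 2) (by simp) (by norm_num)
    (lower_mem h) fun l hl => ?_
  rw [isHomList_ham (by norm_num)] at hl
  have h0 : hamLists 2 (-2) (0 - 2) = [] := by decide +kernel
  rw [h0] at hl
  simp at hl

theorem omega_mem_cochains : omega ∈ cochains sp weightPart 2 (-2) :=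
  mem_cochains_of_mem_invariantForms omega_mem_invariantForms

/-- The product with the symplectic form as a linear map. -/
def wedgeOmegaLM (k : ℕ) : (ham0 [⋀^Fin k]→ₗ[ℝ] ℝ) →ₗ[ℝ] (Ham [⋀^Fin (k + 2)]→ₗ[ℝ] ℝ) where
  toFun := wedgeOmega
  map_add' f g := wedge_add_left (extend k f) (extend k g) omega
  map_smul' c f := wedge_smul_left c (extend k f) omega

theorem wedgeOmegaLM_apply {k : ℕ} (f : ham0 [⋀^Fin k]→ₗ[ℝ] ℝ) :
    wedgeOmegaLM k f = wedgeOmega f := rfl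

variable {k : ℕ} {w : ℤ}

theorem wedgeOmega_mem_cochains {f : ham0 [⋀^Fin k]→ₗ[ℝ] ℝ}
    (hf : f ∈ cochains sp0 weightPart0 k w) :
    wedgeOmega f ∈ cochains sp weightPart (k + 2) (w - 2) :=
  wedge_mem_cochains (extend_mem_cochains hf) omega_mem_cochains

theorem wedgeOmega_eq_zero (f : ham0 [⋀^Fin k]→ₗ[ℝ] ℝ) {v : Fin (k + 2) → Ham}
    (hv : ∀ i j, i ≠ j → v i ∈ ham0 ∨ v j ∈ ham0) : wedgeOmega f v = 0 := by
  refine wedge_eq_zero fun σ => ?_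
  rw [permProd]
  rcases hv (finSumFinEquiv (σ (Sum.inr 0))) (finSumFinEquiv (σ (Sum.inr 1))) (by simp) with h | h
  · rw [omega_eq_zero (i := 0) h, mul_zero]
  · rw [omega_eq_zero (i := 1) h, mul_zero]

/-- The contraction of a form with the Hamiltonians `y` and `x`, restricted to `ham0`. -/
def contract (k : ℕ) (G : Ham [⋀^Fin (k + 2)]→ₗ[ℝ] ℝ) : ham0 [⋀^Fin k]→ₗ[ℝ] ℝ :=
  restrict k ((G.curryLeft (mono 0 1)).curryLeft (mono 1 0))

theorem contract_wedgeOmega (f : ham0 [⋀^Fin k]→ₗ[ℝ] ℝ) : contract k (wedgeOmega f) = -f := by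
  ext u
  let v : Fin (k + 2) → Ham := Matrix.vecCons (mono 0 1) (Matrix.vecCons (mono 1 0) fun i => u i)
  change wedgeOmega f v = -f u
  have hσ : Equiv.Perm.sign (finRotate (k + 2) * finRotate (k + 2)) = 1 := by
    rw [Equiv.Perm.sign_mul, Int.units_mul_self]
  have h1 := (wedgeOmega f).map_perm v (finRotate (k + 2) * finRotate (k + 2))
  rw [hσ, one_smul] at h1
  have h2 : ∀ i : Fin k, (v ∘ ⇑(finRotate (k + 2) * finRotate (k + 2))) (Fin.castAdd 2 i) = u i := by
    intro i
    have h : finRotate (k + 2) (finRotate (k + 2) (Fin.castAdd 2 i)) = i.succ.succ := by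
      rw [show Fin.castAdd 2 i = (⟨i, by omega⟩ : Fin (k + 2)) from rfl,
        finRotate_of_lt (Nat.lt_succ_of_lt i.2), finRotate_of_lt (Nat.succ_lt_succ i.2)]
      rfl
    simp only [Function.comp, Equiv.Perm.coe_mul, h]
    rfl
  have h3 : (v ∘ ⇑(finRotate (k + 2) * finRotate (k + 2))) (Fin.natAdd k 0) = mono 0 1 := by
    have h : finRotate (k + 2) (finRotate (k + 2) (Fin.natAdd k 0)) = 0 := by
      rw [show (Fin.natAdd k 0 : Fin (k + 2)) = ⟨k, by omega⟩ from rfl, finRotate_of_lt (Nat.lt_succ_self k),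
        finRotate_last']
      rfl
    simp only [Function.comp, Equiv.Perm.coe_mul, h]
    rfl
  have h4 : (v ∘ ⇑(finRotate (k + 2) * finRotate (k + 2))) (Fin.natAdd k 1) = mono 1 0 := by
    have h : finRotate (k + 2) (finRotate (k + 2) (Fin.natAdd k 1)) = 1 := by
      rw [show (Fin.natAdd k 1 : Fin (k + 2)) = ⟨k + 1, by omega⟩ from rfl, finRotate_last',
        finRotate_of_lt (Nat.succ_pos k)]
      rfl
    simp only [Function.comp, Equiv.Perm.coe_mul, h]
    rfl
  rw [← h1]
  refine (wedge_apply_of_mem (a := extend k f) (S := ham0) (fun v ⟨i, hi⟩ => omega_eq_zero hi)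
    fun i => ?_).trans ?_
  · rw [h2]
    exact (u i).2
  · rw [omega_apply, h3, h4, cf_mono _ _ _ _ (by simp), cf_mono _ _ _ _ (by simp),
      cf_mono _ _ _ _ (by simp), cf_mono _ _ _ _ (by simp), extend_apply]
    simp only [h2, dropConstant_coe]
    simp

theorem codeMono_32 : codeMono 32 = mono 0 1 := rfl

theorem codeMono_33 : codeMono 33 = mono 1 0 := rfl

theorem onList_contract (G : Ham [⋀^Fin (k + 2)]→ₗ[ℝ] ℝ) {l : List ℕ}
    (hl : ∀ p ∈ l, p ∈ higherCodes) (hk : l.length = k) :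
    onList (k + 2) G (32 :: 33 :: l) = onList k (extend k (contract k G)) l := by
  rw [contract, onList_extend_restrict _ hl hk]
  rfl

theorem onList_wedgeOmega (f : ham0 [⋀^Fin k]→ₗ[ℝ] ℝ) {l : List ℕ}
    (hl : ∀ p ∈ l, p ∈ higherCodes) (hk : l.length = k) :
    onList (k + 2) (wedgeOmega f) (32 :: 33 :: l) = -onList k (extend k f) l := by
  rw [onList_contract _ hl hk, contract_wedgeOmega, ← onListLM_apply, map_neg, map_neg,
    onListLM_apply]

theorem isHomList_two {k : ℕ} {w h : ℤ} (hw : w ≤ 10) {l : List ℕ} :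
    IsHomList {2} k w h l ↔ l ∈ twoLinearLists k w h := by
  refine ⟨fun hl => ?_, isHomList_of_mem_twoLinearLists (by simp)⟩
  have h1 : l ∈ hamLists k w h := (isHomList_ham hw).mp
    ⟨hl.1, hl.2.1, hl.2.2.1, by rw [Finset.mem_singleton.mp hl.2.2.2.1]; simp, hl.2.2.2.2⟩
  rw [hamLists, List.mem_append, List.mem_append] at h1
  rcases h1 with (h1 | h1) | h1
  · have h2 := (isHomList_of_mem_leafLists (A := {0}) (by simp) h1).2.2.2.1
    rw [Finset.mem_singleton.mp hl.2.2.2.1] at h2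
    simp at h2
  · have h2 := (isHomList_of_mem_oneLinearLists (A := {1}) (by simp) h1).2.2.2.1
    rw [Finset.mem_singleton.mp hl.2.2.2.1] at h2
    simp at h2
  · exact h1

theorem onList_eq_zero_of_restrict {F : Ham [⋀^Fin k]→ₗ[ℝ] ℝ} (hF : restrict k F = 0) {l : List ℕ}
    (hl : ∀ p ∈ l, p ∈ higherCodes) (hk : l.length = k) : onList k F l = 0 := by
  rw [← onList_extend_restrict F hl hk, hF, map_zero, ← onListLM_apply, map_zero]

/-- Linear Hamiltonians map Hamiltonians of degree at least three into `ham0`. -/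
theorem onList_act_linear {F : Ham [⋀^Fin k]→ₗ[ℝ] ℝ} (hF : restrict k F = 0) {c d : ℕ}
    (hcd : c + d = 1) {l : List ℕ} (hl : ∀ p ∈ l, p ∈ higherCodes) (hk : l.length = k) :
    onList k (act (mono c d) k F) l = 0 := by
  rw [onList_eq_onMono _ hk, onMono_act]
  refine Finset.sum_eq_zero fun i _ => ?_
  have h1 : ∀ j : Fin k, 3 ≤ (decode (l.getD j 0)).1 + (decode (l.getD j 0)).2 := by
    intro j
    have h2 := mem_higherCodes.mp (hl (l.getD j 0) (by subst hk; simp))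
    simp only [decode]
    omega
  have h3 : ∀ j, mono (Function.update (fun i : Fin k => decode (l.getD i 0)) i
      (c + (decode (l.getD i 0)).1 - 1, d + (decode (l.getD i 0)).2 - 1) j).1
      (Function.update (fun i : Fin k => decode (l.getD i 0)) i
      (c + (decode (l.getD i 0)).1 - 1, d + (decode (l.getD i 0)).2 - 1) j).2 ∈ ham0 := by
    intro j
    refine mono_mem_ham0 ?_
    by_cases h : j = i
    · subst h
      have := h1 j
      simp only [Function.update_self]
      omega
    · have := h1 j
      rw [Function.update_of_ne h]
      omega
  have h4 := congrArg (fun F => F fun j => ⟨_, h3 j⟩) hF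
  rw [restrict_apply] at h4
  rw [onMono, h4]
  simp

theorem restrict_wedgeOmega (f : ham0 [⋀^Fin k]→ₗ[ℝ] ℝ) : restrict (k + 2) (wedgeOmega f) = 0 := by
  ext v
  exact wedgeOmega_eq_zero f fun i _ _ => Or.inl (v i).2

theorem restrict_curryLeft_wedgeOmega (f : ham0 [⋀^Fin k]→ₗ[ℝ] ℝ) (X : Ham) :
    restrict (k + 1) ((wedgeOmega f).curryLeft X) = 0 := by
  ext v
  refine wedgeOmega_eq_zero f fun i j hij => ?_
  refine Fin.cases (fun h => ?_) (fun i _ => Or.inl (v i).2) i hij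
  exact Fin.cases (fun h => absurd rfl h) (fun j _ => Or.inr (v j).2) j h

theorem onList_differential_linear (f : ham0 [⋀^Fin k]→ₗ[ℝ] ℝ) {p : ℕ} (hp : p = 32 ∨ p = 33)
    {l : List ℕ} (hl : ∀ p ∈ l, p ∈ higherCodes) (hk : l.length = k + 2) :
    onList (k + 3) (differential (k + 2) (wedgeOmega f)) (p :: l) = 0 := by
  have h1 : ∃ c d, c + d = 1 ∧ codeMono p = mono c d := by
    rcases hp with rfl | rfl
    · exact ⟨0, 1, rfl, codeMono_32⟩
    · exact ⟨1, 0, rfl, codeMono_33⟩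
  obtain ⟨c, d, hcd, h1⟩ := h1
  rw [onList, h1, differential_curryLeft, ← onListLM_apply, map_sub, map_neg, onListLM_apply,
    onListLM_apply, onList_act_linear (restrict_wedgeOmega f) hcd hl hk,
    onList_eq_zero_of_restrict ?_ hl hk]
  · simp
  · rw [← differential_restrict, restrict_curryLeft_wedgeOmega, map_zero]

theorem differential_wedgeOmega (hw : w ≤ 10) {f : ham0 [⋀^Fin k]→ₗ[ℝ] ℝ}
    (hf : f ∈ cochains sp0 weightPart0 k w) :
    differential (k + 2) (wedgeOmega f) = wedgeOmega (differential k f) := by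
  have h1 := mem_invariantForms_of_mem_cochains (differential_mem_ham (wedgeOmega_mem_cochains hf))
  have h2 := mem_invariantForms_of_mem_cochains
    (wedgeOmega_mem_cochains (differential_mem_leaf hf))
  rw [← sub_eq_zero]
  refine homForms_ext (A := {0, 1, 2}) (w := w - 2) (h := 0) (by simp) (by linarith)
    (Submodule.sub_mem _ h1.1 h2.1) fun l hl => ?_
  rw [← onListLM_apply, map_sub, onListLM_apply, onListLM_apply, sub_eq_zero]
  rw [isHomList_ham (by linarith), hamLists, List.mem_append, List.mem_append] at hl
  rcases hl with (hl | hl) | hl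
  · obtain ⟨h3, -, h4, -⟩ := mem_leafLists.mp hl
    rw [onList_eq_zero_of_restrict (restrict_wedgeOmega (differential k f)) h4 h3,
      onList_eq_zero_of_restrict ?_ h4 h3]
    rw [← differential_restrict, restrict_wedgeOmega, map_zero]
  · have h5 : ∃ p m, (p = 32 ∨ p = 33) ∧ l = p :: m ∧ (∀ q ∈ m, q ∈ higherCodes) ∧
        m.length = k + 2 := by
      rw [oneLinearLists, List.mem_append, List.mem_map, List.mem_map] at hl
      rcases hl with ⟨m, hm, rfl⟩ | ⟨m, hm, rfl⟩
      · exact ⟨_, m, Or.inl rfl, rfl, (mem_leafLists.mp hm).2.2.1, (mem_leafLists.mp hm).1⟩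
      · exact ⟨_, m, Or.inr rfl, rfl, (mem_leafLists.mp hm).2.2.1, (mem_leafLists.mp hm).1⟩
    obtain ⟨p, m, hp, rfl, hm, hk⟩ := h5
    rw [onList_differential_linear f hp hm hk, onList,
      onList_eq_zero_of_restrict (restrict_curryLeft_wedgeOmega _ _) hm hk]
  · rw [twoLinearLists, List.mem_map] at hl
    obtain ⟨m, hm, rfl⟩ := hl
    obtain ⟨h3, -, h4, -⟩ := mem_leafLists.mp hm
    rw [onList_wedgeOmega _ h4 h3, onList, onList, codeMono_32, codeMono_33,
      differential_curryLeft]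
    have h6 : ((-act (mono 0 1) (k + 2) (wedgeOmega f) -
        differential (k + 1) ((wedgeOmega f).curryLeft (mono 0 1))).curryLeft (mono 1 0)) =
        -act (mono 0 1) (k + 1) ((wedgeOmega f).curryLeft (mono 1 0)) +
        act (mono 1 0) (k + 1) ((wedgeOmega f).curryLeft (mono 0 1)) +
        differential k (((wedgeOmega f).curryLeft (mono 0 1)).curryLeft (mono 1 0)) := by
      have h7 := act_curryLeft (mono 0 1) (mono 1 0) (wedgeOmega f)
      have h8 := differential_curryLeft (mono 1 0) ((wedgeOmega f).curryLeft (mono 0 1))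
      rw [bracket_mono, mono_zero, smul_zero, map_zero, add_zero] at h7
      have h9 : ∀ F G : Ham [⋀^Fin (k + 2)]→ₗ[ℝ] ℝ, (-F - G).curryLeft (mono 1 0) =
          -F.curryLeft (mono 1 0) - G.curryLeft (mono 1 0) := fun F G => by
        ext v
        simp
      rw [h9, h7, h8]
      abel
    rw [h6, ← onListLM_apply, map_add, map_add, map_neg, onListLM_apply, onListLM_apply,
      onListLM_apply, onList_act_linear (restrict_curryLeft_wedgeOmega f _) rfl h4 h3,
      onList_act_linear (restrict_curryLeft_wedgeOmega f _) rfl h4 h3,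
      ← onList_extend_restrict _ h4 h3, ← differential_restrict]
    have h10 := contract_wedgeOmega f
    rw [contract] at h10
    rw [h10, map_neg, map_neg, ← onListLM_apply, map_neg, onListLM_apply]
    ring

/-! ### Integral forms given by tables -/

/-- Boolean equality of lists of codes. -/
def beqList : List ℕ → List ℕ → Bool
  | [], [] => true
  | p :: l, q :: m => bif Nat.beq p q then beqList l m else false
  | _, _ => false

theorem beqList_iff : ∀ {l m : List ℕ}, beqList l m = true ↔ l = m
  | [], [] => by simp [beqList]
  | [], _ :: _ => by simp [beqList]
  | _ :: _, [] => by simp [beqList]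
  | p :: l, q :: m => by
    cases h : Nat.beq p q
    · simp [beqList, h, Nat.ne_of_beq_eq_false h]
    · simp [beqList, Nat.eq_of_beq_eq_true h, beqList_iff (l := l) (m := m)]

/-- A search tree of integers indexed by sorted lists of codes, ordered by a numerical key. -/
inductive Table : Type
  | nil : Table
  | node : Table → ℕ → List ℕ × ℤ → Table → Table

namespace Table

/-- The key of a list of codes. -/
def key (l : List ℕ) : ℕ := l.foldl (fun n p => 512 * n + p) 0

/-- A search tree of given depth with the first entries of a list, and the remaining entries. -/
def build : ℕ → List (List ℕ × ℤ) → Table × List (List ℕ × ℤ)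
  | 0, s => (nil, s)
  | n + 1, s =>
    match build n s with
    | (l, []) => (l, [])
    | (l, e :: s') =>
      match build n s' with
      | (r, s'') => (node l (key e.1) e r, s'')

/-- The search tree with the entries of a list, which should be sorted. -/
def ofList (s : List (List ℕ × ℤ)) : Table := (build 8 s).1

/-- The lists with an entry in a table. -/
def support : Table → List (List ℕ)
  | nil => []
  | node l _ e r => support l ++ e.1 :: support r

/-- The entry of a table at a list with a given key. -/
def find : Table → ℕ → List ℕ → ℤ
  | nil, _, _ => 0
  | node l k e r, n, m =>
    bif Nat.beq k n then bif beqList e.1 m then e.2 else 0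
    else bif Nat.blt n k then find l n m else find r n m

/-- The entry of a table at a list. -/
def entry (t : Table) (m : List ℕ) : ℤ := t.find (key m) m

theorem find_eq_zero {n : ℕ} {m : List ℕ} : ∀ {t : Table}, m ∉ t.support → t.find n m = 0
  | nil, _ => rfl
  | node l k e r, h => by
    simp only [support, List.mem_append, List.mem_cons, not_or] at h
    have h1 : beqList e.1 m = false := by
      rw [Bool.eq_false_iff, Ne, beqList_iff]
      exact fun h0 => h.2.1 h0.symm
    rw [find, h1, find_eq_zero h.1, find_eq_zero h.2.2]
    cases Nat.beq k n <;> cases Nat.blt n k <;> rfl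

theorem entry_eq_zero {t : Table} {m : List ℕ} (h : m ∉ t.support) : t.entry m = 0 :=
  find_eq_zero h

end Table

/-- The skew-symmetric extension of a table to all lists. -/
def Table.value (t : Table) (l : List ℕ) : ℤ :=
  match sortSign l with
  | none => 0
  | some (s, m) => bif s then -t.entry m else t.entry m

/-- The action of the Hamiltonian with code `p`, on integral functions of lists. -/
def intAct (p : ℕ) : (List ℕ → ℤ) → List ℕ → ℤ
  | _, [] => 0
  | φ, q :: l => bracketCoeff p q * φ ((p + q - 65) :: l) + intAct p (fun m => φ (q :: m)) l

/-- The differential, on integral functions of lists. -/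
def intDiff : (List ℕ → ℤ) → List ℕ → ℤ
  | _, [] => 0
  | φ, p :: l => -intAct p φ l - intDiff (fun m => φ (p :: m)) l

theorem bracketCoeff_eq_zero_or {p q : ℕ} (hp : IsCode p) (hq : IsCode q) :
    bracketCoeff p q = 0 ∨ (p + q - 65) % 32 ≤ (p + q - 65) / 32 := by
  by_cases h0 : bracketCoeff p q = 0
  · exact Or.inl h0
  obtain ⟨hp1, hp2, hp3⟩ := hp
  obtain ⟨hq1, hq2, hq3⟩ := hq
  have h1 : p % 32 + q % 32 ≠ 0 := by
    intro h
    have h1 : p % 32 = 0 := by omega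
    have h2 : q % 32 = 0 := by omega
    simp [bracketCoeff, h1, h2] at h0
  have h2 : p % 32 + q % 32 ≠ p / 32 + q / 32 := by
    intro h
    have h1 : p % 32 = p / 32 := by omega
    have h2 : q % 32 = q / 32 := by omega
    rw [bracketCoeff, h1, h2, mul_comm] at h0
    exact h0 (sub_self _)
  omega

theorem listAct_eq_intAct {p : ℕ} (hp : IsCode p) : ∀ {ψ : List ℕ → ℝ} {φ : List ℕ → ℤ},
    (∀ m : List ℕ, (∀ q ∈ m, q % 32 ≤ q / 32) → ψ m = φ m) → ∀ {l : List ℕ},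
    (∀ q ∈ l, IsCode q) → listAct p ψ l = intAct p φ l
  | _, _, _, [], _ => by simp [listAct, intAct]
  | ψ, φ, h, q :: l, hl => by
    have hq := hl q (by simp)
    have hl' : ∀ r ∈ l, IsCode r := fun r hr => hl r (by simp [hr])
    rw [listAct, intAct, listAct_eq_intAct hp (φ := fun m => φ (q :: m)) (fun m hm => ?_) hl']
    · rcases bracketCoeff_eq_zero_or hp hq with h0 | h0
      · simp [h0]
      · rw [h]
        · push_cast
          rfl
        · intro r hr
          rcases List.mem_cons.mp hr with rfl | hr
          · exact h0
          · exact (hl' r hr).1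
    · refine h _ fun r hr => ?_
      rcases List.mem_cons.mp hr with rfl | hr
      · exact hq.1
      · exact hm r hr

theorem listDiff_eq_intDiff : ∀ {ψ : List ℕ → ℝ} {φ : List ℕ → ℤ},
    (∀ m : List ℕ, (∀ q ∈ m, q % 32 ≤ q / 32) → ψ m = φ m) → ∀ {l : List ℕ},
    (∀ q ∈ l, IsCode q) → listDiff ψ l = intDiff φ l
  | _, _, _, [], _ => by simp [listDiff, intDiff]
  | ψ, φ, h, p :: l, hl => by
    have hl' : ∀ r ∈ l, IsCode r := fun r hr => hl r (by simp [hr])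
    rw [listDiff, intDiff, listAct_eq_intAct (hl p (by simp)) h hl',
      listDiff_eq_intDiff (φ := fun m => φ (p :: m)) (fun m hm => ?_) hl']
    · push_cast
      rfl
    · refine h _ fun r hr => ?_
      rcases List.mem_cons.mp hr with rfl | hr
      · exact (hl _ (by simp)).1
      · exact hm r hr

/-- The form with the values given by a table. -/
def Table.form (k : ℕ) (t : Table) : Ham [⋀^Fin k]→ₗ[ℝ] ℝ :=
  formOfValues k t.support.toFinset fun l => (t.entry l : ℝ)

variable {A : Finset ℕ} {k : ℕ} {w : ℤ}

theorem Table.form_mem {h : ℤ} {t : Table} (ht : ∀ e ∈ t.support, IsHomList A k w h e) :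
    t.form k ∈ homForms A k w h :=
  formOfValues_mem (fun l hl => by
    rw [List.mem_toFinset] at hl
    exact ht l hl) _

theorem Table.onList_form {h : ℤ} {t : Table} (ht : ∀ e ∈ t.support, IsHomList A k w h e) {l : List ℕ}
    (hl : ∀ p ∈ l, p % 32 ≤ p / 32) : onList k (t.form k) l = t.value l := by
  have hS : ∀ l ∈ t.support.toFinset, IsHomList A k w h l := fun l hl => by
    rw [List.mem_toFinset] at hl
    exact ht l hl
  have h0 : ∀ m : List ℕ, m.length ≠ k → t.entry m = 0 := fun m hm =>
    Table.entry_eq_zero fun h => hm (hS m (List.mem_toFinset.mpr h)).1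
  by_cases hk : l.length = k
  · rw [onList_sortSign _ _ hk, Table.value]
    rcases h1 : sortSign l with _ | ⟨s, m⟩
    · simp [signed]
    · obtain ⟨h2, h3⟩ := sortSign_spec h1
      have h4 : onList k (t.form k) m = t.entry m := by
        rw [Table.form, onList_formOfValues hS _ (h2.length_eq.trans hk) h3 fun p hp =>
          hl p (h2.subset hp)]
        split_ifs with h5
        · rfl
        · rw [Table.entry_eq_zero fun h => h5 (List.mem_toFinset.mpr h), Int.cast_zero]
      cases s <;> simp [signed, h4]
  · rw [onList_of_length_ne _ hk, Table.value]
    rcases h1 : sortSign l with _ | ⟨s, m⟩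
    · simp
    · have h2 : m.length ≠ k := (sortSign_spec h1).1.length_eq ▸ hk
      cases s <;> simp [h0 m h2]

theorem codeMono_66 : codeMono 66 = mono 2 0 := rfl

theorem Table.form_mem_invariantForms (hA : ∀ n ∈ A, n ≤ 2) (hw : w ≤ 10) {t : Table}
    (ht : ∀ e ∈ t.support, IsHomList A k w 0 e)
    (h : ∀ l, IsHomList A k w (-2) l → intAct 66 t.value l = 0) :
    t.form k ∈ invariantForms A k w := by
  refine ⟨Table.form_mem ht, LinearMap.mem_ker.mpr ?_⟩
  refine homForms_ext hA hw (lower_mem (Table.form_mem ht)) fun l hl => ?_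
  rw [lower, ← codeMono_66, onList_act _ (by simp [IsCode]) hl.isCode hl.1,
    listAct_eq_intAct (by simp [IsCode]) (fun m hm => Table.onList_form ht hm) hl.isCode,
    h l (by simpa using hl), Int.cast_zero]

instance (A : Finset ℕ) (k : ℕ) (w h : ℤ) (l : List ℕ) : Decidable (IsHomList A k w h l) := by
  unfold IsHomList IsCode
  infer_instance

/-- Whether a list of tables defines invariant forms, and whether the matrix of the values of
their differentials on the accompanying lists is triangular. The list `s` contains the lists on
which the lowering operator has to be tested. -/
def certified (A : Finset ℕ) (k : ℕ) (w : ℤ) (s : List (List ℕ)) : List (Table × List ℕ) → Bool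
  | [] => true
  | c :: cs => (c.1.support.all fun e => decide (IsHomList A k w 0 e)) &&
      (s.all fun l => intAct 66 c.1.value l == 0) &&
      decide (IsHomList A (k + 1) w 0 c.2) && !(intDiff c.1.value c.2 == 0) &&
      (cs.all fun d => intDiff d.1.value c.2 == 0) && certified A k w s cs

/-- A certificate gives a lower bound for the dimension of any space `B` that contains images of
the differentials of invariant forms, relative to a subspace `N` of `B` on which the functionals of
the certificate vanish. -/
theorem length_add_finrank_le (hA : ∀ n ∈ A, n ≤ 2) (hw : w ≤ 10) {s : List (List ℕ)}
    (hs : ∀ l, IsHomList A k w (-2) l → l ∈ s) {M : Type*} [AddCommGroup M] [Module ℝ M]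
    (D : (Ham [⋀^Fin k]→ₗ[ℝ] ℝ) →ₗ[ℝ] M) (ev : List ℕ → M →ₗ[ℝ] ℝ)
    (hev : ∀ f l, IsHomList A (k + 1) w 0 l →
      ev l (D f) = onList (k + 1) (differential k f) l) {N : Submodule ℝ M}
    (hN : ∀ n ∈ N, ∀ l, IsHomList A (k + 1) w 0 l → ev l n = 0) :
    ∀ {cs : List (Table × List ℕ)}, certified A k w s cs = true →
      ∀ {B : Submodule ℝ M} [FiniteDimensional ℝ B], N ≤ B →
      (∀ c ∈ cs, (c.1.form k) ∈ invariantForms A k w → D (c.1.form k) ∈ B) →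
      cs.length + Module.finrank ℝ N ≤ Module.finrank ℝ B
  | [], _, B, _, hNB, _ => by simpa using Submodule.finrank_mono hNB
  | c :: cs, hc, B, _, hNB, hB => by
    simp only [certified, Bool.and_eq_true, List.all_eq_true, decide_eq_true_eq, beq_iff_eq,
      Bool.not_eq_true', beq_eq_false_iff_ne] at hc
    obtain ⟨⟨⟨⟨⟨h1, h2⟩, h3⟩, h4⟩, h5⟩, h6⟩ := hc
    have key : ∀ {t : Table}, (∀ e ∈ t.support, IsHomList A k w 0 e) →
        ev c.2 (D (t.form k)) = intDiff t.value c.2 := fun {t} ht => by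
      rw [hev _ _ h3, onList_differential _ h3.isCode h3.1,
        listDiff_eq_intDiff (fun m hm => Table.onList_form ht hm) h3.isCode]
    have tables : ∀ {cs : List (Table × List ℕ)}, certified A k w s cs = true →
        ∀ c ∈ cs, ∀ e ∈ c.1.support, IsHomList A k w 0 e := by
      intro cs
      induction cs with
      | nil => simp
      | cons c cs ih =>
        intro hc d hd
        simp only [certified, Bool.and_eq_true, List.all_eq_true, decide_eq_true_eq] at hc
        rcases List.mem_cons.mp hd with rfl | hd
        · exact hc.1.1.1.1.1
        · exact ih hc.2 d hd
    have hlt : B ⊓ LinearMap.ker (ev c.2) < B := by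
      refine lt_of_le_of_ne inf_le_left fun h => h4 ?_
      have h7 : D (c.1.form k) ∈ B := hB c (by simp)
        (Table.form_mem_invariantForms hA hw h1 fun l hl => h2 l (hs l hl))
      rw [← h] at h7
      have h8 := key h1
      rw [LinearMap.mem_ker.mp h7.2] at h8
      exact_mod_cast h8.symm
    have h7 := length_add_finrank_le hA hw hs D ev hev hN h6
      (B := B ⊓ LinearMap.ker (ev c.2)) (le_inf hNB fun n hn => hN n hn _ h3) fun d hd hf =>
        ⟨hB d (by simp [hd]) hf, LinearMap.mem_ker.mpr (by
          rw [key (tables h6 d hd), h5 d hd, Int.cast_zero])⟩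
    have h8 := Submodule.finrank_lt_finrank_of_lt hlt
    rw [List.length_cons]
    omega

/-! ### Tables of invariant forms -/

/-- Invariant leaf forms of degree 2 and weight 6 with independent differentials. -/
def leafTwoSix : List (Table × List ℕ) := [
  (.ofList [([160, 165], 10), ([161, 164], -2), ([162, 163], 1)], [96, 129, 165])]

theorem certified_leafTwoSix :
    certified {0} 2 6 (leafLists 2 6 (-2)) leafTwoSix = true := by
  decide +kernel

/-- Invariant leaf forms of degree 3 and weight 4 with independent differentials. -/
def leafThreeFour : List (Table × List ℕ) := [
  (.ofList [([96, 97, 132], 6), ([96, 98, 131], -3), ([96, 99, 130], 3), ([97, 98, 130], 1),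
    ([97, 99, 129], -3), ([98, 99, 128], 6)], [96, 97, 98, 99])]

theorem certified_leafThreeFour :
    certified {0} 3 4 (leafLists 3 4 (-2)) leafThreeFour = true := by
  decide +kernel

/-- Invariant leaf forms of degree 3 and weight 8 with independent differentials. -/
def leafThreeEight : List (Table × List ℕ) := [
  (.ofList [([128, 162, 165], 15), ([128, 163, 164], -9), ([129, 161, 165], -15),
    ([129, 162, 164], 3), ([130, 160, 165], 25), ([130, 161, 164], 1), ([130, 162, 163], -2),
    ([131, 160, 164], -15), ([131, 161, 163], 3), ([132, 160, 163], 15), ([132, 161, 162], -9)],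
    [96, 97, 162, 165]),
  (.ofList [([96, 161, 198], 135), ([96, 162, 197], -45), ([96, 163, 196], 27),
    ([96, 164, 195], -27), ([96, 165, 194], 45), ([97, 160, 198], -225), ([97, 161, 197], 15),
    ([97, 162, 196], 3), ([97, 163, 195], -9), ([97, 164, 194], 21), ([97, 165, 193], -75),
    ([98, 160, 197], 75), ([98, 161, 196], -21), ([98, 162, 195], 9), ([98, 163, 194], -3),
    ([98, 164, 193], -15), ([98, 165, 192], 225), ([99, 160, 196], -45), ([99, 161, 195], 27),
    ([99, 162, 194], -27), ([99, 163, 193], 45), ([99, 164, 192], -135), ([128, 162, 165], -330),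
    ([128, 163, 164], 198), ([129, 161, 165], 330), ([129, 162, 164], -66),
    ([130, 160, 165], -550), ([130, 161, 164], -22), ([130, 162, 163], 44),
    ([131, 160, 164], 330), ([131, 161, 163], -66), ([132, 160, 163], -330),
    ([132, 161, 162], 198)], [96, 99, 160, 165]),
  (.ofList [([128, 129, 198], 30), ([128, 130, 197], -10), ([128, 131, 196], 6),
    ([128, 132, 195], -6), ([129, 130, 196], 2), ([129, 131, 195], -3), ([129, 132, 194], 6),
    ([130, 131, 194], 2), ([130, 132, 193], -10), ([131, 132, 192], 30)], [96, 97, 129, 198]),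
  (.ofList [([96, 128, 231], 105), ([96, 129, 230], -15), ([96, 130, 229], 5),
    ([96, 131, 228], -3), ([96, 132, 227], 3), ([97, 128, 230], -15), ([97, 129, 229], 5),
    ([97, 130, 228], -3), ([97, 131, 227], 3), ([97, 132, 226], -5), ([98, 128, 229], 5),
    ([98, 129, 228], -3), ([98, 130, 227], 3), ([98, 131, 226], -5), ([98, 132, 225], 15),
    ([99, 128, 228], -3), ([99, 129, 227], 3), ([99, 130, 226], -5), ([99, 131, 225], 15),
    ([99, 132, 224], -105), ([128, 129, 198], -90), ([128, 130, 197], 30), ([128, 131, 196], -18),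
    ([128, 132, 195], 18), ([129, 130, 196], -6), ([129, 131, 195], 9), ([129, 132, 194], -18),
    ([130, 131, 194], -6), ([130, 132, 193], 30), ([131, 132, 192], -90)], [96, 128, 131, 165])]

theorem certified_leafThreeEight :
    certified {0} 3 8 (leafLists 3 8 (-2)) leafThreeEight = true := by
  decide +kernel

/-- Invariant leaf forms of degree 4 and weight 8 with independent differentials. -/
def leafFourEight : List (Table × List ℕ) := [
  (.ofList [([96, 99, 160, 165], 30), ([96, 99, 161, 164], -6), ([96, 99, 162, 163], 3),
    ([97, 98, 160, 165], -10), ([97, 98, 161, 164], 2), ([97, 98, 162, 163], -1)],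
    [96, 97, 98, 129, 165])]

theorem certified_leafFourEight :
    certified {0} 4 8 (leafLists 4 8 (-2)) leafFourEight = true := by
  decide +kernel

/-- Invariant leaf forms of degree 2 and weight 10 with independent differentials. -/
def leafTwoTen : List (Table × List ℕ) := [
  (.ofList [([224, 231], 105), ([225, 230], -15), ([226, 229], 5), ([227, 228], -3)],
    [96, 193, 231])]

theorem certified_leafTwoTen :
    certified {0} 2 10 (leafLists 2 10 (-2)) leafTwoTen = true := by
  decide +kernel

/-- Invariant leaf forms of degree 3 and weight 10 with independent differentials. -/
def leafThreeTen : List (Table × List ℕ) := [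
  (.ofList [([96, 160, 264], 280), ([96, 161, 263], -35), ([96, 162, 262], 10),
    ([96, 163, 261], -5), ([96, 164, 260], 4), ([96, 165, 259], -5), ([97, 160, 263], -35),
    ([97, 161, 262], 10), ([97, 162, 261], -5), ([97, 163, 260], 4), ([97, 164, 259], -5),
    ([97, 165, 258], 10), ([98, 160, 262], 10), ([98, 161, 261], -5), ([98, 162, 260], 4),
    ([98, 163, 259], -5), ([98, 164, 258], 10), ([98, 165, 257], -35), ([99, 160, 261], -5),
    ([99, 161, 260], 4), ([99, 162, 259], -5), ([99, 163, 258], 10), ([99, 164, 257], -35),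
    ([99, 165, 256], 280)], [96, 97, 128, 264]),
  (.ofList [([96, 193, 231], 35), ([96, 194, 230], -10), ([96, 195, 229], 5),
    ([96, 196, 228], -4), ([96, 197, 227], 5), ([96, 198, 226], -10), ([97, 192, 231], -70),
    ([97, 193, 230], 5), ([97, 195, 228], -1), ([97, 196, 227], 2), ([97, 197, 226], -5),
    ([97, 198, 225], 20), ([98, 192, 230], 20), ([98, 193, 229], -5), ([98, 194, 228], 2),
    ([98, 195, 227], -1), ([98, 197, 225], 5), ([98, 198, 224], -70), ([99, 192, 229], -10),
    ([99, 193, 228], 5), ([99, 194, 227], -4), ([99, 195, 226], 5), ([99, 196, 225], -10),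
    ([99, 197, 224], 35)], [96, 97, 161, 231])]

theorem certified_leafThreeTen :
    certified {0} 3 10 (leafLists 3 10 (-2)) leafThreeTen = true := by
  decide +kernel

/-- Invariant leaf forms of degree 4 and weight 10 with independent differentials. -/
def leafFourTen : List (Table × List ℕ) := [
  (.ofList [([128, 129, 130, 198], 20), ([128, 129, 131, 197], -10), ([128, 129, 132, 196], 8),
    ([128, 130, 131, 196], 4), ([128, 130, 132, 195], -8), ([128, 131, 132, 194], 8),
    ([129, 130, 131, 195], -1), ([129, 130, 132, 194], 4), ([129, 131, 132, 193], -10),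
    ([130, 131, 132, 192], 20)], [128, 129, 130, 131, 132]),
  (.ofList [([96, 97, 161, 231], 70), ([96, 97, 162, 230], -20), ([96, 97, 163, 229], 10),
    ([96, 97, 164, 228], -8), ([96, 97, 165, 227], 10), ([96, 98, 160, 231], -175),
    ([96, 98, 161, 230], 5), ([96, 98, 162, 229], 5), ([96, 98, 163, 228], -7),
    ([96, 98, 164, 227], 11), ([96, 98, 165, 226], -25), ([96, 99, 160, 230], 75),
    ([96, 99, 161, 229], -15), ([96, 99, 162, 228], 3), ([96, 99, 163, 227], 3),
    ([96, 99, 164, 226], -15), ([96, 99, 165, 225], 75), ([97, 98, 160, 230], 25),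
    ([97, 98, 161, 229], -5), ([97, 98, 162, 228], 1), ([97, 98, 163, 227], 1),
    ([97, 98, 164, 226], -5), ([97, 98, 165, 225], 25), ([97, 99, 160, 229], -25),
    ([97, 99, 161, 228], 11), ([97, 99, 162, 227], -7), ([97, 99, 163, 226], 5),
    ([97, 99, 164, 225], 5), ([97, 99, 165, 224], -175), ([98, 99, 160, 228], 10),
    ([98, 99, 161, 227], -8), ([98, 99, 162, 226], 10), ([98, 99, 163, 225], -20),
    ([98, 99, 164, 224], 70)], [96, 97, 98, 161, 198]),
  (.ofList [([96, 128, 130, 231], 35), ([96, 128, 131, 230], -15), ([96, 128, 132, 229], 10),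
    ([96, 129, 130, 230], -5), ([96, 129, 131, 229], 5), ([96, 129, 132, 228], -6),
    ([96, 130, 131, 228], -2), ([96, 130, 132, 227], 5), ([96, 131, 132, 226], -5),
    ([97, 128, 129, 231], -35), ([97, 128, 130, 230], 5), ([97, 128, 132, 228], -2),
    ([97, 129, 131, 228], -1), ([97, 129, 132, 227], 3), ([97, 130, 131, 227], 1),
    ([97, 130, 132, 226], -5), ([97, 131, 132, 225], 10), ([98, 128, 129, 230], 10),
    ([98, 128, 130, 229], -5), ([98, 128, 131, 228], 3), ([98, 128, 132, 227], -2),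
    ([98, 129, 130, 228], 1), ([98, 129, 131, 227], -1), ([98, 130, 132, 225], 5),
    ([98, 131, 132, 224], -35), ([99, 128, 129, 229], -5), ([99, 128, 130, 228], 5),
    ([99, 128, 131, 227], -6), ([99, 128, 132, 226], 10), ([99, 129, 130, 227], -2),
    ([99, 129, 131, 226], 5), ([99, 129, 132, 225], -15), ([99, 130, 131, 225], -5),
    ([99, 130, 132, 224], 35)], [96, 99, 128, 130, 197]),
  (.ofList [([96, 128, 130, 231], -140), ([96, 128, 131, 230], 60), ([96, 128, 132, 229], -40),
    ([96, 129, 130, 230], 20), ([96, 129, 131, 229], -20), ([96, 129, 132, 228], 24),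
    ([96, 130, 131, 228], 8), ([96, 130, 132, 227], -20), ([96, 131, 132, 226], 20),
    ([96, 131, 160, 198], 180), ([96, 131, 161, 197], -30), ([96, 131, 162, 196], 12),
    ([96, 131, 163, 195], -9), ([96, 131, 164, 194], 12), ([96, 131, 165, 193], -30),
    ([96, 132, 160, 197], -120), ([96, 132, 161, 196], 48), ([96, 132, 162, 195], -36),
    ([96, 132, 163, 194], 48), ([96, 132, 164, 193], -120), ([96, 132, 165, 192], 720),
    ([97, 128, 129, 231], 140), ([97, 128, 130, 230], -20), ([97, 128, 132, 228], 8),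
    ([97, 129, 131, 228], 4), ([97, 129, 132, 227], -12), ([97, 130, 131, 227], -4),
    ([97, 130, 132, 226], 20), ([97, 130, 160, 198], -120), ([97, 130, 161, 197], 20),
    ([97, 130, 162, 196], -8), ([97, 130, 163, 195], 6), ([97, 130, 164, 194], -8),
    ([97, 130, 165, 193], 20), ([97, 131, 132, 225], -40), ([97, 131, 160, 197], 30),
    ([97, 131, 161, 196], -12), ([97, 131, 162, 195], 9), ([97, 131, 163, 194], -12),
    ([97, 131, 164, 193], 30), ([97, 131, 165, 192], -180), ([98, 128, 129, 230], -40),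
    ([98, 128, 130, 229], 20), ([98, 128, 131, 228], -12), ([98, 128, 132, 227], 8),
    ([98, 129, 130, 228], -4), ([98, 129, 131, 227], 4), ([98, 129, 160, 198], 180),
    ([98, 129, 161, 197], -30), ([98, 129, 162, 196], 12), ([98, 129, 163, 195], -9),
    ([98, 129, 164, 194], 12), ([98, 129, 165, 193], -30), ([98, 130, 132, 225], -20),
    ([98, 130, 160, 197], -20), ([98, 130, 161, 196], 8), ([98, 130, 162, 195], -6),
    ([98, 130, 163, 194], 8), ([98, 130, 164, 193], -20), ([98, 130, 165, 192], 120),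
    ([98, 131, 132, 224], 140), ([99, 128, 129, 229], 20), ([99, 128, 130, 228], -20),
    ([99, 128, 131, 227], 24), ([99, 128, 132, 226], -40), ([99, 128, 160, 198], -720),
    ([99, 128, 161, 197], 120), ([99, 128, 162, 196], -48), ([99, 128, 163, 195], 36),
    ([99, 128, 164, 194], -48), ([99, 128, 165, 193], 120), ([99, 129, 130, 227], 8),
    ([99, 129, 131, 226], -20), ([99, 129, 132, 225], 60), ([99, 129, 160, 197], 30),
    ([99, 129, 161, 196], -12), ([99, 129, 162, 195], 9), ([99, 129, 163, 194], -12),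
    ([99, 129, 164, 193], 30), ([99, 129, 165, 192], -180), ([99, 130, 131, 225], 20),
    ([99, 130, 132, 224], -140)], [96, 129, 131, 132, 162]),
  (.ofList [([96, 97, 128, 264], 280), ([96, 97, 129, 263], -35), ([96, 97, 130, 262], 10),
    ([96, 97, 131, 261], -5), ([96, 97, 132, 260], 4), ([96, 98, 128, 263], -70),
    ([96, 98, 129, 262], 20), ([96, 98, 130, 261], -10), ([96, 98, 131, 260], 8),
    ([96, 98, 132, 259], -10), ([96, 99, 128, 262], 30), ([96, 99, 129, 261], -15),
    ([96, 99, 130, 260], 12), ([96, 99, 131, 259], -15), ([96, 99, 132, 258], 30),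
    ([97, 98, 128, 262], 10), ([97, 98, 129, 261], -5), ([97, 98, 130, 260], 4),
    ([97, 98, 131, 259], -5), ([97, 98, 132, 258], 10), ([97, 99, 128, 261], -10),
    ([97, 99, 129, 260], 8), ([97, 99, 130, 259], -10), ([97, 99, 131, 258], 20),
    ([97, 99, 132, 257], -70), ([98, 99, 128, 260], 4), ([98, 99, 129, 259], -5),
    ([98, 99, 130, 258], 10), ([98, 99, 131, 257], -35), ([98, 99, 132, 256], 280)],
    [96, 97, 129, 130, 198]),
  (.ofList [([96, 97, 161, 231], 280), ([96, 97, 162, 230], -80), ([96, 97, 163, 229], 40),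
    ([96, 97, 164, 228], -32), ([96, 97, 165, 227], 40), ([96, 98, 160, 231], -700),
    ([96, 98, 161, 230], 20), ([96, 98, 162, 229], 20), ([96, 98, 163, 228], -28),
    ([96, 98, 164, 227], 44), ([96, 98, 165, 226], -100), ([96, 99, 160, 230], 300),
    ([96, 99, 161, 229], -60), ([96, 99, 162, 228], 12), ([96, 99, 163, 227], 12),
    ([96, 99, 164, 226], -60), ([96, 99, 165, 225], 300), ([96, 128, 163, 198], 180),
    ([96, 128, 164, 197], -120), ([96, 128, 165, 196], 120), ([96, 129, 163, 197], -30),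
    ([96, 129, 164, 196], 48), ([96, 129, 165, 195], -90), ([96, 130, 163, 196], 12),
    ([96, 130, 164, 195], -36), ([96, 130, 165, 194], 120), ([96, 131, 163, 195], -9),
    ([96, 131, 164, 194], 48), ([96, 131, 165, 193], -300), ([96, 132, 163, 194], 12),
    ([96, 132, 164, 193], -120), ([96, 132, 165, 192], 1800), ([97, 98, 160, 230], 100),
    ([97, 98, 161, 229], -20), ([97, 98, 162, 228], 4), ([97, 98, 163, 227], 4),
    ([97, 98, 164, 226], -20), ([97, 98, 165, 225], 100), ([97, 99, 160, 229], -100),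
    ([97, 99, 161, 228], 44), ([97, 99, 162, 227], -28), ([97, 99, 163, 226], 20),
    ([97, 99, 164, 225], 20), ([97, 99, 165, 224], -700), ([97, 128, 162, 198], -180),
    ([97, 128, 163, 197], 60), ([97, 128, 164, 196], -24), ([97, 129, 162, 197], 30),
    ([97, 129, 163, 196], -24), ([97, 129, 164, 195], 18), ([97, 130, 162, 196], -12),
    ([97, 130, 163, 195], 18), ([97, 130, 164, 194], -24), ([97, 131, 162, 195], 9),
    ([97, 131, 163, 194], -24), ([97, 131, 164, 193], 60), ([97, 132, 162, 194], -12),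
    ([97, 132, 163, 193], 60), ([97, 132, 164, 192], -360), ([98, 99, 160, 228], 40),
    ([98, 99, 161, 227], -32), ([98, 99, 162, 226], 40), ([98, 99, 163, 225], -80),
    ([98, 99, 164, 224], 280), ([98, 128, 161, 198], 360), ([98, 128, 162, 197], -60),
    ([98, 128, 163, 196], 12), ([98, 129, 161, 197], -60), ([98, 129, 162, 196], 24),
    ([98, 129, 163, 195], -9), ([98, 130, 161, 196], 24), ([98, 130, 162, 195], -18),
    ([98, 130, 163, 194], 12), ([98, 131, 161, 195], -18), ([98, 131, 162, 194], 24),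
    ([98, 131, 163, 193], -30), ([98, 132, 161, 194], 24), ([98, 132, 162, 193], -60),
    ([98, 132, 163, 192], 180), ([99, 128, 160, 198], -1800), ([99, 128, 161, 197], 120),
    ([99, 128, 162, 196], -12), ([99, 129, 160, 197], 300), ([99, 129, 161, 196], -48),
    ([99, 129, 162, 195], 9), ([99, 130, 160, 196], -120), ([99, 130, 161, 195], 36),
    ([99, 130, 162, 194], -12), ([99, 131, 160, 195], 90), ([99, 131, 161, 194], -48),
    ([99, 131, 162, 193], 30), ([99, 132, 160, 194], -120), ([99, 132, 161, 193], 120),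
    ([99, 132, 162, 192], -180)], [96, 97, 98, 128, 231]),
  (.ofList [([96, 160, 164, 165], 20), ([96, 161, 163, 165], -5), ([96, 162, 163, 164], 2),
    ([97, 160, 163, 165], -5), ([97, 161, 162, 165], 5), ([97, 161, 163, 164], -1),
    ([98, 160, 162, 165], -5), ([98, 160, 163, 164], 5), ([98, 161, 162, 164], -1),
    ([99, 160, 161, 165], 20), ([99, 160, 162, 164], -5), ([99, 161, 162, 163], 2)],
    [96, 97, 128, 164, 165])]

theorem certified_leafFourTen :
    certified {0} 4 10 (leafLists 4 10 (-2)) leafFourTen = true := by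
  decide +kernel

/-- Invariant leaf forms of degree 5 and weight 10 with independent differentials. -/
def leafFiveTen : List (Table × List ℕ) := [
  (.ofList [([96, 97, 132, 160, 165], 60), ([96, 97, 132, 161, 164], -12),
    ([96, 97, 132, 162, 163], 6), ([96, 98, 131, 160, 165], -30), ([96, 98, 131, 161, 164], 6),
    ([96, 98, 131, 162, 163], -3), ([96, 99, 130, 160, 165], 30), ([96, 99, 130, 161, 164], -6),
    ([96, 99, 130, 162, 163], 3), ([97, 98, 130, 160, 165], 10), ([97, 98, 130, 161, 164], -2),
    ([97, 98, 130, 162, 163], 1), ([97, 99, 129, 160, 165], -30), ([97, 99, 129, 161, 164], 6),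
    ([97, 99, 129, 162, 163], -3), ([98, 99, 128, 160, 165], 60), ([98, 99, 128, 161, 164], -12),
    ([98, 99, 128, 162, 163], 6)], [96, 97, 98, 99, 160, 165]),
  (.ofList [([128, 129, 130, 131, 132], 1)], [96, 97, 129, 130, 131, 132]),
  (.ofList [([96, 97, 98, 128, 231], 105), ([96, 97, 98, 129, 230], -15),
    ([96, 97, 98, 130, 229], 5), ([96, 97, 98, 131, 228], -3), ([96, 97, 98, 132, 227], 3),
    ([96, 97, 99, 128, 230], -45), ([96, 97, 99, 129, 229], 15), ([96, 97, 99, 130, 228], -9),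
    ([96, 97, 99, 131, 227], 9), ([96, 97, 99, 132, 226], -15), ([96, 98, 99, 128, 229], 15),
    ([96, 98, 99, 129, 228], -9), ([96, 98, 99, 130, 227], 9), ([96, 98, 99, 131, 226], -15),
    ([96, 98, 99, 132, 225], 45), ([97, 98, 99, 128, 228], -3), ([97, 98, 99, 129, 227], 3),
    ([97, 98, 99, 130, 226], -5), ([97, 98, 99, 131, 225], 15), ([97, 98, 99, 132, 224], -105)],
    [96, 97, 98, 128, 131, 165]),
  (.ofList [([96, 97, 98, 128, 231], 210), ([96, 97, 98, 129, 230], -30),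
    ([96, 97, 98, 130, 229], 10), ([96, 97, 98, 131, 228], -6), ([96, 97, 98, 132, 227], 6),
    ([96, 97, 99, 128, 230], -90), ([96, 97, 99, 129, 229], 30), ([96, 97, 99, 130, 228], -18),
    ([96, 97, 99, 131, 227], 18), ([96, 97, 99, 132, 226], -30), ([96, 98, 99, 128, 229], 30),
    ([96, 98, 99, 129, 228], -18), ([96, 98, 99, 130, 227], 18), ([96, 98, 99, 131, 226], -30),
    ([96, 98, 99, 132, 225], 90), ([96, 99, 128, 129, 198], 1170),
    ([96, 99, 128, 130, 197], -390), ([96, 99, 128, 131, 196], 234),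
    ([96, 99, 128, 132, 195], -234), ([96, 99, 129, 130, 196], 78),
    ([96, 99, 129, 131, 195], -117), ([96, 99, 129, 132, 194], 234),
    ([96, 99, 130, 131, 194], 78), ([96, 99, 130, 132, 193], -390),
    ([96, 99, 131, 132, 192], 1170), ([97, 98, 99, 128, 228], -6), ([97, 98, 99, 129, 227], 6),
    ([97, 98, 99, 130, 226], -10), ([97, 98, 99, 131, 225], 30), ([97, 98, 99, 132, 224], -210),
    ([97, 98, 128, 129, 198], -390), ([97, 98, 128, 130, 197], 130),
    ([97, 98, 128, 131, 196], -78), ([97, 98, 128, 132, 195], 78), ([97, 98, 129, 130, 196], -26),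
    ([97, 98, 129, 131, 195], 39), ([97, 98, 129, 132, 194], -78), ([97, 98, 130, 131, 194], -26),
    ([97, 98, 130, 132, 193], 130), ([97, 98, 131, 132, 192], -390)], [96, 97, 98, 129, 130, 165])]

theorem certified_leafFiveTen :
    certified {0} 5 10 (leafLists 5 10 (-2)) leafFiveTen = true := by
  decide +kernel

/-- Invariant forms with one linear argument of degree 5 and weight 8 with independent differentials. -/
def hamFiveEight : List (Table × List ℕ) := [
  (.ofList [([32, 128, 129, 131, 165], 10), ([32, 128, 129, 132, 164], -8),
    ([32, 128, 130, 131, 164], -4), ([32, 128, 130, 132, 163], 8), ([32, 128, 131, 132, 162], -8),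
    ([32, 129, 130, 131, 163], 1), ([32, 129, 130, 132, 162], -4), ([32, 129, 131, 132, 161], 10),
    ([32, 130, 131, 132, 160], -20), ([33, 128, 129, 130, 165], -20),
    ([33, 128, 129, 131, 164], 10), ([33, 128, 129, 132, 163], -8),
    ([33, 128, 130, 131, 163], -4), ([33, 128, 130, 132, 162], 8), ([33, 128, 131, 132, 161], -8),
    ([33, 129, 130, 131, 162], 1), ([33, 129, 130, 132, 161], -4),
    ([33, 129, 131, 132, 160], 10)], [32, 96, 129, 130, 131, 132]),
  (.ofList [([32, 96, 99, 160, 198], 180), ([32, 96, 99, 161, 197], -30),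
    ([32, 96, 99, 162, 196], 12), ([32, 96, 99, 163, 195], -9), ([32, 96, 99, 164, 194], 12),
    ([32, 96, 99, 165, 193], -30), ([32, 97, 98, 160, 198], -60), ([32, 97, 98, 161, 197], 10),
    ([32, 97, 98, 162, 196], -4), ([32, 97, 98, 163, 195], 3), ([32, 97, 98, 164, 194], -4),
    ([32, 97, 98, 165, 193], 10), ([33, 96, 99, 160, 197], -30), ([33, 96, 99, 161, 196], 12),
    ([33, 96, 99, 162, 195], -9), ([33, 96, 99, 163, 194], 12), ([33, 96, 99, 164, 193], -30),
    ([33, 96, 99, 165, 192], 180), ([33, 97, 98, 160, 197], 10), ([33, 97, 98, 161, 196], -4),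
    ([33, 97, 98, 162, 195], 3), ([33, 97, 98, 163, 194], -4), ([33, 97, 98, 164, 193], 10),
    ([33, 97, 98, 165, 192], -60)], [32, 96, 97, 98, 162, 165]),
  (.ofList [([32, 96, 98, 128, 231], 105), ([32, 96, 98, 129, 230], -15),
    ([32, 96, 98, 130, 229], 5), ([32, 96, 98, 131, 228], -3), ([32, 96, 98, 132, 227], 3),
    ([32, 96, 99, 128, 230], -45), ([32, 96, 99, 129, 229], 15), ([32, 96, 99, 130, 228], -9),
    ([32, 96, 99, 131, 227], 9), ([32, 96, 99, 132, 226], -15), ([32, 97, 98, 128, 230], -15),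
    ([32, 97, 98, 129, 229], 5), ([32, 97, 98, 130, 228], -3), ([32, 97, 98, 131, 227], 3),
    ([32, 97, 98, 132, 226], -5), ([32, 97, 99, 128, 229], 15), ([32, 97, 99, 129, 228], -9),
    ([32, 97, 99, 130, 227], 9), ([32, 97, 99, 131, 226], -15), ([32, 97, 99, 132, 225], 45),
    ([32, 98, 99, 128, 228], -6), ([32, 98, 99, 129, 227], 6), ([32, 98, 99, 130, 226], -10),
    ([32, 98, 99, 131, 225], 30), ([32, 98, 99, 132, 224], -210), ([33, 96, 97, 128, 231], -210),
    ([33, 96, 97, 129, 230], 30), ([33, 96, 97, 130, 229], -10), ([33, 96, 97, 131, 228], 6),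
    ([33, 96, 97, 132, 227], -6), ([33, 96, 98, 128, 230], 45), ([33, 96, 98, 129, 229], -15),
    ([33, 96, 98, 130, 228], 9), ([33, 96, 98, 131, 227], -9), ([33, 96, 98, 132, 226], 15),
    ([33, 96, 99, 128, 229], -15), ([33, 96, 99, 129, 228], 9), ([33, 96, 99, 130, 227], -9),
    ([33, 96, 99, 131, 226], 15), ([33, 96, 99, 132, 225], -45), ([33, 97, 98, 128, 229], -5),
    ([33, 97, 98, 129, 228], 3), ([33, 97, 98, 130, 227], -3), ([33, 97, 98, 131, 226], 5),
    ([33, 97, 98, 132, 225], -15), ([33, 97, 99, 128, 228], 3), ([33, 97, 99, 129, 227], -3),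
    ([33, 97, 99, 130, 226], 5), ([33, 97, 99, 131, 225], -15), ([33, 97, 99, 132, 224], 105)],
    [32, 96, 97, 99, 128, 198]),
  (.ofList [([32, 96, 98, 128, 231], -105), ([32, 96, 98, 129, 230], 15),
    ([32, 96, 98, 130, 229], -5), ([32, 96, 98, 131, 228], 3), ([32, 96, 98, 132, 227], -3),
    ([32, 96, 99, 128, 230], 45), ([32, 96, 99, 129, 229], -15), ([32, 96, 99, 130, 228], 9),
    ([32, 96, 99, 131, 227], -9), ([32, 96, 99, 132, 226], 15), ([32, 97, 98, 128, 230], 15),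
    ([32, 97, 98, 129, 229], -5), ([32, 97, 98, 130, 228], 3), ([32, 97, 98, 131, 227], -3),
    ([32, 97, 98, 132, 226], 5), ([32, 97, 99, 128, 229], -15), ([32, 97, 99, 129, 228], 9),
    ([32, 97, 99, 130, 227], -9), ([32, 97, 99, 131, 226], 15), ([32, 97, 99, 132, 225], -45),
    ([32, 97, 128, 130, 198], -90), ([32, 97, 128, 131, 197], 45), ([32, 97, 128, 132, 196], -36),
    ([32, 97, 129, 130, 197], 15), ([32, 97, 129, 131, 196], -18), ([32, 97, 129, 132, 195], 27),
    ([32, 97, 130, 131, 195], 9), ([32, 97, 130, 132, 194], -30), ([32, 97, 131, 132, 193], 45),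
    ([32, 98, 99, 128, 228], 6), ([32, 98, 99, 129, 227], -6), ([32, 98, 99, 130, 226], 10),
    ([32, 98, 99, 131, 225], -30), ([32, 98, 99, 132, 224], 210), ([32, 98, 128, 129, 198], 270),
    ([32, 98, 128, 130, 197], -60), ([32, 98, 128, 131, 196], 18), ([32, 98, 129, 130, 196], 6),
    ([32, 98, 129, 132, 194], -18), ([32, 98, 130, 131, 194], -6), ([32, 98, 130, 132, 193], 60),
    ([32, 98, 131, 132, 192], -270), ([32, 99, 128, 129, 197], -135),
    ([32, 99, 128, 130, 196], 90), ([32, 99, 128, 131, 195], -81), ([32, 99, 128, 132, 194], 108),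
    ([32, 99, 129, 130, 195], -27), ([32, 99, 129, 131, 194], 54),
    ([32, 99, 129, 132, 193], -135), ([32, 99, 130, 131, 193], -45),
    ([32, 99, 130, 132, 192], 270), ([33, 96, 97, 128, 231], 210), ([33, 96, 97, 129, 230], -30),
    ([33, 96, 97, 130, 229], 10), ([33, 96, 97, 131, 228], -6), ([33, 96, 97, 132, 227], 6),
    ([33, 96, 98, 128, 230], -45), ([33, 96, 98, 129, 229], 15), ([33, 96, 98, 130, 228], -9),
    ([33, 96, 98, 131, 227], 9), ([33, 96, 98, 132, 226], -15), ([33, 96, 99, 128, 229], 15),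
    ([33, 96, 99, 129, 228], -9), ([33, 96, 99, 130, 227], 9), ([33, 96, 99, 131, 226], -15),
    ([33, 96, 99, 132, 225], 45), ([33, 96, 128, 130, 198], 270), ([33, 96, 128, 131, 197], -135),
    ([33, 96, 128, 132, 196], 108), ([33, 96, 129, 130, 197], -45), ([33, 96, 129, 131, 196], 54),
    ([33, 96, 129, 132, 195], -81), ([33, 96, 130, 131, 195], -27), ([33, 96, 130, 132, 194], 90),
    ([33, 96, 131, 132, 193], -135), ([33, 97, 98, 128, 229], 5), ([33, 97, 98, 129, 228], -3),
    ([33, 97, 98, 130, 227], 3), ([33, 97, 98, 131, 226], -5), ([33, 97, 98, 132, 225], 15),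
    ([33, 97, 99, 128, 228], -3), ([33, 97, 99, 129, 227], 3), ([33, 97, 99, 130, 226], -5),
    ([33, 97, 99, 131, 225], 15), ([33, 97, 99, 132, 224], -105), ([33, 97, 128, 129, 198], -270),
    ([33, 97, 128, 130, 197], 60), ([33, 97, 128, 131, 196], -18), ([33, 97, 129, 130, 196], -6),
    ([33, 97, 129, 132, 194], 18), ([33, 97, 130, 131, 194], 6), ([33, 97, 130, 132, 193], -60),
    ([33, 97, 131, 132, 192], 270), ([33, 98, 128, 129, 197], 45), ([33, 98, 128, 130, 196], -30),
    ([33, 98, 128, 131, 195], 27), ([33, 98, 128, 132, 194], -36), ([33, 98, 129, 130, 195], 9),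
    ([33, 98, 129, 131, 194], -18), ([33, 98, 129, 132, 193], 45), ([33, 98, 130, 131, 193], 15),
    ([33, 98, 130, 132, 192], -90)], [32, 97, 98, 129, 132, 162]),
  (.ofList [([32, 96, 97, 129, 231], 105), ([32, 96, 97, 130, 230], -30),
    ([32, 96, 97, 131, 229], 15), ([32, 96, 97, 132, 228], -12), ([32, 96, 98, 129, 230], -30),
    ([32, 96, 98, 130, 229], 20), ([32, 96, 98, 131, 228], -18), ([32, 96, 98, 132, 227], 24),
    ([32, 96, 99, 129, 229], 15), ([32, 96, 99, 130, 228], -18), ([32, 96, 99, 131, 227], 27),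
    ([32, 96, 99, 132, 226], -60), ([32, 97, 98, 129, 229], 5), ([32, 97, 98, 130, 228], -6),
    ([32, 97, 98, 131, 227], 9), ([32, 97, 98, 132, 226], -20), ([32, 97, 99, 129, 228], -6),
    ([32, 97, 99, 130, 227], 12), ([32, 97, 99, 131, 226], -30), ([32, 97, 99, 132, 225], 120),
    ([32, 98, 99, 129, 227], 3), ([32, 98, 99, 130, 226], -10), ([32, 98, 99, 131, 225], 45),
    ([32, 98, 99, 132, 224], -420), ([33, 96, 97, 128, 231], -420), ([33, 96, 97, 129, 230], 45),
    ([33, 96, 97, 130, 229], -10), ([33, 96, 97, 131, 228], 3), ([33, 96, 98, 128, 230], 120),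
    ([33, 96, 98, 129, 229], -30), ([33, 96, 98, 130, 228], 12), ([33, 96, 98, 131, 227], -6),
    ([33, 96, 99, 128, 229], -60), ([33, 96, 99, 129, 228], 27), ([33, 96, 99, 130, 227], -18),
    ([33, 96, 99, 131, 226], 15), ([33, 97, 98, 128, 229], -20), ([33, 97, 98, 129, 228], 9),
    ([33, 97, 98, 130, 227], -6), ([33, 97, 98, 131, 226], 5), ([33, 97, 99, 128, 228], 24),
    ([33, 97, 99, 129, 227], -18), ([33, 97, 99, 130, 226], 20), ([33, 97, 99, 131, 225], -30),
    ([33, 98, 99, 128, 227], -12), ([33, 98, 99, 129, 226], 15), ([33, 98, 99, 130, 225], -30),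
    ([33, 98, 99, 131, 224], 105)], [32, 96, 97, 98, 129, 198]),
  (.ofList [([32, 96, 97, 129, 231], 315), ([32, 96, 97, 130, 230], -90),
    ([32, 96, 97, 131, 229], 45), ([32, 96, 97, 132, 228], -36), ([32, 96, 98, 129, 230], -90),
    ([32, 96, 98, 130, 229], 60), ([32, 96, 98, 131, 228], -54), ([32, 96, 98, 132, 227], 72),
    ([32, 96, 99, 129, 229], 45), ([32, 96, 99, 130, 228], -54), ([32, 96, 99, 131, 227], 81),
    ([32, 96, 99, 132, 226], -180), ([32, 96, 99, 160, 198], -1080),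
    ([32, 96, 99, 161, 197], 180), ([32, 96, 99, 162, 196], -72), ([32, 96, 99, 163, 195], 54),
    ([32, 96, 99, 164, 194], -72), ([32, 96, 99, 165, 193], 180), ([32, 97, 98, 129, 229], 15),
    ([32, 97, 98, 130, 228], -18), ([32, 97, 98, 131, 227], 27), ([32, 97, 98, 132, 226], -60),
    ([32, 97, 98, 160, 198], 360), ([32, 97, 98, 161, 197], -60), ([32, 97, 98, 162, 196], 24),
    ([32, 97, 98, 163, 195], -18), ([32, 97, 98, 164, 194], 24), ([32, 97, 98, 165, 193], -60),
    ([32, 97, 99, 129, 228], -18), ([32, 97, 99, 130, 227], 36), ([32, 97, 99, 131, 226], -90),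
    ([32, 97, 99, 132, 225], 360), ([32, 97, 128, 130, 198], -480),
    ([32, 97, 128, 131, 197], 240), ([32, 97, 128, 132, 196], -192),
    ([32, 97, 129, 130, 197], 80), ([32, 97, 129, 131, 196], -96), ([32, 97, 129, 132, 195], 144),
    ([32, 97, 129, 162, 165], -40), ([32, 97, 129, 163, 164], 24), ([32, 97, 130, 131, 195], 48),
    ([32, 97, 130, 132, 194], -160), ([32, 97, 130, 161, 165], 80),
    ([32, 97, 130, 162, 164], -16), ([32, 97, 131, 132, 193], 240),
    ([32, 97, 131, 160, 165], -200), ([32, 97, 131, 161, 164], -8), ([32, 97, 131, 162, 163], 16),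
    ([32, 97, 132, 160, 164], 160), ([32, 97, 132, 161, 163], -32), ([32, 98, 99, 129, 227], 9),
    ([32, 98, 99, 130, 226], -30), ([32, 98, 99, 131, 225], 135), ([32, 98, 99, 132, 224], -1260),
    ([32, 98, 128, 129, 198], 1440), ([32, 98, 128, 130, 197], -320),
    ([32, 98, 128, 131, 196], 96), ([32, 98, 128, 162, 165], 160), ([32, 98, 128, 163, 164], -96),
    ([32, 98, 129, 130, 196], 32), ([32, 98, 129, 132, 194], -96), ([32, 98, 129, 161, 165], -80),
    ([32, 98, 129, 162, 164], 16), ([32, 98, 130, 131, 194], -32), ([32, 98, 130, 132, 193], 320),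
    ([32, 98, 131, 132, 192], -1440), ([32, 98, 131, 160, 164], 80),
    ([32, 98, 131, 161, 163], -16), ([32, 98, 132, 160, 163], -160),
    ([32, 98, 132, 161, 162], 96), ([32, 99, 128, 129, 197], -720),
    ([32, 99, 128, 130, 196], 480), ([32, 99, 128, 131, 195], -432),
    ([32, 99, 128, 132, 194], 576), ([32, 99, 128, 161, 165], -480),
    ([32, 99, 128, 162, 164], 96), ([32, 99, 129, 130, 195], -144),
    ([32, 99, 129, 131, 194], 288), ([32, 99, 129, 132, 193], -720),
    ([32, 99, 129, 160, 165], 600), ([32, 99, 129, 161, 164], 24), ([32, 99, 129, 162, 163], -48),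
    ([32, 99, 130, 131, 193], -240), ([32, 99, 130, 132, 192], 1440),
    ([32, 99, 130, 160, 164], -240), ([32, 99, 130, 161, 163], 48),
    ([32, 99, 131, 160, 163], 120), ([32, 99, 131, 161, 162], -72),
    ([33, 96, 97, 128, 231], -1260), ([33, 96, 97, 129, 230], 135), ([33, 96, 97, 130, 229], -30),
    ([33, 96, 97, 131, 228], 9), ([33, 96, 98, 128, 230], 360), ([33, 96, 98, 129, 229], -90),
    ([33, 96, 98, 130, 228], 36), ([33, 96, 98, 131, 227], -18), ([33, 96, 99, 128, 229], -180),
    ([33, 96, 99, 129, 228], 81), ([33, 96, 99, 130, 227], -54), ([33, 96, 99, 131, 226], 45),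
    ([33, 96, 99, 160, 197], 180), ([33, 96, 99, 161, 196], -72), ([33, 96, 99, 162, 195], 54),
    ([33, 96, 99, 163, 194], -72), ([33, 96, 99, 164, 193], 180), ([33, 96, 99, 165, 192], -1080),
    ([33, 96, 128, 130, 198], 1440), ([33, 96, 128, 131, 197], -720),
    ([33, 96, 128, 132, 196], 576), ([33, 96, 129, 130, 197], -240),
    ([33, 96, 129, 131, 196], 288), ([33, 96, 129, 132, 195], -432),
    ([33, 96, 129, 162, 165], 120), ([33, 96, 129, 163, 164], -72),
    ([33, 96, 130, 131, 195], -144), ([33, 96, 130, 132, 194], 480),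
    ([33, 96, 130, 161, 165], -240), ([33, 96, 130, 162, 164], 48),
    ([33, 96, 131, 132, 193], -720), ([33, 96, 131, 160, 165], 600),
    ([33, 96, 131, 161, 164], 24), ([33, 96, 131, 162, 163], -48),
    ([33, 96, 132, 160, 164], -480), ([33, 96, 132, 161, 163], 96), ([33, 97, 98, 128, 229], -60),
    ([33, 97, 98, 129, 228], 27), ([33, 97, 98, 130, 227], -18), ([33, 97, 98, 131, 226], 15),
    ([33, 97, 98, 160, 197], -60), ([33, 97, 98, 161, 196], 24), ([33, 97, 98, 162, 195], -18),
    ([33, 97, 98, 163, 194], 24), ([33, 97, 98, 164, 193], -60), ([33, 97, 98, 165, 192], 360),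
    ([33, 97, 99, 128, 228], 72), ([33, 97, 99, 129, 227], -54), ([33, 97, 99, 130, 226], 60),
    ([33, 97, 99, 131, 225], -90), ([33, 97, 128, 129, 198], -1440),
    ([33, 97, 128, 130, 197], 320), ([33, 97, 128, 131, 196], -96),
    ([33, 97, 128, 162, 165], -160), ([33, 97, 128, 163, 164], 96),
    ([33, 97, 129, 130, 196], -32), ([33, 97, 129, 132, 194], 96), ([33, 97, 129, 161, 165], 80),
    ([33, 97, 129, 162, 164], -16), ([33, 97, 130, 131, 194], 32),
    ([33, 97, 130, 132, 193], -320), ([33, 97, 131, 132, 192], 1440),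
    ([33, 97, 131, 160, 164], -80), ([33, 97, 131, 161, 163], 16), ([33, 97, 132, 160, 163], 160),
    ([33, 97, 132, 161, 162], -96), ([33, 98, 99, 128, 227], -36), ([33, 98, 99, 129, 226], 45),
    ([33, 98, 99, 130, 225], -90), ([33, 98, 99, 131, 224], 315), ([33, 98, 128, 129, 197], 240),
    ([33, 98, 128, 130, 196], -160), ([33, 98, 128, 131, 195], 144),
    ([33, 98, 128, 132, 194], -192), ([33, 98, 128, 161, 165], 160),
    ([33, 98, 128, 162, 164], -32), ([33, 98, 129, 130, 195], 48), ([33, 98, 129, 131, 194], -96),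
    ([33, 98, 129, 132, 193], 240), ([33, 98, 129, 160, 165], -200),
    ([33, 98, 129, 161, 164], -8), ([33, 98, 129, 162, 163], 16), ([33, 98, 130, 131, 193], 80),
    ([33, 98, 130, 132, 192], -480), ([33, 98, 130, 160, 164], 80),
    ([33, 98, 130, 161, 163], -16), ([33, 98, 131, 160, 163], -40),
    ([33, 98, 131, 161, 162], 24)], [32, 96, 98, 128, 131, 165]),
  (.ofList [([32, 96, 132, 160, 165], 120), ([32, 96, 132, 161, 164], -24),
    ([32, 96, 132, 162, 163], 12), ([32, 97, 131, 160, 165], -30), ([32, 97, 131, 161, 164], 6),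
    ([32, 97, 131, 162, 163], -3), ([32, 98, 130, 160, 165], 20), ([32, 98, 130, 161, 164], -4),
    ([32, 98, 130, 162, 163], 2), ([32, 99, 129, 160, 165], -30), ([32, 99, 129, 161, 164], 6),
    ([32, 99, 129, 162, 163], -3), ([33, 96, 131, 160, 165], -30), ([33, 96, 131, 161, 164], 6),
    ([33, 96, 131, 162, 163], -3), ([33, 97, 130, 160, 165], 20), ([33, 97, 130, 161, 164], -4),
    ([33, 97, 130, 162, 163], 2), ([33, 98, 129, 160, 165], -30), ([33, 98, 129, 161, 164], 6),
    ([33, 98, 129, 162, 163], -3), ([33, 99, 128, 160, 165], 120), ([33, 99, 128, 161, 164], -24),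
    ([33, 99, 128, 162, 163], 12)], [32, 96, 97, 128, 132, 165])]

theorem certified_hamFiveEight :
    certified {1} 5 8 (oneLinearLists 5 8 (-2)) hamFiveEight = true := by
  decide +kernel

/-- Invariant forms with one linear argument of degree 6 and weight 8 with independent differentials. -/
def hamSixEight : List (Table × List ℕ) := [
  (.ofList [([32, 96, 97, 98, 162, 165], 5), ([32, 96, 97, 98, 163, 164], -3),
    ([32, 96, 97, 99, 161, 165], -15), ([32, 96, 97, 99, 162, 164], 3),
    ([32, 96, 98, 99, 160, 165], 25), ([32, 96, 98, 99, 161, 164], 1),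
    ([32, 96, 98, 99, 162, 163], -2), ([32, 97, 98, 99, 160, 164], -5),
    ([32, 97, 98, 99, 161, 163], 1), ([33, 96, 97, 98, 161, 165], -5),
    ([33, 96, 97, 98, 162, 164], 1), ([33, 96, 97, 99, 160, 165], 25),
    ([33, 96, 97, 99, 161, 164], 1), ([33, 96, 97, 99, 162, 163], -2),
    ([33, 96, 98, 99, 160, 164], -15), ([33, 96, 98, 99, 161, 163], 3),
    ([33, 97, 98, 99, 160, 163], 5), ([33, 97, 98, 99, 161, 162], -3)],
    [32, 96, 97, 98, 99, 128, 165]),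
  (.ofList [([32, 96, 129, 130, 131, 132], 1), ([32, 97, 128, 130, 131, 132], -1),
    ([32, 98, 128, 129, 131, 132], 1), ([32, 99, 128, 129, 130, 132], -1),
    ([33, 96, 128, 130, 131, 132], -1), ([33, 97, 128, 129, 131, 132], 1),
    ([33, 98, 128, 129, 130, 132], -1), ([33, 99, 128, 129, 130, 131], 1)],
    [32, 96, 97, 99, 128, 131, 132])]

theorem certified_hamSixEight :
    certified {1} 6 8 (oneLinearLists 6 8 (-2)) hamSixEight = true := by
  decide +kernel

/-! ### Dimensions of cohomology spaces -/

section Dimensions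

variable {L : Type*} [LieRing L] [LieAlgebra ℝ L] [TopologicalSpace L] {K : LieSubalgebra ℝ L}
  {W : ℤ → Submodule ℝ L} {w : ℤ}

theorem coboundaries_le_cocycles
    (hd : ∀ {k : ℕ} {f}, f ∈ cochains K W k w → differential k f ∈ cochains K W (k + 1) w) :
    ∀ k, coboundaries K W k w ≤ cocycles K W k w
  | 0 => bot_le
  | k + 1 => by
    rintro _ ⟨f, hf, rfl⟩
    exact ⟨hd hf, differential_differential f⟩

theorem finrank_cocycles_add (k : ℕ) [FiniteDimensional ℝ (cochains K W k w)] :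
    Module.finrank ℝ (cocycles K W k w) + Module.finrank ℝ (coboundaries K W (k + 1) w) =
      Module.finrank ℝ (cochains K W k w) := by
  have h := LinearMap.finrank_range_add_finrank_ker (K := ℝ) (V := cochains K W k w)
    (V₂ := L [⋀^Fin (k + 1)]→ₗ[ℝ] ℝ) ((differential k).domRestrict (cochains K W k w))
  rw [LinearMap.range_domRestrict, add_comm] at h
  rw [← h]
  congr 1
  have h2 : LinearMap.ker ((differential k).domRestrict (cochains K W k w)) =
      (cocycles K W k w).submoduleOf (cochains K W k w) := by
    ext f
    simp only [LinearMap.mem_ker, Submodule.submoduleOf, Submodule.mem_comap, cocycles,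
      Submodule.subtype_apply, Submodule.mem_inf, f.2, true_and, LinearMap.domRestrict_apply]
  rw [h2]
  exact (Submodule.submoduleOfEquivOfLe inf_le_left).finrank_eq.symm

theorem finrank_cohomology_add
    (hd : ∀ {k : ℕ} {f}, f ∈ cochains K W k w → differential k f ∈ cochains K W (k + 1) w) (k : ℕ)
    [FiniteDimensional ℝ (cochains K W k w)] :
    Module.finrank ℝ (Cohomology K W k w) + Module.finrank ℝ (coboundaries K W k w) +
      Module.finrank ℝ (coboundaries K W (k + 1) w) = Module.finrank ℝ (cochains K W k w) := by
  have : FiniteDimensional ℝ (cocycles K W k w) :=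
    Submodule.finiteDimensional_of_le (inf_le_left : cocycles K W k w ≤ cochains K W k w)
  have h := Submodule.finrank_quotient_add_finrank (R := ℝ) (M := cocycles K W k w)
    ((coboundaries K W k w).submoduleOf (cocycles K W k w))
  rw [(Submodule.submoduleOfEquivOfLe (coboundaries_le_cocycles hd k)).finrank_eq] at h
  rw [← finrank_cocycles_add k, ← h]

theorem finiteDimensional_coboundaries (k : ℕ) [FiniteDimensional ℝ (cochains K W k w)] :
    FiniteDimensional ℝ (coboundaries K W (k + 1) w) :=
  inferInstanceAs (FiniteDimensional ℝ ((cochains K W k w).map (differential k)))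

theorem finiteDimensional_cohomology (k : ℕ) [FiniteDimensional ℝ (cochains K W k w)] :
    FiniteDimensional ℝ (Cohomology K W k w) := by
  have : FiniteDimensional ℝ (cocycles K W k w) :=
    Submodule.finiteDimensional_of_le (inf_le_left : cocycles K W k w ≤ cochains K W k w)
  infer_instance

end Dimensions

variable {k : ℕ} {w : ℤ}

/-- The dimension of the space of leaf cochains. -/
def leafDim (k : ℕ) (w : ℤ) : ℕ := (leafLists k w 0).length - (leafLists k w (-2)).length

/-- The dimension of the space of relative cochains on `Ham`. -/
def hamDim (k : ℕ) (w : ℤ) : ℕ := (hamLists k w 0).length - (hamLists k w (-2)).length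

theorem finiteDimensional_leafCochains (hw : w ≤ 10) :
    FiniteDimensional ℝ (cochains sp0 weightPart0 k w) := by
  have := finiteDimensional_leaf (k := k) (h := 0) hw
  have : FiniteDimensional ℝ (invariantForms {0} k w) :=
    Submodule.finiteDimensional_of_le (inf_le_left : invariantForms {0} k w ≤ homForms {0} k w 0)
  exact Module.Finite.equiv (leafEquiv k w).symm

theorem finiteDimensional_hamCochains (hw : w ≤ 10) :
    FiniteDimensional ℝ (cochains sp weightPart k w) := by
  have := finiteDimensional_ham (k := k) (h := 0) hw
  rw [cochains_eq_invariantForms]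
  exact Submodule.finiteDimensional_of_le
    (inf_le_left : invariantForms {0, 1, 2} k w ≤ homForms {0, 1, 2} k w 0)

theorem finrank_leafCochains (hw : w ≤ 10) :
    Module.finrank ℝ (cochains sp0 weightPart0 k w) = leafDim k w := by
  have h := finrank_invariantForms_leaf (k := k) hw
  rw [(leafEquiv k w).finrank_eq, leafDim]
  omega

theorem finrank_hamCochains (hw : w ≤ 10) :
    Module.finrank ℝ (cochains sp weightPart k w) = hamDim k w := by
  have h := finrank_invariantForms_ham (k := k) hw
  rw [cochains_eq_invariantForms, hamDim]
  omega

/-- The dimension of the space of leaf coboundaries. -/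
def leafRank (k : ℕ) (w : ℤ) : ℕ := Module.finrank ℝ (coboundaries sp0 weightPart0 k w)

/-- The dimension of the space of relative coboundaries on `Ham`. -/
def hamRank (k : ℕ) (w : ℤ) : ℕ := Module.finrank ℝ (coboundaries sp weightPart k w)

theorem finrank_leafCohomology (hw : w ≤ 10) :
    Module.finrank ℝ (LeafCohomology k w) + leafRank k w + leafRank (k + 1) w = leafDim k w := by
  have := finiteDimensional_leafCochains (k := k) hw
  rw [← finrank_leafCochains hw]
  exact finrank_cohomology_add differential_mem_leaf k

theorem finrank_hamCohomology (hw : w ≤ 10) :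
    Module.finrank ℝ (HamCohomology k w) + hamRank k w + hamRank (k + 1) w = hamDim k w := by
  have := finiteDimensional_hamCochains (k := k) hw
  rw [← finrank_hamCochains hw]
  exact finrank_cohomology_add differential_mem_ham k

theorem isHomList_one {k : ℕ} {w h : ℤ} (hw : w ≤ 10) {l : List ℕ} :
    IsHomList {1} k w h l ↔ l ∈ oneLinearLists k w h := by
  refine ⟨fun hl => ?_, isHomList_of_mem_oneLinearLists (by simp)⟩
  have h1 : l ∈ hamLists k w h := (isHomList_ham hw).mp
    ⟨hl.1, hl.2.1, hl.2.2.1, by rw [Finset.mem_singleton.mp hl.2.2.2.1]; simp, hl.2.2.2.2⟩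
  rw [hamLists, List.mem_append, List.mem_append] at h1
  rcases h1 with (h1 | h1) | h1
  · have h2 := (isHomList_of_mem_leafLists (A := {0}) (by simp) h1).2.2.2.1
    rw [Finset.mem_singleton.mp hl.2.2.2.1] at h2
    simp at h2
  · exact h1
  · have h2 := (isHomList_of_mem_twoLinearLists (A := {2}) (by simp) h1).2.2.2.1
    rw [Finset.mem_singleton.mp hl.2.2.2.1] at h2
    simp at h2

theorem length_le_leafRank (hw : w ≤ 10) {cs : List (Table × List ℕ)}
    (hc : certified {0} k w (leafLists k w (-2)) cs = true) : cs.length ≤ leafRank (k + 1) w := by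
  have := finiteDimensional_leafCochains (k := k) hw
  have := finiteDimensional_coboundaries (K := sp0) (W := weightPart0) (w := w) k
  have h := length_add_finrank_le (A := {0}) (by simp) hw (fun l hl => (isHomList_leaf hw).mp hl)
    (restrict (k + 1) ∘ₗ differential k) (fun l => onListLM (k + 1) l ∘ₗ extend (k + 1))
    (fun f l hl => ?_) (N := ⊥) (fun n hn l _ => ?_) hc
    (B := coboundaries sp0 weightPart0 (k + 1) w) bot_le (fun c _ hf => ?_)
  · simpa [leafRank] using h
  · obtain ⟨h1, -, h2, -⟩ := mem_leafLists.mp ((isHomList_leaf hw).mp hl)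
    exact onList_extend_restrict _ h2 h1
  · rw [(Submodule.mem_bot ℝ).mp hn, map_zero]
  · exact ⟨restrict k _, restrict_mem (mem_cochains_of_mem_invariantForms hf),
      differential_restrict _⟩

theorem wedgeOmegaLM_injective : Function.Injective (wedgeOmegaLM k) := fun f g h => by
  have h1 := congrArg (contract k) h
  rw [wedgeOmegaLM_apply, wedgeOmegaLM_apply, contract_wedgeOmega, contract_wedgeOmega] at h1
  exact neg_injective h1

theorem finrank_map_wedgeOmega (B : Submodule ℝ (ham0 [⋀^Fin k]→ₗ[ℝ] ℝ)) :
    Module.finrank ℝ (B.map (wedgeOmegaLM k)) = Module.finrank ℝ B :=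
  (Submodule.equivMapOfInjective _ wedgeOmegaLM_injective B).finrank_eq.symm

theorem map_coboundaries_le (hw : w ≤ 10) :
    (coboundaries sp0 weightPart0 (k + 1) w).map (wedgeOmegaLM (k + 1)) ≤
      coboundaries sp weightPart (k + 3) (w - 2) := by
  rintro _ ⟨_, ⟨f, hf, rfl⟩, rfl⟩
  exact ⟨wedgeOmega f, wedgeOmega_mem_cochains hf, differential_wedgeOmega hw hf⟩

theorem onList_wedgeOmega_oneLinear (f : ham0 [⋀^Fin k]→ₗ[ℝ] ℝ) {h : ℤ} {l : List ℕ}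
    (hl : l ∈ oneLinearLists (k + 2) w h) : onList (k + 2) (wedgeOmega f) l = 0 := by
  rw [oneLinearLists, List.mem_append, List.mem_map, List.mem_map] at hl
  rcases hl with ⟨m, hm, rfl⟩ | ⟨m, hm, rfl⟩ <;> obtain ⟨h1, -, h2, -⟩ := mem_leafLists.mp hm
  · exact onList_eq_zero_of_restrict (restrict_curryLeft_wedgeOmega f _) h2 h1
  · exact onList_eq_zero_of_restrict (restrict_curryLeft_wedgeOmega f _) h2 h1

theorem length_add_finrank_le_hamRank (hw : w ≤ 10) {cs : List (Table × List ℕ)}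
    (hc : certified {1} (k + 1) w (oneLinearLists (k + 1) w (-2)) cs = true)
    {N : Submodule ℝ (ham0 [⋀^Fin k]→ₗ[ℝ] ℝ)}
    (hN : N.map (wedgeOmegaLM k) ≤ coboundaries sp weightPart (k + 2) w) :
    cs.length + Module.finrank ℝ N ≤ hamRank (k + 2) w := by
  have := finiteDimensional_hamCochains (k := k + 1) hw
  have := finiteDimensional_coboundaries (K := sp) (W := weightPart) (w := w) (k + 1)
  rw [← finrank_map_wedgeOmega]
  refine length_add_finrank_le (A := {1}) (by simp) hw (fun l hl => (isHomList_one hw).mp hl)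
    (differential (k + 1)) (fun l => onListLM (k + 2) l) (fun f l _ => rfl)
    (fun n hn l hl => ?_) hc hN fun c _ hf => ⟨_, mem_cochains_of_mem_invariantForms hf, rfl⟩
  obtain ⟨f, -, rfl⟩ := hn
  exact onList_wedgeOmega_oneLinear f ((isHomList_one hw).mp hl)

theorem length_add_leafRank_le (hw : w ≤ 10) {cs : List (Table × List ℕ)}
    (hc : certified {1} (k + 2) (w - 2) (oneLinearLists (k + 2) (w - 2) (-2)) cs = true) :
    cs.length + leafRank (k + 1) w ≤ hamRank (k + 3) (w - 2) :=
  length_add_finrank_le_hamRank (by linarith) hc (map_coboundaries_le hw)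

theorem length_le_sum_weights : ∀ {l : List ℕ}, (∀ p ∈ l, p ∈ higherCodes) →
    (l.length : ℤ) ≤ (l.map fun p => ((p / 32 : ℕ) - 2 : ℤ)).sum
  | [], _ => by simp
  | p :: l, hl => by
    have h1 := length_le_sum_weights fun q hq => hl q (List.mem_cons_of_mem p hq)
    have h2 := (mem_higherCodes.mp (hl p List.mem_cons_self)).1
    rw [List.length_cons, List.map_cons, List.sum_cons]
    omega

theorem leafLists_eq_nil {h : ℤ} (hk : w < k) : leafLists k w h = [] := by
  rw [List.eq_nil_iff_forall_not_mem]
  intro l hl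
  obtain ⟨h1, -, h2, h3, -⟩ := mem_leafLists.mp hl
  have h4 := length_le_sum_weights h2
  omega

theorem leafLists_eq_nil_of_odd (hw : w % 2 = 1) : leafLists k w 0 = [] := by
  rw [leafLists, if_neg (by omega)]

theorem finrank_leafCohomology_eq_zero (hw : w ≤ 10) (h0 : (k, w) ≠ (0, 0)) (h2 : (k, w) ≠ (2, 2))
    (h5 : (k, w) ≠ (5, 10)) : Module.finrank ℝ (LeafCohomology k w) = 0 := by
  have E : ∀ {k : ℕ} {w : ℤ}, w ≤ 10 → Module.finrank ℝ (LeafCohomology k w) + leafRank k w +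
    leafRank (k + 1) w = leafDim k w := finrank_leafCohomology
  by_cases h : leafDim k w = 0
  · have := E (k := k) hw
    omega
  have hk : (k : ℤ) ≤ w := by
    by_contra! h1
    rw [leafDim, leafLists_eq_nil h1] at h
    simp at h
  have hw2 : w % 2 = 0 := by
    by_contra h1
    rw [leafDim, leafLists_eq_nil_of_odd (by omega)] at h
    simp at h
  have r1 : 1 ≤ leafRank 4 4 := length_le_leafRank (by norm_num) certified_leafThreeFour
  have r2 : 1 ≤ leafRank 3 6 := length_le_leafRank (by norm_num) certified_leafTwoSix
  have r3 : 4 ≤ leafRank 4 8 := length_le_leafRank (by norm_num) certified_leafThreeEight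
  have r4 : 1 ≤ leafRank 5 8 := length_le_leafRank (by norm_num) certified_leafFourEight
  have r5 : 1 ≤ leafRank 3 10 := length_le_leafRank (by norm_num) certified_leafTwoTen
  have r6 : 2 ≤ leafRank 4 10 := length_le_leafRank (by norm_num) certified_leafThreeTen
  have r7 : 7 ≤ leafRank 5 10 := length_le_leafRank (by norm_num) certified_leafFourTen
  have r8 : 4 ≤ leafRank 6 10 := length_le_leafRank (by norm_num) certified_leafFiveTen
  have n : leafDim 3 4 = 1 ∧ leafDim 4 4 = 1 ∧
      leafDim 2 6 = 1 ∧ leafDim 3 6 = 1 ∧ leafDim 3 8 = 4 ∧ leafDim 4 8 = 5 ∧ leafDim 5 8 = 1 ∧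
      leafDim 2 10 = 1 ∧ leafDim 3 10 = 3 ∧ leafDim 4 10 = 9 ∧ leafDim 6 10 = 4 := by
    decide +kernel
  have e := E (k := k) hw
  have hw0 : 0 ≤ w := by omega
  interval_cases w <;> first | omega | skip
  all_goals
    have hk' : k ≤ 10 := by omega
    interval_cases k <;> simp only [Nat.reduceAdd] at e <;>
      first | omega | exact absurd (by decide +kernel) h | simp at h0 h2 h5

theorem finrank_leafCohomology_zero : Module.finrank ℝ (LeafCohomology 0 0) = 1 := by
  have h1 := finrank_leafCohomology (k := 0) (w := 0) (by norm_num)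
  have h2 := finrank_leafCohomology (k := 1) (w := 0) (by norm_num)
  have h3 : leafRank 0 0 = 0 := finrank_bot ℝ _
  have n : leafDim 0 0 = 1 ∧ leafDim 1 0 = 0 := by decide +kernel
  simp only [Nat.reduceAdd] at *
  omega

theorem finrank_leafCohomology_two : Module.finrank ℝ (LeafCohomology 2 2) = 1 := by
  have h1 := finrank_leafCohomology (k := 1) (w := 2) (by norm_num)
  have h2 := finrank_leafCohomology (k := 2) (w := 2) (by norm_num)
  have h3 := finrank_leafCohomology (k := 3) (w := 2) (by norm_num)
  have n : leafDim 1 2 = 0 ∧ leafDim 2 2 = 1 ∧ leafDim 3 2 = 0 := by decide +kernel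
  simp only [Nat.reduceAdd] at *
  omega

theorem leafRank_ten : leafRank 4 10 = 2 ∧ leafRank 5 10 = 7 ∧ leafRank 6 10 = 4 := by
  have h2 := finrank_leafCohomology (k := 2) (w := 10) (by norm_num)
  have h3 := finrank_leafCohomology (k := 3) (w := 10) (by norm_num)
  have h4 := finrank_leafCohomology (k := 4) (w := 10) (by norm_num)
  have h6 := finrank_leafCohomology (k := 6) (w := 10) (by norm_num)
  have r5 : 1 ≤ leafRank 3 10 := length_le_leafRank (by norm_num) certified_leafTwoTen
  have r6 : 2 ≤ leafRank 4 10 := length_le_leafRank (by norm_num) certified_leafThreeTen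
  have r7 : 7 ≤ leafRank 5 10 := length_le_leafRank (by norm_num) certified_leafFourTen
  have r8 : 4 ≤ leafRank 6 10 := length_le_leafRank (by norm_num) certified_leafFiveTen
  have n : leafDim 2 10 = 1 ∧ leafDim 3 10 = 3 ∧ leafDim 4 10 = 9 ∧ leafDim 6 10 = 4 := by
    decide +kernel
  simp only [Nat.reduceAdd] at *
  omega

theorem finrank_leafCohomology_five : Module.finrank ℝ (LeafCohomology 5 10) = 1 := by
  have h5 := finrank_leafCohomology (k := 5) (w := 10) (by norm_num)
  have r := leafRank_ten
  have n : leafDim 5 10 = 12 := by decide +kernel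
  simp only [Nat.reduceAdd] at *
  omega

theorem leafRank_le_hamRank (hw : w ≤ 10) : leafRank (k + 1) w ≤ hamRank (k + 3) (w - 2) := by
  have := finiteDimensional_hamCochains (k := k + 2) (w := w - 2) (by linarith)
  have := finiteDimensional_coboundaries (K := sp) (W := weightPart) (w := w - 2) (k + 2)
  rw [leafRank, ← finrank_map_wedgeOmega]
  exact Submodule.finrank_mono (map_coboundaries_le hw)

theorem hamRank_eight : hamRank 7 8 = 9 ∧ Module.finrank ℝ (HamCohomology 7 8) ≤ 1 := by
  have h6 := finrank_hamCohomology (k := 6) (w := 8) (by norm_num)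
  have h7 := finrank_hamCohomology (k := 7) (w := 8) (by norm_num)
  have n : hamDim 6 8 = 18 ∧ hamDim 7 8 = 14 := by decide +kernel
  have r := leafRank_ten
  have r6 : 7 + leafRank 4 10 ≤ hamRank 6 8 :=
    length_add_leafRank_le (k := 3) (w := 10) (by norm_num) certified_hamFiveEight
  have r7 : 2 + leafRank 5 10 ≤ hamRank 7 8 :=
    length_add_leafRank_le (k := 4) (w := 10) (by norm_num) certified_hamSixEight
  have r8 : leafRank 6 10 ≤ hamRank 8 8 := leafRank_le_hamRank (k := 5) (w := 10) (by norm_num)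
  simp only [Nat.reduceAdd] at *
  omega

/-! ### The first Pontrjagin form -/

theorem sum_perm_four (F : ℤˣ × Fin 4 × Fin 4 × Fin 4 × Fin 4 → ℝ) :
    ∑ σ : Equiv.Perm (Fin 4), F (Equiv.Perm.sign σ, σ 0, σ 1, σ 2, σ 3) = (Multiset.map F
      {(1, 0, 1, 2, 3), (-1, 0, 1, 3, 2), (-1, 0, 2, 1, 3), (1, 0, 2, 3, 1), (1, 0, 3, 1, 2),
       (-1, 0, 3, 2, 1), (-1, 1, 0, 2, 3), (1, 1, 0, 3, 2), (1, 1, 2, 0, 3), (-1, 1, 2, 3, 0),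
       (-1, 1, 3, 0, 2), (1, 1, 3, 2, 0), (1, 2, 0, 1, 3), (-1, 2, 0, 3, 1), (-1, 2, 1, 0, 3),
       (1, 2, 1, 3, 0), (1, 2, 3, 0, 1), (-1, 2, 3, 1, 0), (-1, 3, 0, 1, 2), (1, 3, 0, 2, 1),
       (1, 3, 1, 0, 2), (-1, 3, 1, 2, 0), (-1, 3, 2, 0, 1), (1, 3, 2, 1, 0)}).sum := by
  have h : (Finset.univ : Finset (Equiv.Perm (Fin 4))).val.map
      (fun σ => (Equiv.Perm.sign σ, σ 0, σ 1, σ 2, σ 3)) =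
      {(1, 0, 1, 2, 3), (-1, 0, 1, 3, 2), (-1, 0, 2, 1, 3), (1, 0, 2, 3, 1), (1, 0, 3, 1, 2),
       (-1, 0, 3, 2, 1), (-1, 1, 0, 2, 3), (1, 1, 0, 3, 2), (1, 1, 2, 0, 3), (-1, 1, 2, 3, 0),
       (-1, 1, 3, 0, 2), (1, 1, 3, 2, 0), (1, 2, 0, 1, 3), (-1, 2, 0, 3, 1), (-1, 2, 1, 0, 3),
       (1, 2, 1, 3, 0), (1, 2, 3, 0, 1), (-1, 2, 3, 1, 0), (-1, 3, 0, 1, 2), (1, 3, 0, 2, 1),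
       (1, 3, 1, 0, 2), (-1, 3, 1, 2, 0), (-1, 3, 2, 0, 1), (1, 3, 2, 1, 0)} := by
    decide +kernel
  rw [← h, Multiset.map_map]
  rfl

theorem wedge_two_two {L : Type*} [LieRing L] [LieAlgebra ℝ L] (a b : L [⋀^Fin 2]→ₗ[ℝ] ℝ)
    (x y z t : L) : wedge a b ![x, y, z, t] =
      a ![x, y] * b ![z, t] - a ![x, z] * b ![y, t] + a ![x, t] * b ![y, z] +
        a ![y, z] * b ![x, t] - a ![y, t] * b ![x, z] + a ![z, t] * b ![x, y] := by
  have h := wedge_apply a b ![x, y, z, t]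
  rw [← Equiv.sum_comp (Equiv.permCongr finSumFinEquiv.symm)] at h
  have sw : ∀ (f : L [⋀^Fin 2]→ₗ[ℝ] ℝ) (p q : L), f ![q, p] = -f ![p, q] := fun f p q =>
    map_vecCons_swap f q p ![]
  have hs : ∀ σ : Equiv.Perm (Fin 4), ((Equiv.Perm.sign (Equiv.permCongr finSumFinEquiv.symm σ :
      Equiv.Perm (Fin 2 ⊕ Fin 2)) : ℤ) : ℝ) *
      permProd a b (Equiv.permCongr finSumFinEquiv.symm σ) ![x, y, z, t] =
      (fun s : ℤˣ × Fin 4 × Fin 4 × Fin 4 × Fin 4 => ((s.1 : ℤ) : ℝ) *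
        (a ![![x, y, z, t] s.2.1, ![x, y, z, t] s.2.2.1] *
          b ![![x, y, z, t] s.2.2.2.1, ![x, y, z, t] s.2.2.2.2]))
        (Equiv.Perm.sign σ, σ 0, σ 1, σ 2, σ 3) := by
    intro σ
    rw [Equiv.Perm.sign_permCongr, permProd]
    congr 3
    · ext i; fin_cases i <;> simp <;> rfl
    · ext i; fin_cases i <;> simp <;> rfl
  rw [Finset.sum_congr rfl fun σ _ => hs σ] at h
  have h4 := h.trans (sum_perm_four fun s => ((s.1 : ℤ) : ℝ) *
    (a ![![x, y, z, t] s.2.1, ![x, y, z, t] s.2.2.1] *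
      b ![![x, y, z, t] s.2.2.2.1, ![x, y, z, t] s.2.2.2.2]))
  simp only [Multiset.insert_eq_cons, Multiset.map_cons, Multiset.map_singleton,
    Multiset.sum_cons, Multiset.sum_singleton, Matrix.cons_val, sw _ x y, sw _ x z, sw _ x t,
    sw _ y z, sw _ y t, sw _ z t, Units.val_one, Units.val_neg, Int.cast_neg, Int.cast_one,
    Nat.factorial_two] at h4
  push_cast at h4
  linear_combination h4 / 4

theorem connection_apply (i j : Fin 2) (v : Fin 1 → Ham) : connection i j v =
    !![cf 1 1 (v 0), 2 * cf 0 2 (v 0); -2 * cf 2 0 (v 0), -cf 1 1 (v 0)] i j := by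
  change -MvPowerSeries.coeff (0 : Fin 2 →₀ ℕ) (MvPowerSeries.pderiv ℝ j (component i (v 0))) = _
  rw [MvPowerSeries.coeff_pderiv]
  have h0 : component 0 (v 0) = -partialDeriv 1 (v 0 : Series) := rfl
  have h1 : component 1 (v 0) = partialDeriv 0 (v 0 : Series) := rfl
  fin_cases i <;> fin_cases j <;>
    simp [h0, h1, partialDeriv, MvPowerSeries.coeff_pderiv, cf_apply, expo]
  · rw [← Finsupp.single_add]
    ring
  · rw [← Finsupp.single_add]
    ring
  · rw [add_comm]

theorem curvature_apply (i j : Fin 2) (v : Fin 2 → Ham) : curvature i j v =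
    -connection i j (fun _ => ⁅v 0, v 1⁆) + ∑ k, (connection i k (fun _ => v 0) *
      connection k j (fun _ => v 1) - connection i k (fun _ => v 1) * connection k j fun _ => v 0) := by
  have h : ∀ u : Fin 1 → Ham, u = fun _ => u 0 := fun u => by
    ext1 m
    rw [Subsingleton.elim m 0]
  have hd : differential 1 (connection i j) v = -connection i j fun _ => ⁅v 0, v 1⁆ := by
    rw [differential_apply]
    simp
    rw [h (Matrix.vecCons _ _)]
    rfl
  simp only [curvature, AlternatingMap.add_apply, hd, Fin.sum_univ_two, wedge_one_one]

theorem elementaryForm_two (p q : ℕ) (v : Fin 2 → Ham) : elementaryForm 2 [p, q] v =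
    cf (decode p).1 (decode p).2 (v 0) * cf (decode q).1 (decode q).2 (v 1) -
      cf (decode q).1 (decode q).2 (v 0) * cf (decode p).1 (decode p).2 (v 1) := by
  rw [elementaryForm_apply, Matrix.det_fin_two]
  simp

theorem continuous_connection (i j : Fin 2) :
    Continuous fun v : Fin 1 → Ham => connection i j v := by
  have h : ∀ a b, Continuous fun v : Fin 1 → Ham => cf a b (v 0) := fun a b =>
    (continuous_cf a b).comp (continuous_apply 0)
  simp only [connection_apply]
  fin_cases i <;> fin_cases j
  · exact h 1 1
  · exact (h 0 2).const_mul 2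
  · exact (h 2 0).const_mul (-2)
  · exact (h 1 1).neg

theorem continuous_curvature (i j : Fin 2) :
    Continuous fun v : Fin 2 → Ham => curvature i j v := by
  have h : ∀ i j, Continuous fun v : Fin 2 → Ham =>
      wedge (connection i 0) (connection 0 j) v := fun i j =>
    continuous_wedge (continuous_connection i 0) (continuous_connection 0 j)
  have h' : ∀ i j, Continuous fun v : Fin 2 → Ham =>
      wedge (connection i 1) (connection 1 j) v := fun i j =>
    continuous_wedge (continuous_connection i 1) (continuous_connection 1 j)
  have h1 := continuous_differential continuous_bracket (continuous_connection i j)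
  simp only [curvature, Fin.sum_univ_two, AlternatingMap.add_apply]
  exact h1.add ((h i j).add (h' i j))

/-- The coefficient at `x ^ m * y ^ n`, with `m + n = 2`, of the bracket of two monomials. -/
theorem cf_bracket_mono {m n a b c d : ℕ} (hmn : m + n = 2) :
    cf m n ⁅mono a b, mono c d⁆ =
      if a + c = m + 1 ∧ b + d = n + 1 then (a : ℝ) * d - b * c else 0 := by
  rw [bracket_mono, map_smul, smul_eq_mul]
  by_cases h0 : a + c - 1 + (b + d - 1) = 0
  · rw [show a + c - 1 = 0 by omega, show b + d - 1 = 0 by omega, mono_zero, map_zero, mul_zero,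
      if_neg (by omega)]
  · rw [cf_mono _ _ _ _ h0]
    split_ifs with h1 h2 h2
    · ring
    · have h3 : (a + c = 0 ∨ b + d = 0) := by omega
      rcases h3 with h3 | h3
      · obtain ⟨rfl, rfl⟩ : a = 0 ∧ c = 0 := by omega
        simp
      · obtain ⟨rfl, rfl⟩ : b = 0 ∧ d = 0 := by omega
        simp
    · omega
    · ring

theorem curvature_eq (i j : Fin 2) : curvature i j =
    !![(-2 : ℝ) • elementaryForm 2 [33, 97] + (2 : ℝ) • elementaryForm 2 [32, 98],
      (-6 : ℝ) • elementaryForm 2 [33, 96] + (2 : ℝ) • elementaryForm 2 [32, 97];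
      (2 : ℝ) • elementaryForm 2 [33, 98] + (-6 : ℝ) • elementaryForm 2 [32, 99],
      (2 : ℝ) • elementaryForm 2 [33, 97] + (-2 : ℝ) • elementaryForm 2 [32, 98]] i j := by
  have he : ∀ (r s : ℝ) (l m : List ℕ), Continuous fun v : Fin 2 → Ham =>
      (r • elementaryForm 2 l + s • elementaryForm 2 m) v := fun r s l m =>
    ((continuous_elementaryForm 2 l).const_mul r).add ((continuous_elementaryForm 2 m).const_mul s)
  have key : ∀ {f g : Ham [⋀^Fin 2]→ₗ[ℝ] ℝ}, (Continuous fun v : Fin 2 → Ham => f v) →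
      (Continuous fun v : Fin 2 → Ham => g v) → (∀ a b c d, a + b ≠ 0 → c + d ≠ 0 →
        f ![mono a b, mono c d] = g ![mono a b, mono c d]) → f = g := by
    intro f g hf hg h
    rw [← sub_eq_zero]
    refine eq_zero_of_mono (hf.sub hg) fun t => ?_
    have ht : (fun i => mono (t i).1 (t i).2) =
        ![mono (t 0).1 (t 0).2, mono (t 1).1 (t 1).2] := by
      ext1 i
      fin_cases i <;> rfl
    by_cases h0 : (t 0).1 + (t 0).2 = 0
    · refine AlternatingMap.map_coord_zero _ 0 ?_
      rw [show (t 0).1 = 0 by omega, show (t 0).2 = 0 by omega, mono_zero]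
    by_cases h1 : (t 1).1 + (t 1).2 = 0
    · refine AlternatingMap.map_coord_zero _ 1 ?_
      rw [show (t 1).1 = 0 by omega, show (t 1).2 = 0 by omega, mono_zero]
    rw [ht, AlternatingMap.sub_apply, h _ _ _ _ h0 h1, sub_self]
  have hc : ∀ i j : Fin 2, ∀ r s : ℝ, ∀ p q p' q' : ℕ,
      (∀ a b c d, a + b ≠ 0 → c + d ≠ 0 → curvature i j ![mono a b, mono c d] =
        (r • elementaryForm 2 [p, q] + s • elementaryForm 2 [p', q']) ![mono a b, mono c d]) →
      curvature i j = r • elementaryForm 2 [p, q] + s • elementaryForm 2 [p', q'] := by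
    intro i j r s p q p' q' h
    exact key (continuous_curvature i j) (he r s _ _) h
  have hz : ∀ {m n a b c d : ℕ}, ¬(a + c = m + 1 ∧ b + d = n + 1) → ∀ p q p' q' : ℕ,
      p + p' = m + 1 → q + q' = n + 1 →
      (if p = a ∧ q = b then (1 : ℝ) else 0) * (if p' = c ∧ q' = d then 1 else 0) = 0 := by
    intro m n a b c d h p q p' q' h1 h2
    split_ifs <;> first | omega | simp
  fin_cases i <;> fin_cases j
  all_goals
    refine hc _ _ _ _ _ _ _ _ fun a b c d h0 h1 => ?_
    rw [curvature_apply, Fin.sum_univ_two]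
    simp only [connection_apply, AlternatingMap.add_apply, AlternatingMap.smul_apply,
      elementaryForm_two, Matrix.cons_val_zero, Matrix.cons_val_one, Fin.zero_eta, Fin.mk_one,
      Matrix.of_apply, Matrix.cons_val', Matrix.cons_val_fin_one, cf_mono _ _ _ _ h0,
      cf_mono _ _ _ _ h1, cf_bracket_mono, decode, Nat.reduceMod, Nat.reduceDiv, Nat.reduceSub,
      Nat.reduceAdd, smul_eq_mul]
  · by_cases hs : a + c = 1 + 1 ∧ b + d = 1 + 1
    · obtain ⟨rfl, rfl⟩ : c = 1 + 1 - a ∧ d = 1 + 1 - b := by omega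
      have ha : a ≤ 2 := by omega
      have hb : b ≤ 2 := by omega
      interval_cases a <;> interval_cases b <;> norm_num
    · have z := hz hs
      rw [if_neg hs]
      linear_combination -4 * z 0 2 2 0 rfl rfl + 4 * z 2 0 0 2 rfl rfl + 2 * z 1 0 1 2 rfl rfl - 2 * z 1
        2 1 0 rfl rfl - 2 * z 0 1 2 1 rfl rfl + 2 * z 2 1 0 1 rfl rfl
  · by_cases hs : a + c = 0 + 1 ∧ b + d = 2 + 1
    · obtain ⟨rfl, rfl⟩ : c = 0 + 1 - a ∧ d = 2 + 1 - b := by omega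
      have ha : a ≤ 1 := by omega
      have hb : b ≤ 3 := by omega
      interval_cases a <;> interval_cases b <;> norm_num
    · have z := hz hs
      rw [if_neg hs]
      linear_combination 4 * z 1 1 0 2 rfl rfl - 4 * z 0 2 1 1 rfl rfl + 6 * z 1 0 0 3 rfl rfl - 6 * z 0
        3 1 0 rfl rfl - 2 * z 0 1 1 2 rfl rfl + 2 * z 1 2 0 1 rfl rfl
  · by_cases hs : a + c = 2 + 1 ∧ b + d = 0 + 1
    · obtain ⟨rfl, rfl⟩ : c = 2 + 1 - a ∧ d = 0 + 1 - b := by omega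
      have ha : a ≤ 3 := by omega
      have hb : b ≤ 1 := by omega
      interval_cases a <;> interval_cases b <;> norm_num
    · have z := hz hs
      rw [if_neg hs]
      linear_combination -4 * z 2 0 1 1 rfl rfl + 4 * z 1 1 2 0 rfl rfl - 2 * z 1 0 2 1 rfl rfl + 2 * z 2
        1 1 0 rfl rfl + 6 * z 0 1 3 0 rfl rfl - 6 * z 3 0 0 1 rfl rfl
  · by_cases hs : a + c = 1 + 1 ∧ b + d = 1 + 1
    · obtain ⟨rfl, rfl⟩ : c = 1 + 1 - a ∧ d = 1 + 1 - b := by omega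
      have ha : a ≤ 2 := by omega
      have hb : b ≤ 2 := by omega
      interval_cases a <;> interval_cases b <;> norm_num
    · have z := hz hs
      rw [if_neg hs]
      linear_combination -4 * z 2 0 0 2 rfl rfl + 4 * z 0 2 2 0 rfl rfl - 2 * z 1 0 1 2 rfl rfl + 2 * z 1
        2 1 0 rfl rfl + 2 * z 0 1 2 1 rfl rfl - 2 * z 2 1 0 1 rfl rfl

theorem wedge_mem_homForms {m n p q : ℕ} {w w' h h' : ℤ} {f : Ham [⋀^Fin p]→ₗ[ℝ] ℝ}
    {g : Ham [⋀^Fin q]→ₗ[ℝ] ℝ} (hf : f ∈ homForms {m} p w h) (hg : g ∈ homForms {n} q w' h') :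
    wedge f g ∈ homForms {m + n} (p + q) (w + w') (h + h') := by
  refine ⟨continuous_wedge hf.1 hg.1, fun t ht => wedge_eq_zero fun σ => ?_⟩
  by_contra h0
  refine ht ?_
  have h1 : IsHomogeneous {m} w h fun i => t (finSumFinEquiv (σ (Sum.inl i))) := by
    by_contra h1
    exact left_ne_zero_of_mul h0 (hf.2 _ h1)
  have h2 : IsHomogeneous {n} w' h' fun i => t (finSumFinEquiv (σ (Sum.inr i))) := by
    by_contra h2
    exact right_ne_zero_of_mul h0 (hg.2 _ h2)
  obtain ⟨f1, f2, f3, f4⟩ := h1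
  obtain ⟨g1, g2, g3, g4⟩ := h2
  have hs : ∀ {R : Type} [AddCommMonoid R] (F : Fin (p + q) → R), ∑ i, F i =
      ∑ i, F (finSumFinEquiv (σ (Sum.inl i))) + ∑ i, F (finSumFinEquiv (σ (Sum.inr i))) := by
    intro R _ F
    rw [← Equiv.sum_comp (σ.trans finSumFinEquiv), Fintype.sum_sum_type]
    rfl
  refine ⟨fun i => ?_, ?_, ?_, ?_⟩
  · obtain ⟨s, rfl⟩ := (σ.trans finSumFinEquiv).surjective i
    rcases s with s | s
    · exact f1 s
    · exact g1 s
  · rw [Finset.mem_singleton, Finset.card_filter] at f2 g2 ⊢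
    rw [hs, f2, g2]
  · rw [hs, f3, g3]
  · rw [hs, f4, g4]

theorem curvature_mem (i j : Fin 2) :
    curvature i j ∈ homForms {1} 2 0 (!![0, -2; 2, 0] i j) := by
  have h : ∀ {h : ℤ} {l m : List ℕ} (r s : ℝ), IsHomList {1} 2 0 h l → IsHomList {1} 2 0 h m →
      r • elementaryForm 2 l + s • elementaryForm 2 m ∈ homForms {1} 2 0 h := fun r s hl hm =>
    Submodule.add_mem _ (Submodule.smul_mem _ _ (elementaryForm_mem hl))
      (Submodule.smul_mem _ _ (elementaryForm_mem hm))
  rw [curvature_eq]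
  fin_cases i <;> fin_cases j <;> exact h _ _ (by decide) (by decide)

theorem pontrjagin_mem_homForms : pontrjagin ∈ homForms {2} 4 0 0 := by
  refine Submodule.smul_mem _ _ (Submodule.sum_mem _ fun i _ => Submodule.sum_mem _ fun j _ => ?_)
  have h := wedge_mem_homForms (curvature_mem i j) (curvature_mem j i)
  have h0 : (!![0, -2; 2, 0] i j : ℤ) + !![0, -2; 2, 0] j i = 0 := by
    fin_cases i <;> fin_cases j <;> rfl
  rwa [h0] at h

theorem onList_four (f : Ham [⋀^Fin 4]→ₗ[ℝ] ℝ) (p q r s : ℕ) :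
    onList 4 f [p, q, r, s] = f ![codeMono p, codeMono q, codeMono r, codeMono s] := rfl

theorem cf_codeMono (a b : ℕ) {p : ℕ} (hp : p % 32 ≠ 0 ∨ p / 32 ≠ 0) :
    cf a b (codeMono p) = if a = p % 32 ∧ b = p / 32 - p % 32 then 1 else 0 := by
  rw [codeMono, decode, cf_mono _ _ _ _ (by dsimp only; omega)]

theorem pontrjagin_values :
    onList 4 pontrjagin [32, 33, 97, 98] = 3 / Real.pi ^ 2 ∧
    onList 4 pontrjagin [32, 33, 96, 99] = -9 / Real.pi ^ 2 := by
  constructor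
  all_goals
    rw [onList_four, pontrjagin, AlternatingMap.smul_apply]
    simp only [Fin.sum_univ_two, AlternatingMap.add_apply, wedge_two_two, curvature_eq,
      Matrix.cons_val_zero, Matrix.cons_val_one, 
      Matrix.of_apply, Matrix.cons_val', Matrix.cons_val_fin_one, AlternatingMap.smul_apply,
      elementaryForm_two, decode, Nat.reduceMod, Nat.reduceDiv, Nat.reduceSub]
    norm_num [cf_codeMono]
    try ring

theorem pontrjagin_mem : pontrjagin ∈ invariantForms {2} 4 0 := by
  refine ⟨pontrjagin_mem_homForms, LinearMap.mem_ker.mpr ?_⟩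
  refine homForms_ext (A := {2}) (w := 0) (h := 0 - 2) (by simp) (by norm_num)
    (lower_mem pontrjagin_mem_homForms) fun l hl => ?_
  have h0 : twoLinearLists 4 0 (0 - 2) = [[32, 33, 96, 98]] := by decide +kernel
  rw [isHomList_two (by norm_num), h0, List.mem_singleton] at hl
  subst hl
  have h1 : onList 4 pontrjagin [33, 33, 96, 98] = 0 := by
    rw [onList_four]
    exact pontrjagin.map_eq_zero_of_eq _ (i := 0) (j := 1) rfl (by simp)
  have h2 : bracketCoeff 66 32 = 2 ∧ bracketCoeff 66 33 = 0 ∧ bracketCoeff 66 96 = 6 ∧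
    bracketCoeff 66 98 = 2 := by decide
  rw [lower, ← codeMono_66, onList_act (k := 4) (l := [32, 33, 96, 98]) pontrjagin
    (by simp [IsCode]) (by simp [IsCode]) rfl]
  simp only [listAct, h2, Nat.reduceAdd, Nat.reduceSub, pontrjagin_values, h1]
  push_cast
  ring

theorem pontrjagin_ne_zero : pontrjagin ≠ 0 := fun h => by
  have h1 := pontrjagin_values.1
  rw [h, ← onListLM_apply, map_zero] at h1
  have h2 : (0 : ℝ) < 3 / Real.pi ^ 2 := by positivity
  exact h2.ne h1

theorem omega_ne_zero : omega ≠ 0 := fun h => by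
  have h1 := congrArg (fun f => f ![mono 1 0, mono 0 1]) h
  simp only [omega_apply, Matrix.cons_val_zero, Matrix.cons_val_one,
    cf_mono _ _ 1 0 (by simp), cf_mono _ _ 0 1 (by simp)] at h1
  simp at h1

/-! ### The product with the symplectic form on cohomology -/

variable {k : ℕ} {w : ℤ}

theorem wedgeOmega_mem_cocycles (hw : w ≤ 10) {z : ham0 [⋀^Fin k]→ₗ[ℝ] ℝ}
    (hz : z ∈ cocycles sp0 weightPart0 k w) :
    wedgeOmega z ∈ cocycles sp weightPart (k + 2) (w - 2) := by
  refine ⟨wedgeOmega_mem_cochains hz.1, LinearMap.mem_ker.mpr ?_⟩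
  rw [differential_wedgeOmega hw hz.1, LinearMap.mem_ker.mp hz.2]
  exact map_zero (wedgeOmegaLM (k + 1))

theorem wedgeOmega_mem_coboundaries (hw : w ≤ 10) {z : ham0 [⋀^Fin k]→ₗ[ℝ] ℝ}
    (hz : z ∈ coboundaries sp0 weightPart0 k w) :
    wedgeOmega z ∈ coboundaries sp weightPart (k + 2) (w - 2) := by
  cases k with
  | zero =>
    rw [(Submodule.mem_bot ℝ).mp hz, ← wedgeOmegaLM_apply, map_zero]
    exact zero_mem _
  | succ k => exact map_coboundaries_le hw ⟨z, hz, rfl⟩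

/-- The product with the symplectic form, on cocycles. -/
def wedgeOmegaCocycles (k : ℕ) (hw : w ≤ 10) :
    cocycles sp0 weightPart0 k w →ₗ[ℝ] cocycles sp weightPart (k + 2) (w - 2) :=
  (wedgeOmegaLM k).restrict fun _ hz => wedgeOmega_mem_cocycles hw hz

/-- The product with the symplectic form, on cohomology. -/
def wedgeOmegaCohomology (k : ℕ) (hw : w ≤ 10) :
    LeafCohomology k w →ₗ[ℝ] HamCohomology (k + 2) (w - 2) :=
  Submodule.mapQ _ _ (wedgeOmegaCocycles k hw) fun _ hz => wedgeOmega_mem_coboundaries hw hz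

theorem isWedgeOmega_wedgeOmegaCohomology (k : ℕ) (hw : w ≤ 10) :
    IsWedgeOmega (wedgeOmegaCohomology k hw) :=
  fun _ hz => ⟨wedgeOmega_mem_cocycles hw hz, rfl⟩

/-- If the product with the symplectic form reflects exactness, and the source and the target have
dimension one and at most one, then it is an isomorphism on cohomology. -/
theorem bijective_wedgeOmegaCohomology (hw : w ≤ 10)
    (h : ∀ z ∈ cocycles sp0 weightPart0 k w,
      wedgeOmega z ∈ coboundaries sp weightPart (k + 2) (w - 2) →
        z ∈ coboundaries sp0 weightPart0 k w)
    (h1 : Module.finrank ℝ (LeafCohomology k w) = 1)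
    (h2 : Module.finrank ℝ (HamCohomology (k + 2) (w - 2)) ≤ 1) :
    Function.Bijective (wedgeOmegaCohomology k hw) ∧
      Module.finrank ℝ (HamCohomology (k + 2) (w - 2)) = 1 := by
  have := finiteDimensional_leafCochains (k := k) hw
  have := finiteDimensional_hamCochains (k := k + 2) (w := w - 2) (by linarith)
  have := finiteDimensional_cohomology (K := sp0) (W := weightPart0) (w := w) k
  have := finiteDimensional_cohomology (K := sp) (W := weightPart) (w := w - 2) (k + 2)
  have hinj : Function.Injective (wedgeOmegaCohomology k hw) := by
    rw [injective_iff_map_eq_zero]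
    intro a ha
    obtain ⟨z, rfl⟩ := Submodule.Quotient.mk_surjective _ a
    have ha' : (Submodule.Quotient.mk (wedgeOmegaCocycles k hw z) :
      HamCohomology (k + 2) (w - 2)) = 0 := ha
    rw [Submodule.Quotient.mk_eq_zero] at ha' ⊢
    exact h z.1 z.2 ha'
  have h3 := LinearMap.finrank_le_finrank_of_injective (R := ℝ) hinj
  have h4 : Module.finrank ℝ (HamCohomology (k + 2) (w - 2)) = 1 := by omega
  exact ⟨⟨hinj, (LinearMap.injective_iff_surjective_of_finrank_eq_finrank (h1.trans h4.symm)).mp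
    hinj⟩, h4⟩

theorem exists_isWedgeOmega (hw : w ≤ 10) {w' : ℤ} (hw' : w' = w - 2)
    (h : ∀ z : ham0 [⋀^Fin k]→ₗ[ℝ] ℝ, wedgeOmega z ∈ coboundaries sp weightPart (k + 2) w' →
      z ∈ coboundaries sp0 weightPart0 k w)
    (h1 : Module.finrank ℝ (LeafCohomology k w) = 1)
    (h2 : Module.finrank ℝ (HamCohomology (k + 2) w') ≤ 1) :
    ∃ e : LeafCohomology k w →ₗ[ℝ] HamCohomology (k + 2) w', IsWedgeOmega e ∧
      Function.Bijective e ∧ Module.finrank ℝ (HamCohomology (k + 2) w') = 1 := by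
  subst hw'
  exact ⟨wedgeOmegaCohomology k hw, isWedgeOmega_wedgeOmegaCohomology k hw,
    bijective_wedgeOmegaCohomology hw (fun z _ => h z) h1 h2⟩

theorem mem_coboundaries_of_eq_bot {w' : ℤ} (hB : coboundaries sp weightPart (k + 2) w' = ⊥)
    (z : ham0 [⋀^Fin k]→ₗ[ℝ] ℝ) (hz : wedgeOmega z ∈ coboundaries sp weightPart (k + 2) w') :
    z ∈ coboundaries sp0 weightPart0 k w := by
  rw [hB, Submodule.mem_bot, ← wedgeOmegaLM_apply] at hz
  rw [wedgeOmegaLM_injective (hz.trans (map_zero _).symm)]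
  exact zero_mem _

theorem finrank_hamCohomology_le (hw : w ≤ 10) {n : ℕ} (h : hamDim k w = n) :
    Module.finrank ℝ (HamCohomology k w) ≤ n := by
  have := finrank_hamCohomology (k := k) hw
  omega

theorem mem_coboundaries_five (z : ham0 [⋀^Fin 5]→ₗ[ℝ] ℝ)
    (hz : wedgeOmega z ∈ coboundaries sp weightPart 7 8) :
    z ∈ coboundaries sp0 weightPart0 5 10 := by
  have := finiteDimensional_leafCochains (k := 4) (w := 10) (by norm_num)
  have := finiteDimensional_coboundaries (K := sp0) (W := weightPart0) (w := 10) 4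
  have h1 := length_add_finrank_le_hamRank (k := 5) (w := 8) (by norm_num) certified_hamSixEight
    (N := coboundaries sp0 weightPart0 5 10 ⊔ Submodule.span ℝ {z}) (by
      rw [Submodule.map_sup, Submodule.map_span, Set.image_singleton]
      exact sup_le (map_coboundaries_le (k := 4) (w := 10) (by norm_num))
        (Submodule.span_le.mpr (Set.singleton_subset_iff.mpr hz)))
  have h2 : Module.finrank ℝ (coboundaries sp0 weightPart0 5 10) = 7 := leafRank_ten.2.1
  have h3 : hamRank 7 8 = 9 := hamRank_eight.1
  have h4 : hamSixEight.length = 2 := rfl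
  have h5 : coboundaries sp0 weightPart0 5 10 =
      coboundaries sp0 weightPart0 5 10 ⊔ Submodule.span ℝ {z} := by
    refine Submodule.eq_of_le_of_finrank_le le_sup_left ?_
    simp only [Nat.reduceAdd] at h1
    omega
  rw [h5]
  exact Submodule.mem_sup_right (Submodule.mem_span_singleton_self z)

theorem span_cohomologyClass {K : LieSubalgebra ℝ Ham} {W : ℤ → Submodule ℝ Ham}
    (h1 : Module.finrank ℝ (Cohomology K W k w) = 1) (hB : coboundaries K W k w = ⊥)
    {z : Ham [⋀^Fin k]→ₗ[ℝ] ℝ} (hz : z ∈ cocycles K W k w) (h0 : z ≠ 0) :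
    Submodule.span ℝ {(cohomologyClass z hz : Cohomology K W k w)} = ⊤ := by
  refine (finrank_eq_one_iff_of_nonzero _ fun h => h0 ?_).mp h1
  rw [cohomologyClass, Submodule.Quotient.mk_eq_zero] at h
  have h2 : z ∈ coboundaries K W k w := h
  rwa [hB, Submodule.mem_bot] at h2

theorem coboundaries_eq_bot (hw : w ≤ 10) (h : hamDim k w = 0) :
    coboundaries sp weightPart (k + 1) w = ⊥ := by
  have := finiteDimensional_hamCochains (k := k) hw
  rw [← finrank_hamCochains hw, Submodule.finrank_eq_zero] at h
  change (cochains sp weightPart k w).map (differential k) = ⊥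
  rw [h, Submodule.map_bot]

theorem mem_cocycles_of_hamDim (hw : w ≤ 10) (h : hamDim (k + 1) w = 0)
    {z : Ham [⋀^Fin k]→ₗ[ℝ] ℝ} (hz : z ∈ cochains sp weightPart k w) :
    z ∈ cocycles sp weightPart k w := by
  have := finiteDimensional_hamCochains (k := k + 1) hw
  rw [← finrank_hamCochains hw, Submodule.finrank_eq_zero] at h
  refine ⟨hz, LinearMap.mem_ker.mpr ?_⟩
  have h1 := differential_mem_ham hz
  rwa [h, Submodule.mem_bot] at h1

end GelfandFuks

end

theorem mainTheorem1 :
    -- the leaf cohomology in weights at most ten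
    (∀ (k : ℕ) (w : ℤ), w ≤ 10 → (k, w) ≠ (0, 0) → (k, w) ≠ (2, 2) → (k, w) ≠ (5, 10) →
      Subsingleton (LeafCohomology k w)) ∧
    Module.finrank ℝ (LeafCohomology 0 0) = 1 ∧
    Module.finrank ℝ (LeafCohomology 2 2) = 1 ∧
    Module.finrank ℝ (LeafCohomology 5 10) = 1 ∧
    -- degree 0, weight 0: the target is one-dimensional, spanned by the class of `ω`
    (∃ e : LeafCohomology 0 0 →ₗ[ℝ] HamCohomology 2 (-2),
      IsWedgeOmega e ∧ Function.Bijective e ∧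
      Module.finrank ℝ (HamCohomology 2 (-2)) = 1 ∧
      ∃ h : omega ∈ cocycles sp weightPart 2 (-2),
        Submodule.span ℝ {(cohomologyClass omega h : HamCohomology 2 (-2))} = ⊤) ∧
    -- degree 2, weight 2: the target is one-dimensional, spanned by `p₁`, and `p₁ = γ₁ ∧ ω`
    (∃ e : LeafCohomology 2 2 →ₗ[ℝ] HamCohomology 4 0,
      IsWedgeOmega e ∧ Function.Bijective e ∧
      Module.finrank ℝ (HamCohomology 4 0) = 1 ∧
      ∃ h : pontrjagin ∈ cocycles sp weightPart 4 0,
        Submodule.span ℝ {(cohomologyClass pontrjagin h : HamCohomology 4 0)} = ⊤ ∧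
        ∃! γ₁ : LeafCohomology 2 2, e γ₁ = cohomologyClass pontrjagin h) ∧
    -- degree 5, weight 10: the target is one-dimensional, and its generator is `GKF = η ∧ ω`
    (∃ e : LeafCohomology 5 10 →ₗ[ℝ] HamCohomology 7 8,
      IsWedgeOmega e ∧ Function.Bijective e ∧
      Module.finrank ℝ (HamCohomology 7 8) = 1 ∧
      ∀ GKF : HamCohomology 7 8, Submodule.span ℝ {GKF} = ⊤ →
        ∃! η : LeafCohomology 5 10, e η = GKF) := by
  refine ⟨fun k w hw h0 h2 h5 => ?_, finrank_leafCohomology_zero, finrank_leafCohomology_two,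
    finrank_leafCohomology_five, ?_, ?_, ?_⟩
  · have := finiteDimensional_leafCochains (k := k) hw
    have := finiteDimensional_cohomology (K := sp0) (W := weightPart0) (w := w) k
    exact Module.finrank_zero_iff.mp (finrank_leafCohomology_eq_zero hw h0 h2 h5)
  · have hB : coboundaries sp weightPart 2 (-2) = ⊥ :=
      coboundaries_eq_bot (by norm_num) (by decide +kernel)
    obtain ⟨e, h1, h2, h3⟩ := exists_isWedgeOmega (k := 0) (w := 0) (w' := -2) (by norm_num)
      (by norm_num) (mem_coboundaries_of_eq_bot hB) finrank_leafCohomology_zero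
      (finrank_hamCohomology_le (by norm_num) (by decide +kernel))
    have hz : omega ∈ cocycles sp weightPart 2 (-2) :=
      mem_cocycles_of_hamDim (by norm_num) (by decide +kernel) omega_mem_cochains
    exact ⟨e, h1, h2, h3, hz, span_cohomologyClass h3 hB hz omega_ne_zero⟩
  · have hB : coboundaries sp weightPart 4 0 = ⊥ :=
      coboundaries_eq_bot (by norm_num) (by decide +kernel)
    obtain ⟨e, h1, h2, h3⟩ := exists_isWedgeOmega (k := 2) (w := 2) (w' := 0) (by norm_num)
      (by norm_num) (mem_coboundaries_of_eq_bot hB) finrank_leafCohomology_two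
      (finrank_hamCohomology_le (by norm_num) (by decide +kernel))
    have hz : pontrjagin ∈ cocycles sp weightPart 4 0 :=
      mem_cocycles_of_hamDim (by norm_num) (by decide +kernel)
        (mem_cochains_of_mem_invariantForms pontrjagin_mem)
    exact ⟨e, h1, h2, h3, hz, span_cohomologyClass h3 hB hz pontrjagin_ne_zero,
      h2.existsUnique _⟩
  · obtain ⟨e, h1, h2, h3⟩ := exists_isWedgeOmega (k := 5) (w := 10) (w' := 8) (by norm_num)
      (by norm_num) mem_coboundaries_five finrank_leafCohomology_five hamRank_eight.2
    exact ⟨e, h1, h2, h3, fun GKF _ => h2.existsUnique GKF⟩
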